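/- **Setting.** For each index $k$ (usually suppressed) we observe $Y=X\beta+\varepsilon$, with $X$ a deterministic $n\times p$ matrix, $\varepsilon$ standard normal in $\mathbb R^n$, and $p=p_k\to\infty$ ($n=n_k$ arbitrary). Write $S_\beta=\{i:\beta_i\ne0\}$, $\beta_S=(\beta_i)_{i\in S}$, $X_S$ for the submatrix of the columns of $X$ with index in $S$, $\|X\|=\max_i\|X_{\cdot,i}\|_2$ and $\bar\lambda=2\|X\|\sqrt{\log p}$. The prior $\Pi$ draws a dimension $s$ from a probability distribution $\pi_p$ on $\{0,\dots,p\}$, then a uniformly random set $S\subset\{1,\dots,p\}$ with $|S|=s$, then independent coordinates $\beta_i$, $i\in S$, with Laplace density $\frac{\lambda}{2}e^{-\lambda|x|}$, and sets $\beta_{S^c}=0$. The posterior is $\Pi[B\mid Y]=\int_B e^{-\|Y-X\beta\|_2^2/2}\,d\Pi(\beta)\big/\int e^{-\|Y-X\beta\|_2^2/2}\,d\Pi(\beta)$. With infima over empty sets equal to $+\infty$ and $1/\infty=0$, put $$\phi(S)=\inf\Big\{\frac{\|X\beta\|_2|S|^{1/2}}{\|X\|\,\|\beta_S\|_1}:\|\beta_{S^c}\|_1\le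 7\|\beta_S\|_1,\ \beta_S\ne0\Big\},\qquad \widetilde\phi(t)=\inf\Big\{\frac{\|X\beta\|_2}{\|X\|\,\|\beta\|_2}:0\ne|S_\beta|\le t\Big\},$$ $$\widetilde\psi(S)=\widetilde\phi\Big(\Big(2+\frac3{A_4}+\frac{33}{\phi(S)^2}\frac{\lambda}{\bar\lambda}\Big)|S|\Big),\qquad \widetilde{\mathrm B}=\Big\{\beta:\ |\beta_i|\ge\frac{M}{\widetilde\psi(S_\beta)^2}\frac{\sqrt{|S_\beta|\log p}}{\|X\|\,\phi(S_\beta)}\ \text{ for all } i\in S_\beta\Big\}.$$ **Corollary 2.** Let $A_1,A_2,A_3>0$ and $A_4>1$. There is a constant $M_0$, depending only on $A_1,\dots,A_4$, such that the following holds for every $M\ge M_0$. Suppose that, along the sequence, $\lambda>0$, $\|X\|/p\le\lambda\le2\bar\lambda$, and $A_1p^{-A_3}\pi_p(s-1)\le\pi_p(s)\le A_2p^{-A_4}\pi_p(s-1)$ for $s=1,\dots,p$. Let $a<A_4-1$, and let the real numbers $s_n$ satisfy $s_n\le p^a$ and $s_n\lambda\sqrt{\log p}/\|X\|\to0$. For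 each $S$ and $Y$ let $\widehat\beta_{(S)}$ be any least squares estimator, $\widehat\beta_{(S)}\in\operatorname{argmin}_{b\in\mathbb R^S}\|Y-X_Sb\|_2^2$. Then for every $c_0>0$, writing $S_0=S_{\beta^0}$, $$\sup_{\substack{\beta^0\in\widetilde{\mathrm B}:\ \phi(S_0)\ge c_0,\\ |S_0|\le s_n,\ \widetilde\psi(S_0)\ge c_0}}\mathbb E_{\beta^0}\Big\|\Pi(\cdot\mid Y)-\mathcal N\big(\widehat\beta_{(S_0)},(X_{S_0}^tX_{S_0})^{-1}\big)\otimes\delta_{S_0^c}\Big\|_{TV}\to0,$$ where $\mathbb E_{\beta^0}$ is the expectation under $Y\sim\mathcal N(X\beta^0,I)$, $\|\cdot\|_{TV}$ is the total variation distance, $\delta_{S_0^c}$ is the Dirac measure at $0\in\mathbb R^{S_0^c}$, and a supremum over the empty set is $0$. -/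

import Mathlib

open MeasureTheory ProbabilityTheory Filter Topology
open scoped ENNReal Matrix

noncomputable section

namespace SparseRegression

variable {n p : ℕ}

/-- The predictive vector `X β`. -/
def predict (X : Matrix (Fin n) (Fin p) ℝ) (β : EuclideanSpace ℝ (Fin p)) :
    EuclideanSpace ℝ (Fin n) :=
  WithLp.toLp 2 (X *ᵥ β.ofLp)

/-- The support `S_β = {i : β_i ≠ 0}`. -/
def supp (β : EuclideanSpace ℝ (Fin p)) : Finset (Fin p) :=
  Finset.univ.filter fun i => β i ≠ 0

/-- `‖β_S‖₁ = ∑_{i ∈ S} |β_i|`. -/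
def l1On (S : Finset (Fin p)) (β : EuclideanSpace ℝ (Fin p)) : ℝ :=
  ∑ i ∈ S, |β i|

/-- `‖X‖`, the largest Euclidean length of a column of `X`. -/
def colNorm (X : Matrix (Fin n) (Fin p) ℝ) : ℝ :=
  ⨆ i : Fin p, Real.sqrt (∑ j : Fin n, X j i ^ 2)

/-- `λ̄ = 2 ‖X‖ √(log p)`. -/
def lamBar (X : Matrix (Fin n) (Fin p) ℝ) : ℝ :=
  2 * colNorm X * Real.sqrt (Real.log p)

/-- The range of the scale parameter: `‖X‖ / p ≤ λ ≤ 2 λ̄`, with `λ > 0` because `λ` is the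
(inverse) scale of a Laplace density. -/
def LambdaRange (X : Matrix (Fin n) (Fin p) ℝ) (lam : ℝ) : Prop :=
  0 < lam ∧ colNorm X / p ≤ lam ∧ lam ≤ 2 * lamBar X

/-- `π` is (the probability mass function of) a probability distribution on `{0, …, p}`. -/
def IsDimPrior (p : ℕ) (π : ℕ → ℝ) : Prop :=
  (∀ s ≤ p, 0 ≤ π s) ∧ ∑ s ∈ Finset.range (p + 1), π s = 1

/-- `A₁ p^{-A₃} π(s-1) ≤ π(s) ≤ A₂ p^{-A₄} π(s-1)` for `s = 1, …, p`
(written with `s + 1` for `s`). -/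
def DimPriorDecay (A₁ A₂ A₃ A₄ : ℝ) (p : ℕ) (π : ℕ → ℝ) : Prop :=
  ∀ s < p, A₁ * (p : ℝ) ^ (-A₃) * π s ≤ π (s + 1) ∧
    π (s + 1) ≤ A₂ * (p : ℝ) ^ (-A₄) * π s

/-- The compatibility number `φ(S)`; an infimum over the empty set is `∞`. -/
def compat (X : Matrix (Fin n) (Fin p) ℝ) (S : Finset (Fin p)) : ℝ≥0∞ :=
  ⨅ (β : EuclideanSpace ℝ (Fin p)) (_ : l1On Sᶜ β ≤ 7 * l1On S β) (_ : ∃ i ∈ S, β i ≠ 0),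
    ENNReal.ofReal (‖predict X β‖ * Real.sqrt S.card / (colNorm X * l1On S β))

/-- The smallest scaled sparse singular value `φ̃(t)`, the infimum of `‖Xβ‖₂ / (‖X‖ ‖β‖₂)` over
`0 ≠ |S_β| ≤ t`; an infimum over the empty set is `∞`. -/
def sparseSing (X : Matrix (Fin n) (Fin p) ℝ) (t : ℝ≥0∞) : ℝ≥0∞ :=
  ⨅ (β : EuclideanSpace ℝ (Fin p)) (_ : (supp β).card ≠ 0) (_ : ((supp β).card : ℝ≥0∞) ≤ t),
    ENNReal.ofReal (‖predict X β‖ / (colNorm X * ‖β‖))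

/-- `ψ̃(S) = φ̃((2 + 3/A₄ + (33/φ(S)²)(λ/λ̄)) |S|)`. -/
def psiTilde (X : Matrix (Fin n) (Fin p) ℝ) (lam A₄ : ℝ) (S : Finset (Fin p)) : ℝ≥0∞ :=
  sparseSing X
    ((2 + ENNReal.ofReal (3 / A₄) + 33 / compat X S ^ 2 * ENNReal.ofReal (lam / lamBar X)) *
      (S.card : ℝ≥0∞))

/-- The class `B̃` of vectors whose nonzero coordinates are, in absolute value, at least
`(M / ψ̃(S_β)²) √(|S_β| log p) / (‖X‖ φ(S_β))`. -/
def betaMin (X : Matrix (Fin n) (Fin p) ℝ) (lam A₄ M : ℝ) : Set (EuclideanSpace ℝ (Fin p)) :=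
  {β | ∀ i ∈ supp β,
    ENNReal.ofReal M / psiTilde X lam A₄ (supp β) ^ 2 *
        (ENNReal.ofReal (Real.sqrt ((supp β).card * Real.log p)) /
          (ENNReal.ofReal (colNorm X) * compat X (supp β))) ≤
      ENNReal.ofReal |β i|}

/-- The parameters over which the supremum is taken: `β ∈ B̃`, `φ(S_β) ≥ c₀`, `|S_β| ≤ s`,
`ψ̃(S_β) ≥ c₀`. -/
def paramClass (X : Matrix (Fin n) (Fin p) ℝ) (lam A₄ M c₀ s : ℝ) :
    Set (EuclideanSpace ℝ (Fin p)) :=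
  {β | β ∈ betaMin X lam A₄ M ∧ ENNReal.ofReal c₀ ≤ compat X (supp β) ∧
    ((supp β).card : ℝ) ≤ s ∧ ENNReal.ofReal c₀ ≤ psiTilde X lam A₄ (supp β)}

/-- The Laplace distribution, with density `x ↦ (λ/2) exp(-λ|x|)`. -/
def laplace (lam : ℝ) : Measure ℝ :=
  volume.withDensity fun x => ENNReal.ofReal (lam / 2 * Real.exp (-lam * |x|))

/-- Extension of a vector in `ℝ^S` by zero to `ℝ^p`. A law on `ℝ^S` pushed forward by this map is
the product of that law with the Dirac measure at `0 ∈ ℝ^{Sᶜ}`. -/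
def zeroExtend (S : Finset (Fin p)) (b : S → ℝ) : EuclideanSpace ℝ (Fin p) :=
  WithLp.toLp 2 fun i => if h : i ∈ S then b ⟨i, h⟩ else 0

/-- The prior `Π` on `β`: a dimension `s ~ π`, a uniformly chosen set `S` of size `s`, independent
Laplace coordinates on `S`, and zeros outside `S`. -/
def prior (π : ℕ → ℝ) (lam : ℝ) : Measure (EuclideanSpace ℝ (Fin p)) :=
  ∑ S : Finset (Fin p), ENNReal.ofReal (π S.card / (p.choose S.card : ℝ)) •
    (Measure.pi fun _ : S => laplace lam).map (zeroExtend S)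

/-- The likelihood `exp(-‖Y - Xβ‖₂²/2)`, up to a constant. -/
def likelihood (X : Matrix (Fin n) (Fin p) ℝ) (Y : EuclideanSpace ℝ (Fin n))
    (β : EuclideanSpace ℝ (Fin p)) : ℝ≥0∞ :=
  ENNReal.ofReal (Real.exp (-‖Y - predict X β‖ ^ 2 / 2))

/-- The posterior distribution `Π(· | Y)` given by Bayes's formula. -/
def posterior (X : Matrix (Fin n) (Fin p) ℝ) (π : ℕ → ℝ) (lam : ℝ)
    (Y : EuclideanSpace ℝ (Fin n)) : Measure (EuclideanSpace ℝ (Fin p)) :=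
  (∫⁻ β, likelihood X Y β ∂(prior π lam))⁻¹ • (prior π lam).withDensity (likelihood X Y)

/-- The submatrix `X_S` of the columns of `X` with index in `S`. -/
def colSub (X : Matrix (Fin n) (Fin p) ℝ) (S : Finset (Fin p)) : Matrix (Fin n) S ℝ :=
  X.submatrix id Subtype.val

/-- `b` is a least squares estimator in the model `Y = X_S β_S + ε`, that is, a minimizer of
`‖Y - X_S b‖₂²`. -/
def IsLeastSquares (X : Matrix (Fin n) (Fin p) ℝ) (S : Finset (Fin p))
    (Y : EuclideanSpace ℝ (Fin n)) (b : EuclideanSpace ℝ S) : Prop :=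
  IsMinOn (fun b' : EuclideanSpace ℝ S => ‖Y - WithLp.toLp 2 (colSub X S *ᵥ b'.ofLp)‖ ^ 2)
    Set.univ b

/-- The law `N(b, (X_Sᵀ X_S)⁻¹) ⊗ δ_{Sᶜ}` on `ℝ^p`. -/
def normalOnModel (X : Matrix (Fin n) (Fin p) ℝ) (S : Finset (Fin p)) (b : EuclideanSpace ℝ S) :
    Measure (EuclideanSpace ℝ (Fin p)) :=
  (multivariateGaussian b ((colSub X S)ᵀ * colSub X S)⁻¹).map fun b' => zeroExtend S b'.ofLp

/-- The law of `Y = X β + ε` with `ε` standard normal, that is, `N(Xβ, I)`. -/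
def dataLaw (X : Matrix (Fin n) (Fin p) ℝ) (β : EuclideanSpace ℝ (Fin p)) :
    Measure (EuclideanSpace ℝ (Fin n)) :=
  multivariateGaussian (predict X β) 1

/-- The total variation distance `sup_B |μ(B) - ν(B)|` of two probability measures. -/
def tvDist {E : Type*} [MeasurableSpace E] (μ ν : Measure E) : ℝ≥0∞ :=
  ⨆ (B : Set E) (_ : MeasurableSet B), max (μ B - ν B) (ν B - μ B)

end SparseRegression

end

open SparseRegression

/-! The posterior is a mixture over models `S`, and the normal law is the normalization of an
explicit measure G: on the true model S₀, the prior weight of S₀ times the likelihood times the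
Laplace density frozen at its value at β⁰ (`approxMeasure`, `normalOnModel_eq`). By
`tvDist_normalize_le` two estimates suffice. The unnormalized posterior must dominate exp(-δ) G on a
neighbourhood N of the truth in prediction norm. Its total mass must be at most (exp δ + η) G(ℝ^p),
with G(Nᶜ) relatively small. The first holds because log of the Laplace density varies by at most δ
≍ s λ √(log p) / ‖X‖ on N ∩ ℝ^{S₀}.

For the total mass, the contribution of each model is divided by the mass of G, on the event that
the noise correlates with no column by more than λ̄.

Large models, |S| > (1 + 3/A₄)|S₀|: averaging over the noise before integrating over β, and using
the compatibility condition, bounds the expected ratio by a factor 4^{|S|} over a polynomial floor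
(`lintegral_noiseEvent_mass_le`). The decay of the dimension prior beats this (`sum_large_le`).

Other models, outside N: the quadratic term of the log likelihood dominates the noise, giving a
factor p^{-K²|S₀|/4} (`moderate_exponent_le`).

Other models, inside N: the lower bound on the nonzero coordinates forces S ⊇ S₀. The model S₀
contributes at most exp δ times the mass of G. For a strict supermodel, integrating out the
coordinates in S₀ leaves the evidence of S₀ at shifted data. The ratio of shifted to unshifted
evidence is a Gaussian exponential of mean one (`lintegral_evidence_ratio_le`), so on average the
supermodel gains at most exp δ times its prior odds, and these odds sum to a quantity of order |S₀|
p^{-A₄} when this is small (`sum_supersets_le`). -/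

noncomputable section

namespace SparseRegression

/-! ### Integrals of products and densities under product measures -/

section ProductMeasures

variable {ι : Type*}

theorem lmarginal_prod [DecidableEq ι] {α : ι → Type*} [∀ i, MeasurableSpace (α i)]
    (μ : ∀ i, Measure (α i)) [∀ i, SigmaFinite (μ i)] (f : ∀ i, α i → ℝ≥0∞)
    (hf : ∀ i, Measurable (f i)) (s : Finset ι) (x : ∀ i, α i) :
    lmarginal μ s (fun y => ∏ i ∈ s, f i (y i)) x = ∏ i ∈ s, ∫⁻ t, f i t ∂(μ i) := by
  induction s using Finset.induction_on generalizing x with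
  | empty => simp
  | insert i s hi ih =>
    have hm : Measurable fun y : ∀ i, α i => ∏ j ∈ insert i s, f j (y j) :=
      Finset.measurable_prod _ fun j _ => (hf j).comp (measurable_pi_apply j)
    have hm' : Measurable fun y : ∀ i, α i => ∏ j ∈ s, f j (y j) :=
      Finset.measurable_prod _ fun j _ => (hf j).comp (measurable_pi_apply j)
    rw [lmarginal_insert _ hm hi, Finset.prod_insert hi, ← ih x]
    have key : ∀ t, lmarginal μ s (fun y => ∏ j ∈ insert i s, f j (y j)) (Function.update x i t) =
        f i t * lmarginal μ s (fun y => ∏ j ∈ s, f j (y j)) x := by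
      intro t
      rw [ih x, ← ih (Function.update x i t)]
      unfold lmarginal
      rw [← lintegral_const_mul _ (show Measurable fun y : ∀ j : s, α j =>
        (fun y => ∏ j ∈ s, f j (y j)) (Function.updateFinset (Function.update x i t) s y) from
        hm'.comp measurable_updateFinset)]
      refine lintegral_congr fun y => ?_
      beta_reduce
      rw [Finset.prod_insert hi]
      congr 2
      simp [Function.updateFinset, hi]
    simp_rw [key]
    rw [lintegral_mul_const _ (hf i)]

theorem lintegral_pi_prod [Fintype ι] {α : ι → Type*} [∀ i, MeasurableSpace (α i)]
    [∀ i, Nonempty (α i)]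
    (μ : ∀ i, Measure (α i)) [∀ i, SigmaFinite (μ i)] (f : ∀ i, α i → ℝ≥0∞)
    (hf : ∀ i, Measurable (f i)) :
    ∫⁻ y, ∏ i, f i (y i) ∂(Measure.pi μ) = ∏ i, ∫⁻ t, f i t ∂(μ i) := by
  classical
  rw [← lmarginal_prod μ f hf Finset.univ (Classical.arbitrary _), lmarginal_univ]

/-- Boxes determine a product measure, and on a box the product density times the indicator is again
a product over coordinates. -/
theorem pi_withDensity [Fintype ι] {α : ι → Type*} [∀ i, MeasurableSpace (α i)] [∀ i, Nonempty (α i)]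
    (μ : ∀ i, Measure (α i)) [∀ i, SigmaFinite (μ i)] (f : ∀ i, α i → ℝ≥0∞)
    (hf : ∀ i, Measurable (f i)) [∀ i, SigmaFinite ((μ i).withDensity (f i))] :
    Measure.pi (fun i => (μ i).withDensity (f i)) =
      (Measure.pi μ).withDensity fun y => ∏ i, f i (y i) := by
  refine Measure.pi_eq fun s hs => ?_
  rw [withDensity_apply _ (MeasurableSet.univ_pi hs), ← lintegral_indicator (MeasurableSet.univ_pi hs)]
  have : (Set.univ.pi s).indicator (fun y => ∏ i, f i (y i)) =
      fun y => ∏ i, (s i).indicator (f i) (y i) := by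
    funext y
    by_cases hy : y ∈ Set.univ.pi s
    · rw [Set.indicator_of_mem hy]
      exact Finset.prod_congr rfl fun i _ => by rw [Set.indicator_of_mem (hy i trivial)]
    · rw [Set.indicator_of_notMem hy]
      simp only [Set.mem_pi, Set.mem_univ, true_implies, not_forall] at hy
      obtain ⟨i, hi⟩ := hy
      exact (Finset.prod_eq_zero (Finset.mem_univ i) (Set.indicator_of_notMem hi _)).symm
  rw [this, lintegral_pi_prod μ _ fun i => (hf i).indicator (hs i)]
  refine Finset.prod_congr rfl fun i _ => ?_
  rw [lintegral_indicator (hs i), withDensity_apply _ (hs i)]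

end ProductMeasures

/-! ### One-dimensional Laplace integrals -/

section Laplace

variable {lam : ℝ}

theorem lintegral_exp_neg_mul_abs {r : ℝ} (hr : 0 < r) (c : ℝ) :
    ∫⁻ x : ℝ, ENNReal.ofReal (Real.exp (-r * |x - c|)) = ENNReal.ofReal (2 / r) := by
  rw [lintegral_sub_right_eq_self (μ := volume) (fun x => ENNReal.ofReal (Real.exp (-r * |x|))) c]
  have hval : ∫ x : ℝ, Real.exp (-r * |x|) = 2 / r := by
    rw [integral_comp_abs (f := fun x => Real.exp (-r * x)), integral_exp_mul_Ioi (by linarith)]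
    simp
    field_simp
  have hint : Integrable fun x : ℝ => Real.exp (-r * |x|) := by
    -- A nonintegrable function has integral 0 by convention, whereas the value found is 2 / r ≠ 0.
    refine not_imp_comm.1 integral_undef ?_
    rw [hval]
    positivity
  rw [← ofReal_integral_eq_lintegral_ofReal hint (ae_of_all _ fun x => (Real.exp_pos _).le), hval]

theorem measurable_laplaceDensity :
    Measurable fun x : ℝ => ENNReal.ofReal (lam / 2 * Real.exp (-lam * |x|)) := by
  fun_prop

theorem isProbabilityMeasure_laplace (h : 0 < lam) : IsProbabilityMeasure (laplace lam) := by
  constructor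
  rw [laplace, withDensity_apply _ MeasurableSet.univ, Measure.restrict_univ]
  simp_rw [ENNReal.ofReal_mul (by positivity : 0 ≤ lam / 2)]
  rw [lintegral_const_mul _ (by fun_prop)]
  have := lintegral_exp_neg_mul_abs h 0
  simp only [sub_zero] at this
  rw [this, ← ENNReal.ofReal_mul (by positivity)]
  simp only [ENNReal.ofReal_eq_one]
  field_simp

/-- The factor exp(λ|x|) cancels the Laplace density and leaves (λ/2) · (8/λ). This is the source of
every later factor 4^{|S|}. -/
theorem lintegral_laplace_exp (h : 0 < lam) (c : ℝ) :
    ∫⁻ x, ENNReal.ofReal (Real.exp (lam * |x| - lam / 4 * |x - c|)) ∂(laplace lam) = 4 := by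
  rw [laplace, lintegral_withDensity_eq_lintegral_mul _ measurable_laplaceDensity (by fun_prop)]
  have : ∀ x : ℝ, ((fun x : ℝ => ENNReal.ofReal (lam / 2 * Real.exp (-lam * |x|))) *
      fun x => ENNReal.ofReal (Real.exp (lam * |x| - lam / 4 * |x - c|))) x =
      ENNReal.ofReal (lam / 2) * ENNReal.ofReal (Real.exp (-(lam / 4) * |x - c|)) := by
    intro x
    simp only [Pi.mul_apply]
    rw [← ENNReal.ofReal_mul (by positivity), ← ENNReal.ofReal_mul (by positivity), mul_assoc,
      ← Real.exp_add]
    congr 3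
    ring
  simp_rw [this]
  rw [lintegral_const_mul _ (by fun_prop), lintegral_exp_neg_mul_abs (by positivity),
    ← ENNReal.ofReal_mul (by positivity)]
  have : lam / 2 * (2 / (lam / 4)) = 4 := by field_simp
  rw [this]
  simp

end Laplace

/-! ### Exponential moments, tails and density of the standard normal law -/

section StdGaussian

variable {E : Type*} [NormedAddCommGroup E] [InnerProductSpace ℝ E] [FiniteDimensional ℝ E]
  [MeasurableSpace E] [BorelSpace E]

theorem map_inner_stdGaussian (u : E) :
    (stdGaussian E).map (fun x => inner ℝ x u) = gaussianReal 0 (‖u‖₊ ^ 2) := by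
  have h1 : (fun x : E => inner ℝ x u) = innerSL ℝ u := by
    funext x
    simp [real_inner_comm]
  rw [h1, IsGaussian.map_eq_gaussianReal, integral_strongDual_stdGaussian, variance_dual_stdGaussian]
  congr 1
  ext
  simp

theorem lintegral_exp_inner_stdGaussian (u : E) :
    ∫⁻ x, ENNReal.ofReal (Real.exp (inner ℝ x u)) ∂(stdGaussian E) =
      ENNReal.ofReal (Real.exp (‖u‖ ^ 2 / 2)) := by
  have h1 := map_inner_stdGaussian u
  have h2 : ∫⁻ x, ENNReal.ofReal (Real.exp (inner ℝ x u)) ∂(stdGaussian E) =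
      ∫⁻ t, ENNReal.ofReal (Real.exp t) ∂(gaussianReal 0 (‖u‖₊ ^ 2)) := by
    rw [← h1, lintegral_map (by fun_prop) (by fun_prop)]
  rw [h2, ← ofReal_integral_eq_lintegral_ofReal _ (ae_of_all _ fun x => (Real.exp_pos _).le)]
  · have h3 := mgf_gaussianReal (p := gaussianReal 0 (‖u‖₊ ^ 2)) (X := id) Measure.map_id 1
    simp only [mgf, id, one_mul] at h3
    rw [h3]
    simp
  · have := integrable_exp_mul_gaussianReal (μ := 0) (v := ‖u‖₊ ^ 2) 1
    simpa using this

/-- Chernoff's bound with exponent τ / r, the optimal one when ‖u‖ = r. -/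
theorem stdGaussian_lt_inner_le (u : E) {r τ : ℝ} (hr : 0 < r) (hu : ‖u‖ ≤ r) (hτ : 0 ≤ τ) :
    stdGaussian E {x | r * τ < inner ℝ x u} ≤ ENNReal.ofReal (Real.exp (-τ ^ 2 / 2)) := by
  set θ := τ / r with hθ
  have hθ0 : 0 ≤ θ := by positivity
  have hsub : ∀ x ∈ {x : E | r * τ < inner ℝ x u},
      (1 : ℝ≥0∞) ≤ ENNReal.ofReal (Real.exp (inner ℝ x (θ • u) - τ ^ 2)) := by
    intro x hx
    rw [ENNReal.one_le_ofReal, Real.one_le_exp_iff, inner_smul_right]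
    have : θ * (r * τ) ≤ θ * inner ℝ x u := mul_le_mul_of_nonneg_left (le_of_lt hx) hθ0
    have h2 : θ * (r * τ) = τ ^ 2 := by rw [hθ]; field_simp
    linarith
  calc stdGaussian E {x | r * τ < inner ℝ x u}
      = ∫⁻ x in {x | r * τ < inner ℝ x u}, 1 ∂(stdGaussian E) := by simp
    _ ≤ ∫⁻ x in {x | r * τ < inner ℝ x u},
          ENNReal.ofReal (Real.exp (inner ℝ x (θ • u) - τ ^ 2)) ∂(stdGaussian E) :=
        setLIntegral_mono' (measurableSet_lt (by fun_prop) (by fun_prop)) hsub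
    _ ≤ ∫⁻ x, ENNReal.ofReal (Real.exp (inner ℝ x (θ • u) - τ ^ 2)) ∂(stdGaussian E) :=
        setLIntegral_le_lintegral _ _
    _ = ENNReal.ofReal (Real.exp (‖θ • u‖ ^ 2 / 2)) * ENNReal.ofReal (Real.exp (-τ ^ 2)) := by
        rw [← lintegral_exp_inner_stdGaussian, ← lintegral_mul_const _ (by fun_prop)]
        refine lintegral_congr fun x => ?_
        rw [← ENNReal.ofReal_mul (Real.exp_pos _).le, ← Real.exp_add]
        rfl
    _ ≤ _ := by
        rw [← ENNReal.ofReal_mul (Real.exp_pos _).le, ← Real.exp_add]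
        apply ENNReal.ofReal_le_ofReal
        apply Real.exp_le_exp.2
        have h3 : ‖θ • u‖ ≤ τ := by
          rw [norm_smul, Real.norm_of_nonneg hθ0]
          calc θ * ‖u‖ ≤ θ * r := mul_le_mul_of_nonneg_left hu hθ0
            _ = τ := by rw [hθ]; field_simp
        have h4 : ‖θ • u‖ ^ 2 ≤ τ ^ 2 := pow_le_pow_left₀ (norm_nonneg _) h3 2
        linarith

/-- The value of the constant is irrelevant: it is absorbed by the normalization in
`normalOnModel_eq`. -/
theorem stdGaussian_euclidean_eq_withDensity {ι : Type*} [Fintype ι] :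
    ∃ c : ℝ≥0∞, c ≠ 0 ∧ c ≠ ∞ ∧ stdGaussian (EuclideanSpace ℝ ι) =
      (volume : Measure (EuclideanSpace ℝ ι)).withDensity
        fun z => c * ENNReal.ofReal (Real.exp (-‖z‖ ^ 2 / 2)) := by
  have hpos : 0 < (Real.sqrt (2 * Real.pi))⁻¹ := by positivity
  refine ⟨ENNReal.ofReal (Real.sqrt (2 * Real.pi))⁻¹ ^ Fintype.card ι, ?_,
    ENNReal.pow_ne_top ENNReal.ofReal_ne_top, ?_⟩
  · exact pow_ne_zero _ (by simpa using hpos)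
  · rw [← map_pi_eq_stdGaussian]
    have h1 : (gaussianReal 0 1) = (volume : Measure ℝ).withDensity (gaussianPDF 0 1) :=
      gaussianReal_of_var_ne_zero _ one_ne_zero
    have : SigmaFinite ((volume : Measure ℝ).withDensity (gaussianPDF 0 1)) := by
      rw [← h1]; infer_instance
    rw [h1, pi_withDensity (ι := ι) (fun _ => (volume : Measure ℝ)) (fun _ => gaussianPDF 0 1)
      fun _ => measurable_gaussianPDF 0 1]
    ext B hB
    rw [Measure.map_apply (by fun_prop) hB, withDensity_apply _ (by measurability),
      withDensity_apply _ hB, ← (PiLp.volume_preserving_toLp ι).setLIntegral_comp_preimage hB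
        (by fun_prop)]
    rw [← volume_pi]
    refine lintegral_congr fun z => ?_
    simp only [gaussianPDF, gaussianPDFReal]
    rw [← ENNReal.ofReal_prod_of_nonneg (fun _ _ => by positivity), Finset.prod_mul_distrib,
      ← Real.exp_sum, ENNReal.ofReal_mul (by positivity), EuclideanSpace.real_norm_sq_eq]
    simp [Finset.sum_div, neg_div, ENNReal.ofReal_pow]

end StdGaussian

/-! ### Total variation distance of normalized measures -/

section TotalVariation

variable {E : Type*} [MeasurableSpace E]

theorem tvDist_le_one (μ ν : Measure E) [IsProbabilityMeasure μ] [IsProbabilityMeasure ν] :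
    tvDist μ ν ≤ 1 :=
  iSup₂_le fun _ _ => max_le (tsub_le_self.trans prob_le_one) (tsub_le_self.trans prob_le_one)

/-- Applying the one-sided bound to Bᶜ gives the opposite one, so a lower bound on one of the two
measures is enough. -/
theorem tvDist_le_of_forall_sub_le (μ ν : Measure E) [IsProbabilityMeasure μ]
    [IsProbabilityMeasure ν] (e : ℝ≥0∞) (h : ∀ B, MeasurableSet B → ν B ≤ μ B + e) :
    tvDist μ ν ≤ e := by
  refine iSup₂_le fun B hB => max_le ?_ (tsub_le_iff_left.2 (h B hB))
  have h1 := h Bᶜ hB.compl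
  rw [prob_compl_eq_one_sub hB, prob_compl_eq_one_sub hB] at h1
  rw [tsub_le_iff_left]
  have h2 : μ B ≤ 1 := prob_le_one
  have h3 : (1 : ℝ≥0∞) ≤ 1 - μ B + e + ν B := tsub_le_iff_right.1 h1
  have h4 : μ B + (1 - μ B) = 1 := add_tsub_cancel_of_le h2
  have h5 : 1 - μ B ≠ ∞ := by simp
  have h6 : (1 - μ B) + μ B ≤ (1 - μ B) + (ν B + e) := by
    rw [add_comm (1 - μ B) (μ B), h4]
    calc (1 : ℝ≥0∞) ≤ 1 - μ B + e + ν B := h3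
      _ = _ := by ring
  exact (ENNReal.add_le_add_iff_left h5).1 h6

/-- If an unnormalized measure `m` dominates `exp (-δ)` times `G` on `N`, while its total mass is at
most `exp δ + η` times that of `G` and `G` puts little mass outside `N`, then the normalizations of
`m` and `G` are close. -/
theorem tvDist_normalize_le (m G : Measure E) {N : Set E} (hN : MeasurableSet N) {δ : ℝ}
    (hδ : 0 ≤ δ) {η η' : ℝ≥0∞} (hm0 : m Set.univ ≠ 0) (hm : m Set.univ ≠ ∞)
    (hG0 : G Set.univ ≠ 0) (hG : G Set.univ ≠ ∞)
    (hlow : ∀ B, MeasurableSet B → ENNReal.ofReal (Real.exp (-δ)) * G (B ∩ N) ≤ m B)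
    (hup : m Set.univ ≤ (ENNReal.ofReal (Real.exp δ) + η) * G Set.univ)
    (hG' : G Nᶜ ≤ η' * G Set.univ) :
    tvDist ((m Set.univ)⁻¹ • m) ((G Set.univ)⁻¹ • G) ≤ ENNReal.ofReal (2 * δ) + η + η' := by
  have i1 : IsProbabilityMeasure ((m Set.univ)⁻¹ • m) := ⟨by
    simp [ENNReal.inv_mul_cancel hm0 hm]⟩
  have i2 : IsProbabilityMeasure ((G Set.univ)⁻¹ • G) := ⟨by
    simp [ENNReal.inv_mul_cancel hG0 hG]⟩
  by_cases hη : η = ∞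
  · simp [hη]
  by_cases hη' : η' = ∞
  · simp [hη']
  refine tvDist_le_of_forall_sub_le _ _ _ fun B hB => ?_
  have fm : ∀ B, m B ≠ ∞ := fun B => ne_top_of_le_ne_top hm (measure_mono (Set.subset_univ _))
  have fG : ∀ B, G B ≠ ∞ := fun B => ne_top_of_le_ne_top hG (measure_mono (Set.subset_univ _))
  simp only [Measure.smul_apply, smul_eq_mul]
  have hsplit : G B ≤ G (B ∩ N) + G Nᶜ := by
    rw [← measure_inter_add_sdiff B hN]
    gcongr
    intro x hx; exact hx.2
  have h1 := hlow B hB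
  lift η to NNReal using hη
  lift η' to NNReal using hη'
  have gp : 0 < (G Set.univ).toReal := ENNReal.toReal_pos hG0 hG
  have mp : 0 < (m Set.univ).toReal := ENNReal.toReal_pos hm0 hm
  have e1 : Real.exp (-δ) * (G (B ∩ N)).toReal ≤ (m B).toReal := by
    have := (ENNReal.toReal_le_toReal (ENNReal.mul_ne_top ENNReal.ofReal_ne_top (fG _)) (fm _)).2 h1
    rwa [ENNReal.toReal_mul, ENNReal.toReal_ofReal (Real.exp_pos _).le] at this
  have e2 : (m Set.univ).toReal ≤ (Real.exp δ + η) * (G Set.univ).toReal := by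
    have := (ENNReal.toReal_le_toReal hm (ENNReal.mul_ne_top (by simp) hG)).2 hup
    rwa [ENNReal.toReal_mul, ENNReal.toReal_add (by simp) (by simp),
      ENNReal.toReal_ofReal (Real.exp_pos _).le, ENNReal.coe_toReal] at this
  have e3 : (G Nᶜ).toReal ≤ η' * (G Set.univ).toReal := by
    have := (ENNReal.toReal_le_toReal (fG _) (ENNReal.mul_ne_top (by simp) hG)).2 hG'
    rwa [ENNReal.toReal_mul, ENNReal.coe_toReal] at this
  have e4 : (G B).toReal ≤ (G (B ∩ N)).toReal + (G Nᶜ).toReal := by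
    have := (ENNReal.toReal_le_toReal (fG _) (by finiteness [fG (B ∩ N), fG Nᶜ])).2 hsplit
    rwa [ENNReal.toReal_add (fG _) (fG _)] at this
  have e5 : (G (B ∩ N)).toReal ≤ (G Set.univ).toReal :=
    (ENNReal.toReal_le_toReal (fG _) hG).2 (measure_mono (Set.subset_univ _))
  have hfin1 : (G Set.univ)⁻¹ * G B ≠ ∞ := ENNReal.mul_ne_top (by simp [hG0]) (fG _)
  have hfin2 : (m Set.univ)⁻¹ * m B ≠ ∞ := ENNReal.mul_ne_top (by simp [hm0]) (fm _)
  rw [← ENNReal.toReal_le_toReal hfin1 (by finiteness)]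
  rw [ENNReal.toReal_add hfin2 (by finiteness), ENNReal.toReal_add (by finiteness) (by finiteness),
    ENNReal.toReal_add (by finiteness) (by finiteness)]
  simp only [ENNReal.toReal_mul, ENNReal.toReal_inv, ENNReal.coe_toReal]
  rw [ENNReal.toReal_ofReal (by positivity)]
  set g := (G Set.univ).toReal
  set Z := (m Set.univ).toReal
  set b := (G (B ∩ N)).toReal
  have hη0 : (0 : ℝ) ≤ η := η.2
  have b0 : 0 ≤ b := ENNReal.toReal_nonneg
  have hb1 : b / g ≤ 1 := (div_le_one gp).2 e5
  have s1 : g⁻¹ * (G B).toReal ≤ b / g + η' := by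
    rw [inv_mul_le_iff₀ gp]
    calc (G B).toReal ≤ b + η' * g := e4.trans (by gcongr)
      _ = g * (b / g + η') := by field_simp
  -- The normalized `m` gives `B` at least exp(-δ) / (exp δ + η) times b / g, and this factor is at
  -- least 1 - (2δ + η); since b / g ≤ 1, the loss is at most 2δ + η.
  have s2 : b / g - (2 * δ + η) ≤ Z⁻¹ * (m B).toReal := by
    have hD : 0 < Real.exp δ + η := by positivity
    have t1 : Real.exp (-δ) * b / ((Real.exp δ + η) * g) ≤ Z⁻¹ * (m B).toReal := by
      calc Real.exp (-δ) * b / ((Real.exp δ + η) * g) ≤ Real.exp (-δ) * b / Z := by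
            gcongr
        _ ≤ (m B).toReal / Z := by gcongr
        _ = _ := by ring
    refine le_trans ?_ t1
    have t2 : 1 - (2 * δ + η) ≤ Real.exp (-δ) / (Real.exp δ + η) := by
      rw [le_div_iff₀ hD]
      have u1 : 1 - 2 * δ ≤ Real.exp (-(2 * δ)) := by
        have := Real.add_one_le_exp (-(2 * δ)); linarith
      have u2 : Real.exp δ * Real.exp (-(2 * δ)) = Real.exp (-δ) := by
        rw [← Real.exp_add]; congr 1; ring
      have u3 : 1 ≤ Real.exp δ := Real.one_le_exp hδ
      have u4 : Real.exp δ * (1 - 2 * δ) ≤ Real.exp (-δ) := by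
        rw [← u2]; gcongr
      have u5 : 0 ≤ (Real.exp δ - 1) * η := mul_nonneg (by linarith) hη0
      have u6 : (1 - (2 * δ + η)) * (Real.exp δ + η) = Real.exp δ * (1 - 2 * δ) - (Real.exp δ - 1) * η - 2 * δ * η - η * η := by
        ring
      have u7 : 0 ≤ 2 * δ * η := by positivity
      have u8 : 0 ≤ (η : ℝ) * η := by positivity
      linarith
    have t3 : Real.exp (-δ) * b / ((Real.exp δ + η) * g) = Real.exp (-δ) / (Real.exp δ + η) * (b / g) := by
      field_simp
    rw [t3]
    have hbg : 0 ≤ b / g := by positivity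
    have t4 : (1 - (2 * δ + η)) * (b / g) ≤ Real.exp (-δ) / (Real.exp δ + η) * (b / g) := by gcongr
    have t5 : (2 * δ + η) * (b / g) ≤ (2 * δ + η) * 1 := by gcongr
    linarith
  linarith

end TotalVariation

variable {n p : ℕ}

/-! ### The design matrix, the noise event and the likelihood -/

section Design

variable (X : Matrix (Fin n) (Fin p) ℝ)

/-- `predict X` as a linear map. -/
def predictLin : EuclideanSpace ℝ (Fin p) →ₗ[ℝ] EuclideanSpace ℝ (Fin n) where
  toFun := predict X
  map_add' a b := by ext; simp [predict, Matrix.mulVec_add]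
  map_smul' r a := by ext; simp [predict, Matrix.mulVec_smul]

theorem predict_add (a b : EuclideanSpace ℝ (Fin p)) :
    predict X (a + b) = predict X a + predict X b := (predictLin X).map_add a b

theorem predict_sub (a b : EuclideanSpace ℝ (Fin p)) :
    predict X (a - b) = predict X a - predict X b := (predictLin X).map_sub a b

theorem predict_zero : predict X 0 = 0 := (predictLin X).map_zero

@[fun_prop]
theorem continuous_predict : Continuous (predict X) :=
  (predictLin X).continuous_of_finiteDimensional

@[fun_prop]
theorem measurable_predict : Measurable (predict X) := (continuous_predict X).measurable

/-- The `i`-th column of the design. -/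
def column (i : Fin p) : EuclideanSpace ℝ (Fin n) := WithLp.toLp 2 fun j => X j i

theorem predict_eq_sum (β : EuclideanSpace ℝ (Fin p)) : predict X β = ∑ i, β i • column X i := by
  ext j
  simp [predict, column, Matrix.mulVec, dotProduct, mul_comm]

theorem norm_column_le (i : Fin p) : ‖column X i‖ ≤ colNorm X := by
  have h : ‖column X i‖ = Real.sqrt (∑ j : Fin n, X j i ^ 2) := by
    rw [EuclideanSpace.norm_eq]
    simp [column]
  rw [h]
  exact le_ciSup (f := fun i : Fin p => Real.sqrt (∑ j : Fin n, X j i ^ 2))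
    (Set.finite_range _).bddAbove i

theorem colNorm_nonneg : 0 ≤ colNorm X := Real.iSup_nonneg fun _ => Real.sqrt_nonneg _

theorem l1On_nonneg (S : Finset (Fin p)) (β : EuclideanSpace ℝ (Fin p)) : 0 ≤ l1On S β :=
  Finset.sum_nonneg fun _ _ => abs_nonneg _

theorem l1On_add_compl (S : Finset (Fin p)) (β : EuclideanSpace ℝ (Fin p)) :
    l1On S β + l1On Sᶜ β = l1On Finset.univ β := Finset.sum_add_sum_compl S _

theorem measurable_l1On (S : Finset (Fin p)) : Measurable (l1On S) := by
  unfold l1On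
  fun_prop

theorem norm_predict_le (β : EuclideanSpace ℝ (Fin p)) :
    ‖predict X β‖ ≤ colNorm X * l1On Finset.univ β := by
  rw [predict_eq_sum, l1On, Finset.mul_sum]
  refine (norm_sum_le _ _).trans (Finset.sum_le_sum fun i _ => ?_)
  rw [norm_smul, Real.norm_eq_abs, mul_comm]
  exact mul_le_mul_of_nonneg_right (norm_column_le X i) (abs_nonneg _)

theorem abs_inner_predict_le {e : EuclideanSpace ℝ (Fin n)} {L : ℝ}
    (h : ∀ i, |inner ℝ e (column X i)| ≤ L) (β : EuclideanSpace ℝ (Fin p)) :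
    |inner ℝ e (predict X β)| ≤ L * l1On Finset.univ β := by
  rw [predict_eq_sum, inner_sum, l1On, Finset.mul_sum]
  refine (Finset.abs_sum_le_sum_abs _ _).trans (Finset.sum_le_sum fun i _ => ?_)
  rw [inner_smul_right, abs_mul, mul_comm]
  exact mul_le_mul_of_nonneg_right (h i) (abs_nonneg _)

/-- The noise vectors whose correlation with every column is at most `λ̄`. -/
def noiseEvent : Set (EuclideanSpace ℝ (Fin n)) :=
  {e | ∀ i, |inner ℝ e (column X i)| ≤ lamBar X}

theorem measurableSet_noiseEvent : MeasurableSet (noiseEvent X) := by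
  have : noiseEvent X = ⋂ i, {e | |inner ℝ e (column X i)| ≤ lamBar X} := by
    ext; simp [noiseEvent]
  rw [this]
  exact MeasurableSet.iInter fun i => measurableSet_le (by fun_prop) measurable_const

/-- Union bound over 2p one-sided tails. The threshold λ̄ is at least 2 √(log p) standard deviations
of each correlation, so each tail is at most p^{-2}. -/
theorem stdGaussian_noiseEvent_compl_le (hX : 0 < colNorm X) (hp : 1 ≤ p) :
    stdGaussian (EuclideanSpace ℝ (Fin n)) (noiseEvent X)ᶜ ≤ ENNReal.ofReal (2 / p) := by
  set τ : ℝ := 2 * Real.sqrt (Real.log p) with hτ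
  have hp0 : (0 : ℝ) < p := by exact_mod_cast hp
  have hlog : 0 ≤ Real.log p := Real.log_nonneg (by exact_mod_cast hp)
  have hτ0 : 0 ≤ τ := by positivity
  have hL : lamBar X = colNorm X * τ := by rw [lamBar, hτ]; ring
  have hsub : (noiseEvent X)ᶜ ⊆ ⋃ i : Fin p, ({e | colNorm X * τ < inner ℝ e (column X i)} ∪
      {e | colNorm X * τ < inner ℝ e (-column X i)}) := by
    intro e he
    simp only [noiseEvent, Set.mem_compl_iff, Set.mem_ofPred_eq, not_forall, not_le, hL] at he
    obtain ⟨i, hi⟩ := he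
    refine Set.mem_iUnion.2 ⟨i, ?_⟩
    simp only [Set.mem_union, Set.mem_ofPred_eq, inner_neg_right]
    exact lt_abs.1 hi
  have hexp : Real.exp (-τ ^ 2 / 2) = 1 / (p : ℝ) ^ 2 := by
    have : -τ ^ 2 / 2 = -(Real.log p + Real.log p) := by
      rw [hτ, mul_pow, Real.sq_sqrt hlog]; ring
    rw [this, Real.exp_neg, Real.exp_add, Real.exp_log hp0]
    field_simp
  calc _ ≤ _ := measure_mono hsub
    _ ≤ ∑ i : Fin p, stdGaussian (EuclideanSpace ℝ (Fin n))
          ({e | colNorm X * τ < inner ℝ e (column X i)} ∪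
            {e | colNorm X * τ < inner ℝ e (-column X i)}) := measure_iUnion_fintype_le _ _
    _ ≤ ∑ _i : Fin p, (ENNReal.ofReal (1 / (p : ℝ) ^ 2) + ENNReal.ofReal (1 / (p : ℝ) ^ 2)) := by
        refine Finset.sum_le_sum fun i _ => (measure_union_le _ _).trans ?_
        rw [← hexp]
        refine add_le_add (stdGaussian_lt_inner_le _ hX (norm_column_le X i) hτ0)
          (stdGaussian_lt_inner_le _ hX ?_ hτ0)
        rw [norm_neg]
        exact norm_column_le X i
    _ = _ := by
        rw [← ENNReal.ofReal_add (by positivity) (by positivity), Finset.sum_const,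
          Finset.card_univ, Fintype.card_fin, nsmul_eq_mul, ← ENNReal.ofReal_natCast,
          ← ENNReal.ofReal_mul (by positivity)]
        congr 1
        field_simp
        norm_num

theorem dataLaw_eq_map (β : EuclideanSpace ℝ (Fin p)) :
    dataLaw X β = (stdGaussian (EuclideanSpace ℝ (Fin n))).map fun e => predict X β + e := by
  simp [dataLaw, multivariateGaussian]

/-- A translation is a measurable embedding, so `f` need not be measurable. This matters for the
total variation distance, a supremum over uncountably many sets that also involves an arbitrary
choice of least squares estimators. -/
theorem lintegral_dataLaw (β : EuclideanSpace ℝ (Fin p)) (f : EuclideanSpace ℝ (Fin n) → ℝ≥0∞) :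
    ∫⁻ Y, f Y ∂(dataLaw X β) =
      ∫⁻ e, f (predict X β + e) ∂(stdGaussian (EuclideanSpace ℝ (Fin n))) := by
  rw [dataLaw_eq_map, (measurableEmbedding_addLeft (predict X β)).lintegral_map]

theorem measurable_likelihood_uncurry :
    Measurable fun q : EuclideanSpace ℝ (Fin n) × EuclideanSpace ℝ (Fin p) =>
      likelihood X q.1 q.2 := by
  unfold likelihood
  fun_prop

theorem measurable_likelihood (Y : EuclideanSpace ℝ (Fin n)) : Measurable (likelihood X Y) := by
  unfold likelihood
  fun_prop

/-- The factor exp(-‖e‖²/2) is isolated because it also appears in the lower bound `approxMass_ge`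
and cancels in ratios. -/
theorem likelihood_shift (β₀ β : EuclideanSpace ℝ (Fin p)) (e : EuclideanSpace ℝ (Fin n)) :
    likelihood X (predict X β₀ + e) β = ENNReal.ofReal (Real.exp (-‖e‖ ^ 2 / 2)) *
      ENNReal.ofReal (Real.exp (inner ℝ e (predict X (β - β₀)) -
        ‖predict X (β - β₀)‖ ^ 2 / 2)) := by
  rw [likelihood, ← ENNReal.ofReal_mul (Real.exp_pos _).le, ← Real.exp_add]
  have h : predict X β₀ + e - predict X β = e - predict X (β - β₀) := by
    rw [predict_sub]; abel
  rw [h, norm_sub_sq_real]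
  congr 2
  ring

end Design

/-! ### Lebesgue and Laplace measures on the coordinate subspaces -/

section Models

/-- `zeroExtend S` as a linear map. -/
def zeroExtendLin (S : Finset (Fin p)) : (S → ℝ) →ₗ[ℝ] EuclideanSpace ℝ (Fin p) where
  toFun := zeroExtend S
  map_add' a b := by
    ext i
    by_cases h : i ∈ S <;> simp [zeroExtend, h]
  map_smul' r a := by
    ext i
    by_cases h : i ∈ S <;> simp [zeroExtend, h]

theorem continuous_zeroExtend (S : Finset (Fin p)) : Continuous (zeroExtend S) :=
  (zeroExtendLin S).continuous_of_finiteDimensional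

@[fun_prop]
theorem measurable_zeroExtend (S : Finset (Fin p)) : Measurable (zeroExtend S) :=
  (continuous_zeroExtend S).measurable

theorem zeroExtend_apply_coe (S : Finset (Fin p)) (b : S → ℝ) (i : S) : zeroExtend S b i = b i := by
  simp [zeroExtend]

theorem zeroExtend_apply_of_notMem {S : Finset (Fin p)} (b : S → ℝ) {i : Fin p} (h : i ∉ S) :
    zeroExtend S b i = 0 := by
  simp [zeroExtend, h]

theorem supp_zeroExtend_subset (S : Finset (Fin p)) (b : S → ℝ) : supp (zeroExtend S b) ⊆ S := by
  intro i hi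
  by_contra h
  simp [supp, zeroExtend_apply_of_notMem b h] at hi

theorem l1On_univ_zeroExtend (S : Finset (Fin p)) (b : S → ℝ) :
    l1On Finset.univ (zeroExtend S b) = ∑ i, |b i| := by
  rw [← l1On_add_compl S]
  have h1 : l1On Sᶜ (zeroExtend S b) = 0 :=
    Finset.sum_eq_zero fun i hi => by
      rw [zeroExtend_apply_of_notMem b (Finset.mem_compl.1 hi), abs_zero]
  rw [h1, add_zero, l1On, ← Finset.sum_coe_sort]
  exact Finset.sum_congr rfl fun i _ => by rw [zeroExtend_apply_coe]

theorem exists_zeroExtend_eq {S : Finset (Fin p)} {β : EuclideanSpace ℝ (Fin p)} (h : supp β ⊆ S) :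
    ∃ b, zeroExtend S b = β := by
  refine ⟨fun i => β i, ?_⟩
  ext i
  by_cases hi : i ∈ S
  · simp [zeroExtend, hi]
  · rw [zeroExtend_apply_of_notMem _ hi]
    by_contra h'
    exact hi (h (by simpa [supp, eq_comm] using h'))

/-- Lebesgue measure on `ℝ^S`, as a measure on `ℝ^p`. -/
def flat (S : Finset (Fin p)) : Measure (EuclideanSpace ℝ (Fin p)) :=
  (volume : Measure (S → ℝ)).map (zeroExtend S)

instance (S : Finset (Fin p)) : SFinite (flat S) := by unfold flat; infer_instance

/-- The law of a vector with independent Laplace coordinates on `S` and zeros elsewhere. -/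
def slab (lam : ℝ) (S : Finset (Fin p)) : Measure (EuclideanSpace ℝ (Fin p)) :=
  (Measure.pi fun _ : S => laplace lam).map (zeroExtend S)

theorem lintegral_flat (S : Finset (Fin p)) {f : EuclideanSpace ℝ (Fin p) → ℝ≥0∞}
    (hf : Measurable f) : ∫⁻ β, f β ∂(flat S) = ∫⁻ b : S → ℝ, f (zeroExtend S b) := by
  rw [flat, lintegral_map hf (by fun_prop)]

theorem ae_flat_supp_subset (S : Finset (Fin p)) : ∀ᵐ β ∂(flat S), supp β ⊆ S := by
  have : MeasurableSet {β : EuclideanSpace ℝ (Fin p) | supp β ⊆ S} := by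
    have h : {β : EuclideanSpace ℝ (Fin p) | supp β ⊆ S} = ⋂ i ∈ Sᶜ, {β | β i = 0} := by
      ext β
      simp only [supp, Finset.subset_iff, Finset.mem_filter, Finset.mem_univ, true_and,
        Set.mem_ofPred_eq, Finset.mem_compl, Set.mem_iInter]
      exact forall_congr' fun i => not_imp_comm
    rw [h]
    exact Finset.measurableSet_biInter _ fun i _ => measurableSet_eq_fun (by fun_prop) (by fun_prop)
  rw [flat, ae_map_iff (by fun_prop) this]
  exact ae_of_all _ fun b => supp_zeroExtend_subset S b

theorem isProbabilityMeasure_slab {lam : ℝ} (h : 0 < lam) (S : Finset (Fin p)) :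
    IsProbabilityMeasure (slab lam S) := by
  have := isProbabilityMeasure_laplace h
  unfold slab
  exact Measure.isProbabilityMeasure_map (by fun_prop)

theorem slab_eq_withDensity {lam : ℝ} (h : 0 < lam) (S : Finset (Fin p)) :
    slab lam S = (flat S).withDensity fun β =>
      ENNReal.ofReal ((lam / 2) ^ S.card * Real.exp (-lam * l1On Finset.univ β)) := by
  have i1 := isProbabilityMeasure_laplace h
  have i2 : SigmaFinite ((volume : Measure ℝ).withDensity fun x =>
      ENNReal.ofReal (lam / 2 * Real.exp (-lam * |x|))) := by
    change SigmaFinite (laplace lam)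
    infer_instance
  have hm : Measurable fun β : EuclideanSpace ℝ (Fin p) =>
      ENNReal.ofReal ((lam / 2) ^ S.card * Real.exp (-lam * l1On Finset.univ β)) := by
    have := measurable_l1On (p := p) Finset.univ
    fun_prop
  ext B hB
  rw [slab, Measure.map_apply (by fun_prop) hB, withDensity_apply _ hB, flat,
    setLIntegral_map hB hm (by fun_prop)]
  unfold laplace
  rw [pi_withDensity (ι := S) (fun _ => (volume : Measure ℝ))
    (fun _ x => ENNReal.ofReal (lam / 2 * Real.exp (-lam * |x|)))
    fun _ => measurable_laplaceDensity, withDensity_apply _ (measurable_zeroExtend S hB),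
    ← volume_pi]
  refine lintegral_congr fun b => ?_
  rw [← ENNReal.ofReal_prod_of_nonneg (fun _ _ => by positivity), Finset.prod_mul_distrib,
    ← Real.exp_sum, l1On_univ_zeroExtend, Finset.mul_sum]
  simp [div_pow]

theorem lintegral_slab {lam : ℝ} (h : 0 < lam) (S : Finset (Fin p))
    {f : EuclideanSpace ℝ (Fin p) → ℝ≥0∞} (hf : Measurable f) :
    ∫⁻ β, f β ∂(slab lam S) = ∫⁻ β, ENNReal.ofReal ((lam / 2) ^ S.card *
      Real.exp (-lam * l1On Finset.univ β)) * f β ∂(flat S) := by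
  rw [slab_eq_withDensity h, lintegral_withDensity_eq_lintegral_mul _ _ hf]
  · rfl
  · have := measurable_l1On (p := p) Finset.univ
    fun_prop

/-- The integral factorizes into one-dimensional integrals equal to 4. Coordinates of `β₀` outside
`S` only decrease the integrand, hence the inequality. -/
theorem lintegral_slab_exp_le {lam : ℝ} (h : 0 < lam) (S : Finset (Fin p))
    (β₀ : EuclideanSpace ℝ (Fin p)) :
    ∫⁻ β, ENNReal.ofReal (Real.exp (lam * l1On Finset.univ β -
      lam / 4 * l1On Finset.univ (β - β₀))) ∂(slab lam S) ≤ 4 ^ S.card := by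
  have i1 := isProbabilityMeasure_laplace h
  have hl := measurable_l1On (p := p) Finset.univ
  rw [slab, lintegral_map (by fun_prop) (by fun_prop)]
  calc _ ≤ ∫⁻ b : S → ℝ, ∏ i : S, ENNReal.ofReal (Real.exp (lam * |b i| -
          lam / 4 * |b i - β₀ i|)) ∂(Measure.pi fun _ : S => laplace lam) := by
        refine lintegral_mono fun b => ?_
        rw [← ENNReal.ofReal_prod_of_nonneg (fun _ _ => (Real.exp_pos _).le), ← Real.exp_sum]
        apply ENNReal.ofReal_le_ofReal
        apply Real.exp_le_exp.2
        rw [Finset.sum_sub_distrib, ← Finset.mul_sum, ← Finset.mul_sum, l1On_univ_zeroExtend]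
        have : ∑ i : S, |b i - β₀ i| ≤ l1On Finset.univ (zeroExtend S b - β₀) := by
          rw [← l1On_add_compl S]
          have h1 : ∑ i : S, |b i - β₀ i| = l1On S (zeroExtend S b - β₀) := by
            refine Eq.trans (Finset.sum_congr rfl fun i _ => ?_)
              (Finset.sum_coe_sort S fun i => |(zeroExtend S b - β₀) i|)
            rw [PiLp.sub_apply, zeroExtend_apply_coe]
          linarith [l1On_nonneg Sᶜ (zeroExtend S b - β₀)]
        have h4 : 0 ≤ lam / 4 := by positivity
        linarith [mul_le_mul_of_nonneg_left this h4]
    _ = 4 ^ S.card := by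
        rw [lintegral_pi_prod (fun _ : S => laplace lam)
          (fun i x => ENNReal.ofReal (Real.exp (lam * |x| - lam / 4 * |x - β₀ i|)))
          fun i => by fun_prop]
        simp_rw [lintegral_laplace_exp h]
        simp

theorem lintegral_flat_exp_le {lam : ℝ} (h : 0 < lam) (S : Finset (Fin p))
    (β₀ : EuclideanSpace ℝ (Fin p)) :
    ENNReal.ofReal ((lam / 2) ^ S.card) * ∫⁻ β, ENNReal.ofReal (Real.exp (-
      (lam / 4 * l1On Finset.univ (β - β₀)))) ∂(flat S) ≤ 4 ^ S.card := by
  have hl := measurable_l1On (p := p) Finset.univ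
  refine le_trans (le_of_eq ?_) (lintegral_slab_exp_le h S β₀)
  rw [lintegral_slab h S (by fun_prop), ← lintegral_const_mul _ (by fun_prop)]
  refine lintegral_congr fun β => ?_
  rw [← ENNReal.ofReal_mul (by positivity), ← ENNReal.ofReal_mul (by positivity), mul_assoc,
    ← Real.exp_add]
  congr 3
  ring

theorem prior_eq (π : ℕ → ℝ) (lam : ℝ) :
    prior (p := p) π lam = ∑ S : Finset (Fin p),
      ENNReal.ofReal (π S.card / (p.choose S.card : ℝ)) • slab lam S := rfl

theorem lintegral_prior (π : ℕ → ℝ) (lam : ℝ) (f : EuclideanSpace ℝ (Fin p) → ℝ≥0∞) :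
    ∫⁻ β, f β ∂(prior π lam) = ∑ S : Finset (Fin p),
      ENNReal.ofReal (π S.card / (p.choose S.card : ℝ)) * ∫⁻ β, f β ∂(slab lam S) := by
  rw [prior_eq, lintegral_finsetSum_measure]
  exact Finset.sum_congr rfl fun S _ => lintegral_smul_measure _ _

end Models

/-! ### The evidence of a model, through projection on its space of means -/

section Evidence

variable (X : Matrix (Fin n) (Fin p) ℝ) (S : Finset (Fin p))

/-- The likelihood integrated over the model `S` with respect to Lebesgue measure. -/
def evidence (Y : EuclideanSpace ℝ (Fin n)) : ℝ≥0∞ := ∫⁻ β, likelihood X Y β ∂(flat S)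

theorem measurable_evidence : Measurable (evidence X S) :=
  (measurable_likelihood_uncurry X).lintegral_prod_right'

theorem evidence_eq_lintegral (Y : EuclideanSpace ℝ (Fin n)) :
    evidence X S Y = ∫⁻ b : S → ℝ, likelihood X Y (zeroExtend S b) :=
  lintegral_flat S (measurable_likelihood X Y)

/-- The regression map `b ↦ X_S b` of the model `S`. -/
def modelLin : (S → ℝ) →ₗ[ℝ] EuclideanSpace ℝ (Fin n) := predictLin X ∘ₗ zeroExtendLin S

theorem modelLin_apply (b : S → ℝ) : modelLin X S b = predict X (zeroExtend S b) := rfl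

/-- The space of mean vectors of the model `S`. -/
def modelSpace : Submodule ℝ (EuclideanSpace ℝ (Fin n)) := LinearMap.range (modelLin X S)

/-- The residual of the projection on the model `S`. -/
def resid (Y : EuclideanSpace ℝ (Fin n)) : EuclideanSpace ℝ (Fin n) :=
  Y - (modelSpace X S).starProjection Y

theorem resid_sub (y z : EuclideanSpace ℝ (Fin n)) :
    resid X S (y - z) = resid X S y - resid X S z := by
  simp only [resid, map_sub]; abel

theorem resid_add (y z : EuclideanSpace ℝ (Fin n)) :
    resid X S (y + z) = resid X S y + resid X S z := by
  simp only [resid, map_add]; abel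

theorem resid_of_mem {y : EuclideanSpace ℝ (Fin n)} (h : y ∈ modelSpace X S) :
    resid X S y = 0 := by
  rw [resid, Submodule.starProjection_eq_self_iff.2 h, sub_self]

theorem inner_resid_of_mem {y z : EuclideanSpace ℝ (Fin n)} (h : z ∈ modelSpace X S) :
    inner ℝ (resid X S y) z = 0 :=
  Submodule.starProjection_inner_eq_zero _ _ h

theorem inner_resid_resid (y z : EuclideanSpace ℝ (Fin n)) :
    inner ℝ (resid X S y) (resid X S z) = inner ℝ y (resid X S z) := by
  have h : inner ℝ ((modelSpace X S).starProjection y) (resid X S z) = 0 := by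
    rw [real_inner_comm]
    exact inner_resid_of_mem X S (Submodule.starProjection_apply_mem _ _)
  conv_lhs => rw [resid]
  rw [inner_sub_left, h, sub_zero]

theorem norm_sub_sq_of_mem (y : EuclideanSpace ℝ (Fin n)) {z : EuclideanSpace ℝ (Fin n)}
    (h : z ∈ modelSpace X S) :
    ‖y - z‖ ^ 2 = ‖resid X S y‖ ^ 2 + ‖(modelSpace X S).starProjection y - z‖ ^ 2 := by
  have h1 : y - z = resid X S y + ((modelSpace X S).starProjection y - z) := by
    rw [resid]; abel
  have h2 := inner_resid_of_mem X S (y := y)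
    ((modelSpace X S).sub_mem (Submodule.starProjection_apply_mem _ y) h)
  rw [h1, norm_add_sq_real, h2]
  ring

theorem norm_resid_le (y : EuclideanSpace ℝ (Fin n)) : ‖resid X S y‖ ≤ ‖y‖ := by
  have h := norm_sub_sq_of_mem X S y (Submodule.zero_mem _)
  rw [sub_zero] at h
  have h3 : ‖resid X S y‖ ^ 2 ≤ ‖y‖ ^ 2 := by
    rw [h]; exact le_add_of_nonneg_right (sq_nonneg _)
  exact (pow_le_pow_iff_left₀ (norm_nonneg _) (norm_nonneg _) two_ne_zero).1 h3

/-- By Pythagoras the residual of `Y` splits off the likelihood, and what remains is the likelihood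
at data 0 up to a translation of the coefficients, which Lebesgue measure ignores. The identity
holds in [0, ∞], so no injectivity is required. -/
theorem evidence_eq (Y : EuclideanSpace ℝ (Fin n)) :
    evidence X S Y = ENNReal.ofReal (Real.exp (-‖resid X S Y‖ ^ 2 / 2)) * evidence X S 0 := by
  obtain ⟨b, hb⟩ := Submodule.starProjection_apply_mem (modelSpace X S) Y
  rw [evidence_eq_lintegral, evidence_eq_lintegral, ← lintegral_const_mul _
    (show Measurable fun b : S → ℝ => likelihood X 0 (zeroExtend S b) from
      (measurable_likelihood X 0).comp (measurable_zeroExtend S)),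
    ← lintegral_sub_left_eq_self (μ := (volume : Measure (S → ℝ)))
      (fun c => ENNReal.ofReal (Real.exp (-‖resid X S Y‖ ^ 2 / 2)) *
        likelihood X 0 (zeroExtend S c)) b]
  refine lintegral_congr fun c => ?_
  rw [likelihood, likelihood, ← ENNReal.ofReal_mul (Real.exp_pos _).le, ← Real.exp_add,
    norm_sub_sq_of_mem X S Y (z := predict X (zeroExtend S c)) ⟨c, rfl⟩, ← hb,
    ← modelLin_apply, ← modelLin_apply, ← map_sub, zero_sub, norm_neg]
  congr 2
  ring

theorem evidence_ge (Y : EuclideanSpace ℝ (Fin n)) {β₀ : EuclideanSpace ℝ (Fin p)}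
    (h : supp β₀ ⊆ S) (e : EuclideanSpace ℝ (Fin n)) (hY : Y = predict X β₀ + e) :
    ENNReal.ofReal (Real.exp (-‖e‖ ^ 2 / 2)) * evidence X S 0 ≤ evidence X S Y := by
  obtain ⟨b, rfl⟩ := exists_zeroExtend_eq h
  rw [evidence_eq X S Y, hY, resid_add, resid_of_mem X S (y := predict X (zeroExtend S b)) ⟨b, rfl⟩,
    zero_add]
  gcongr
  exact norm_resid_le X S e

theorem evidence_zero_ge (hX : 0 < colNorm X) :
    ENNReal.ofReal ((2 / (colNorm X * S.card)) ^ S.card * Real.exp (-1 / 2)) ≤ evidence X S 0 := by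
  rcases S.eq_empty_or_nonempty with rfl | hS
  · have : ∀ b : (∅ : Finset (Fin p)) → ℝ, likelihood X 0 (zeroExtend ∅ b) = 1 := by
      intro b
      have h : zeroExtend (∅ : Finset (Fin p)) b = 0 := by ext i; simp [zeroExtend]
      rw [h, likelihood, predict_zero]
      simp
    rw [evidence_eq_lintegral, lintegral_congr this]
    simp only [Finset.card_empty, pow_zero, one_mul, lintegral_const]
    have hv : (volume : Measure ((∅ : Finset (Fin p)) → ℝ)) Set.univ = 1 := by
      rw [volume_pi, Measure.pi_of_empty]
      simp
    rw [hv]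
    exact ENNReal.ofReal_le_one.2 (Real.exp_le_one_iff.2 (by norm_num))
  have hs : (0 : ℝ) < S.card := by exact_mod_cast hS.card_pos
  -- On the cube of half-side ρ the bound ‖Xβ‖ ≤ ‖X‖ ‖β‖₁ gives ‖Xβ‖ ≤ 1, so the likelihood at data
  -- 0 is at least exp(-1/2) there.
  set ρ : ℝ := 1 / (colNorm X * S.card) with hρ
  have hρ0 : 0 < ρ := by positivity
  set box : Set (S → ℝ) := Set.Icc (fun _ => -ρ) fun _ => ρ
  have hvol : volume box = ENNReal.ofReal ((2 / (colNorm X * S.card)) ^ S.card) := by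
    rw [Real.volume_Icc_pi]
    have : ρ - -ρ = 2 / (colNorm X * S.card) := by rw [hρ]; ring
    simp only [this, Finset.prod_const, Finset.card_univ, Fintype.card_coe]
    rw [ENNReal.ofReal_pow (by positivity)]
  rw [evidence_eq_lintegral]
  calc ENNReal.ofReal ((2 / (colNorm X * S.card)) ^ S.card * Real.exp (-1 / 2))
      = ∫⁻ _b in box, ENNReal.ofReal (Real.exp (-1 / 2)) := by
        rw [setLIntegral_const, hvol, mul_comm, ENNReal.ofReal_mul (Real.exp_pos _).le]
    _ ≤ ∫⁻ b in box, likelihood X 0 (zeroExtend S b) := by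
        refine setLIntegral_mono' measurableSet_Icc fun b hb => ?_
        apply ENNReal.ofReal_le_ofReal
        apply Real.exp_le_exp.2
        rw [zero_sub, norm_neg]
        have h1 : l1On Finset.univ (zeroExtend S b) ≤ S.card * ρ := by
          rw [l1On_univ_zeroExtend]
          refine (Finset.sum_le_card_nsmul _ _ ρ fun i _ => abs_le.2 ⟨hb.1 i, hb.2 i⟩).trans ?_
          simp
        have h2 : ‖predict X (zeroExtend S b)‖ ≤ 1 := by
          refine (norm_predict_le X _).trans ?_
          calc colNorm X * l1On Finset.univ (zeroExtend S b) ≤ colNorm X * (S.card * ρ) := by gcongr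
            _ = 1 := by rw [hρ]; field_simp
        have h3 : ‖predict X (zeroExtend S b)‖ ^ 2 ≤ 1 := pow_le_one₀ (norm_nonneg _) h2
        linarith
    _ ≤ _ := setLIntegral_le_lintegral _ _

/-- Moving the data by a vector changes the evidence of a model containing the true mean by a
factor with expectation one. -/
theorem lintegral_evidence_ratio_le {β₀ : EuclideanSpace ℝ (Fin p)} (h : supp β₀ ⊆ S)
    (z : EuclideanSpace ℝ (Fin n)) :
    ∫⁻ e, evidence X S (predict X β₀ + e - z) / evidence X S (predict X β₀ + e)
      ∂(stdGaussian (EuclideanSpace ℝ (Fin n))) ≤ 1 := by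
  obtain ⟨b, rfl⟩ := exists_zeroExtend_eq h
  have h0 : resid X S (predict X (zeroExtend S b)) = 0 := resid_of_mem X S ⟨b, rfl⟩
  -- With R the residual map, R annihilates the true mean, and the ratio is exp(⟨e, Rz⟩ - ‖Rz‖²/2),
  -- of mean one. Only an inequality is claimed because the evidence may be infinite.
  calc _ ≤ ∫⁻ e, ENNReal.ofReal (Real.exp (-(‖resid X S z‖ ^ 2 / 2))) *
          ENNReal.ofReal (Real.exp (inner ℝ e (resid X S z)))
          ∂(stdGaussian (EuclideanSpace ℝ (Fin n))) := by
        refine lintegral_mono fun e => ?_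
        rw [evidence_eq X S (_ - z), evidence_eq X S (_ + e), resid_sub, resid_add, h0, zero_add]
        refine ENNReal.div_le_of_le_mul ?_
        rw [← mul_assoc, ← ENNReal.ofReal_mul (Real.exp_pos _).le,
          ← ENNReal.ofReal_mul (by positivity), ← Real.exp_add, ← Real.exp_add, norm_sub_sq_real,
          inner_resid_resid]
        gcongr
        apply le_of_eq
        ring
    _ = 1 := by
        rw [lintegral_const_mul _ (by fun_prop), lintegral_exp_inner_stdGaussian,
          ← ENNReal.ofReal_mul (Real.exp_pos _).le, ← Real.exp_add]
        simp

end Evidence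

/-! ### The normal law on a model as normalized likelihood -/

section NormalApproximation

variable (X : Matrix (Fin n) (Fin p) ℝ) (S : Finset (Fin p))

theorem colSub_mulVec (b : S → ℝ) :
    WithLp.toLp 2 (colSub X S *ᵥ b) = predict X (zeroExtend S b) := by
  ext j
  simp only [predict, colSub, Matrix.mulVec, dotProduct, Matrix.submatrix_apply, id]
  rw [← Finset.sum_subset (Finset.subset_univ S)]
  · refine Eq.trans (Finset.sum_congr rfl fun i _ => ?_)
      (Finset.sum_coe_sort S fun i => X j i * zeroExtend S b i)
    rw [zeroExtend_apply_coe]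
  · intro i _ hi
    rw [zeroExtend_apply_of_notMem _ hi, mul_zero]

theorem IsLeastSquares.predict_eq {Y : EuclideanSpace ℝ (Fin n)} {b : EuclideanSpace ℝ S}
    (hb : IsLeastSquares X S Y b) :
    predict X (zeroExtend S b.ofLp) = (modelSpace X S).starProjection Y := by
  obtain ⟨c, hc⟩ := Submodule.starProjection_apply_mem (modelSpace X S) Y
  have h1 := hb (Set.mem_univ (WithLp.toLp 2 c))
  simp only [Set.mem_ofPred_eq, colSub_mulVec] at h1
  rw [norm_sub_sq_of_mem X S Y (z := predict X (zeroExtend S b.ofLp)) ⟨_, rfl⟩,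
    norm_sub_sq_of_mem X S Y (z := predict X (zeroExtend S c)) ⟨_, rfl⟩, ← modelLin_apply X S c,
    hc, sub_self] at h1
  have h2 : ‖(modelSpace X S).starProjection Y - predict X (zeroExtend S b.ofLp)‖ ^ 2 = 0 :=
    le_antisymm (by simpa using h1) (sq_nonneg _)
  exact (sub_eq_zero.1 (norm_eq_zero.1 (pow_eq_zero_iff two_ne_zero |>.1 h2))).symm

theorem posDef_gram (hinj : Function.Injective (modelLin X S)) :
    ((colSub X S)ᵀ * colSub X S).PosDef := by
  have := Matrix.PosDef.conjTranspose_mul_self (colSub X S) (fun a b h => hinj ?_)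
  · simpa using this
  · rw [modelLin_apply, modelLin_apply, ← colSub_mulVec, ← colSub_mulVec]
    exact congrArg _ h

open scoped MatrixOrder in
/-- The normal law `N(b̂, (X_Sᵀ X_S)⁻¹)` on the model `S` is the normalized likelihood. -/
theorem normalOnModel_eq (hinj : Function.Injective (modelLin X S))
    {Y : EuclideanSpace ℝ (Fin n)} {b : EuclideanSpace ℝ S} (hb : IsLeastSquares X S Y b) :
    evidence X S Y ≠ 0 ∧ evidence X S Y ≠ ∞ ∧
      normalOnModel X S b = (evidence X S Y)⁻¹ • (flat S).withDensity (likelihood X Y) := by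
  set M := (colSub X S)ᵀ * colSub X S with hM
  have hMpos : M.PosDef := posDef_gram X S hinj
  have hdet : IsUnit M.det := (Matrix.isUnit_iff_isUnit_det _).1 hMpos.isUnit
  set A := CFC.sqrt M⁻¹ with hA
  have hAA : A * A = M⁻¹ := by
    exact CFC.sqrt_mul_sqrt_self _ hMpos.inv.posSemidef.nonneg
  have hAT : Aᵀ = A := by
    have h : IsSelfAdjoint A := by
      exact (CFC.sqrt_nonneg M⁻¹).isSelfAdjoint
    simpa [Matrix.star_eq_conjTranspose] using h.star_eq
  -- A is the symmetric root of M⁻¹, so A (A M) = 1, and a one-sided inverse of a square matrix is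
  -- two-sided. Hence z ↦ X_S A z is an isometry.
  have hAMA : A * M * A = 1 := by
    rw [mul_eq_one_comm, ← mul_assoc, hAA, Matrix.nonsing_inv_mul _ hdet]
  set L := Matrix.toEuclideanCLM (n := S) (𝕜 := ℝ) A with hL
  have hLdet : LinearMap.det (L : EuclideanSpace ℝ S →ₗ[ℝ] EuclideanSpace ℝ S) ≠ 0 := by
    intro h0
    have h1 : L * Matrix.toEuclideanCLM (n := S) (𝕜 := ℝ) (M * A) = 1 := by
      rw [hL, ← map_mul, ← mul_assoc, hAMA, map_one]
    have h2 := congrArg (fun T : EuclideanSpace ℝ S →L[ℝ] EuclideanSpace ℝ S =>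
      LinearMap.det (T : EuclideanSpace ℝ S →ₗ[ℝ] EuclideanSpace ℝ S)) h1
    simp only [ContinuousLinearMap.toLinearMap_mul, map_mul, h0, zero_mul,
      ContinuousLinearMap.toLinearMap_one, map_one] at h2
    exact zero_ne_one h2
  have hnorm : ∀ z : EuclideanSpace ℝ S, ‖predict X (zeroExtend S (L z).ofLp)‖ ^ 2 = ‖z‖ ^ 2 := by
    intro z
    have hz : (L z).ofLp = A *ᵥ z.ofLp := by simp [hL]
    rw [hz, ← colSub_mulVec, EuclideanSpace.real_norm_sq_eq, EuclideanSpace.real_norm_sq_eq]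
    have h1 : ∀ {m : Type} [Fintype m] (v : m → ℝ), ∑ i, v i ^ 2 = v ⬝ᵥ v := by
      intro m _ v; simp [dotProduct, sq]
    have h2 : (colSub X S * A)ᵀ * (colSub X S * A) = 1 := by
      rw [← hAMA, hM, Matrix.transpose_mul, hAT]; simp only [Matrix.mul_assoc]
    rw [h1, h1, Matrix.mulVec_mulVec, Matrix.dotProduct_mulVec, Matrix.vecMul_mulVec, h2,
      Matrix.vecMul_one]
  obtain ⟨c, hc0, hc, hstd⟩ := stdGaussian_euclidean_eq_withDensity (ι := S)
  have hproj := hb.predict_eq X S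
  -- The Jacobian and the Gaussian constant go into one factor κ, later identified by testing with f
  -- = 1; the determinant is never computed.
  obtain ⟨κ, hκ⟩ : ∃ κ : ℝ≥0∞, ∀ f : EuclideanSpace ℝ (Fin p) → ℝ≥0∞, Measurable f →
      ∫⁻ β, f β ∂(normalOnModel X S b) = κ * ∫⁻ β, f β * likelihood X Y β ∂(flat S) := by
    refine ⟨c * ENNReal.ofReal |(LinearMap.det
      (L : EuclideanSpace ℝ S →ₗ[ℝ] EuclideanSpace ℝ S))⁻¹| *
        ENNReal.ofReal (Real.exp (‖resid X S Y‖ ^ 2 / 2)), fun f hf => ?_⟩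
    have hmz : Measurable fun b' : EuclideanSpace ℝ S => zeroExtend S b'.ofLp :=
      (measurable_zeroExtend S).comp (by fun_prop)
    set h : EuclideanSpace ℝ S → ℝ≥0∞ := fun d =>
      f (zeroExtend S (b + d).ofLp) *
        ENNReal.ofReal (Real.exp (-‖predict X (zeroExtend S d.ofLp)‖ ^ 2 / 2)) with hh
    have hhm : Measurable h := by
      have m1 := hf.comp (hmz.comp (measurable_const_add b))
      have m2 := (measurable_predict X).comp hmz
      exact m1.mul (by
        have := m2.norm
        simp only [Function.comp_def] at this
        fun_prop)
    have hf1 : Measurable fun b' : EuclideanSpace ℝ S => f (zeroExtend S b'.ofLp) := hf.comp hmz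
    have hf2 : Measurable fun z : EuclideanSpace ℝ S => f (zeroExtend S (b + L z).ofLp) :=
      hf1.comp (by fun_prop)
    have hhL : Measurable fun z : EuclideanSpace ℝ S => h (L z) := hhm.comp L.continuous.measurable
    have hflik : Measurable fun β => f β * likelihood X Y β := hf.mul (measurable_likelihood X Y)
    have hflik' : Measurable fun d : S → ℝ =>
        f (zeroExtend S d) * likelihood X Y (zeroExtend S d) :=
      hflik.comp (measurable_zeroExtend S)
    have hmap := Measure.map_linearMap_addHaar_eq_smul_addHaar
      (volume : Measure (EuclideanSpace ℝ S)) hLdet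
    calc ∫⁻ β, f β ∂(normalOnModel X S b)
        = ∫⁻ z, f (zeroExtend S (b + L z).ofLp) ∂(stdGaussian (EuclideanSpace ℝ S)) := by
          rw [normalOnModel, lintegral_map hf hmz, multivariateGaussian,
            lintegral_map hf1 (by fun_prop)]
      _ = c * ∫⁻ z, h (L z) := by
          rw [hstd, lintegral_withDensity_eq_lintegral_mul _ (by fun_prop)
            hf2, ← lintegral_const_mul _ hhL]
          refine lintegral_congr fun z => ?_
          simp only [Pi.mul_apply, hh, hnorm]
          ring
      _ = c * (ENNReal.ofReal |(LinearMap.det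
            (L : EuclideanSpace ℝ S →ₗ[ℝ] EuclideanSpace ℝ S))⁻¹| * ∫⁻ d, h d) := by
          rw [← smul_eq_mul (ENNReal.ofReal _), ← lintegral_smul_measure, ← hmap]
          congr 1
          exact (lintegral_map hhm L.continuous.measurable).symm
      _ = _ := by
          rw [mul_assoc, mul_assoc, lintegral_flat S hflik]
          congr 2
          rw [← lintegral_const_mul _ hflik', ← lintegral_sub_right_eq_self h b]
          refine ((PiLp.volume_preserving_toLp S).lintegral_comp
            (hhm.comp (measurable_sub_const b))).symm.trans ?_
          refine lintegral_congr fun d => ?_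
          simp only [hh, likelihood, Function.comp_apply]
          have e1 : b + (WithLp.toLp 2 d - b) = WithLp.toLp 2 d := by abel
          rw [e1, mul_left_comm, ← ENNReal.ofReal_mul (Real.exp_pos _).le, ← Real.exp_add,
            norm_sub_sq_of_mem X S Y (z := predict X (zeroExtend S d)) ⟨d, rfl⟩, ← hproj]
          have e2 : predict X (zeroExtend S (WithLp.toLp 2 d - b).ofLp) =
              -(predict X (zeroExtend S b.ofLp) - predict X (zeroExtend S d)) := by
            rw [neg_sub, WithLp.ofLp_sub]
            exact (modelLin X S).map_sub d b.ofLp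
          rw [e2, norm_neg]
          congr 4
          ring
  have hprob : IsProbabilityMeasure (normalOnModel X S b) := by
    unfold normalOnModel
    exact Measure.isProbabilityMeasure_map
      ((measurable_zeroExtend S).comp (by fun_prop)).aemeasurable
  have h1 : κ * evidence X S Y = 1 := by
    have := hκ (fun _ => 1) measurable_const
    simp only [one_mul, lintegral_const, measure_univ] at this
    exact this.symm
  have hE0 : evidence X S Y ≠ 0 := fun h => by simp [h] at h1
  have hκ0 : κ ≠ 0 := fun h => by simp [h] at h1
  have hEt : evidence X S Y ≠ ∞ := fun h => by
    rw [h, ENNReal.mul_top hκ0] at h1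
    exact ENNReal.top_ne_one h1
  have hκ' : κ = (evidence X S Y)⁻¹ := ENNReal.eq_inv_of_mul_eq_one_left h1
  refine ⟨hE0, hEt, ?_⟩
  ext B hB
  rw [Measure.smul_apply, smul_eq_mul, withDensity_apply _ hB, ← hκ', ← lintegral_indicator hB,
    ← lintegral_indicator_one hB, hκ _ (measurable_one.indicator hB)]
  congr 1
  refine lintegral_congr fun β => ?_
  by_cases hβ : β ∈ B <;> simp [hβ]

end NormalApproximation

/-! ### Compatibility number and sparse singular value -/

section Compatibility

variable {X : Matrix (Fin n) (Fin p) ℝ} {S : Finset (Fin p)}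

theorem mem_supp {β : EuclideanSpace ℝ (Fin p)} {i : Fin p} : i ∈ supp β ↔ β i ≠ 0 := by
  simp [supp]

theorem l1On_pos {β : EuclideanSpace ℝ (Fin p)} (h : ∃ i ∈ S, β i ≠ 0) : 0 < l1On S β := by
  obtain ⟨i, hi, hβ⟩ := h
  exact Finset.sum_pos' (fun _ _ => abs_nonneg _) ⟨i, hi, abs_pos.2 hβ⟩

theorem mul_l1On_le_of_le_compat (hX : 0 < colNorm X) {c₀ : ℝ} (h : ENNReal.ofReal c₀ ≤ compat X S)
    {β : EuclideanSpace ℝ (Fin p)} (h7 : l1On Sᶜ β ≤ 7 * l1On S β) :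
    c₀ * colNorm X * l1On S β ≤ ‖predict X β‖ * Real.sqrt S.card := by
  by_cases h0 : ∃ i ∈ S, β i ≠ 0
  · have hpos := l1On_pos h0
    have h1 := le_trans h ((iInf_le _ β).trans ((iInf_le _ h7).trans (iInf_le _ h0)))
    rw [ENNReal.ofReal_le_ofReal_iff (by positivity), le_div_iff₀ (by positivity)] at h1
    linarith
  · push Not at h0
    have : l1On S β = 0 := Finset.sum_eq_zero fun i hi => by rw [h0 i hi, abs_zero]
    rw [this, mul_zero]
    positivity

theorem injective_modelLin (hX : 0 < colNorm X) {c₀ : ℝ} (hc₀ : 0 < c₀)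
    (h : ENNReal.ofReal c₀ ≤ compat X S) : Function.Injective (modelLin X S) := by
  rw [← LinearMap.ker_eq_bot, LinearMap.ker_eq_bot']
  intro b hb
  rw [modelLin_apply] at hb
  have h1 : l1On Sᶜ (zeroExtend S b) = 0 := Finset.sum_eq_zero fun i hi => by
    rw [zeroExtend_apply_of_notMem b (Finset.mem_compl.1 hi), abs_zero]
  have h2 := mul_l1On_le_of_le_compat hX h (β := zeroExtend S b)
    (by rw [h1]; exact mul_nonneg (by norm_num) (l1On_nonneg _ _))
  rw [hb, norm_zero, zero_mul] at h2
  by_contra hne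
  obtain ⟨i, hi⟩ := Function.ne_iff.1 hne
  have h3 : 0 < l1On S (zeroExtend S b) := l1On_pos ⟨i, i.2, by
    rw [zeroExtend_apply_coe]; exact hi⟩
  have : 0 < c₀ * colNorm X * l1On S (zeroExtend S b) := by positivity
  linarith

/-- Greedy choice: each new sign makes the cross term with the partial sum nonpositive, so squared
norms at most add up. The sign vector is the test vector of `compat_le_one`. -/
theorem exists_signs (X : Matrix (Fin n) (Fin p) ℝ) (S : Finset (Fin p)) :
    ∃ σ : Fin p → ℝ, (∀ i, |σ i| = 1) ∧
      ‖∑ i ∈ S, σ i • column X i‖ ^ 2 ≤ S.card * colNorm X ^ 2 := by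
  induction S using Finset.induction_on with
  | empty => exact ⟨fun _ => 1, fun _ => by simp, by simp⟩
  | insert i S hi ih =>
    obtain ⟨σ, h1, h2⟩ := ih
    set v := ∑ j ∈ S, σ j • column X j
    obtain ⟨τ, hτ, hτv⟩ : ∃ τ : ℝ, |τ| = 1 ∧ τ * inner ℝ (column X i) v ≤ 0 := by
      rcases le_total (inner ℝ (column X i) v) 0 with h | h
      · exact ⟨1, by simp, by simpa using h⟩
      · exact ⟨-1, by simp, by simpa using h⟩
    refine ⟨Function.update σ i τ, fun j => ?_, ?_⟩
    · by_cases hj : j = i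
      · subst hj; simp [hτ]
      · simp [hj, h1]
    · have hv : ∑ j ∈ S, Function.update σ i τ j • column X j = v :=
        Finset.sum_congr rfl fun j hj => by
          rw [Function.update_of_ne (ne_of_mem_of_not_mem hj hi)]
      rw [Finset.sum_insert hi, hv, Function.update_self, norm_add_sq_real, inner_smul_left,
        norm_smul, Real.norm_eq_abs, hτ, one_mul, Finset.card_insert_of_notMem hi]
      have h3 : ‖column X i‖ ^ 2 ≤ colNorm X ^ 2 :=
        pow_le_pow_left₀ (norm_nonneg _) (norm_column_le X i) 2
      push_cast
      simp only [conj_trivial]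
      linarith

/-- It allows the factor 1/φ(S) in the lower bound defining `betaMin` to be dropped. -/
theorem compat_le_one (hX : 0 < colNorm X) (hS : S.Nonempty) : compat X S ≤ 1 := by
  obtain ⟨σ, h1, h2⟩ := exists_signs X S
  set β := zeroExtend S fun i => σ i with hβ
  have hval : ∀ i ∈ S, β i = σ i := fun i hi => zeroExtend_apply_coe S _ ⟨i, hi⟩
  have hc : ∀ i ∉ S, β i = 0 := fun i hi => zeroExtend_apply_of_notMem _ hi
  have hl : l1On S β = S.card := by
    rw [l1On, Finset.sum_congr rfl fun i hi => by rw [hval i hi, h1]]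
    simp
  have hlc : l1On Sᶜ β = 0 := Finset.sum_eq_zero fun i hi => by
    rw [hc i (Finset.mem_compl.1 hi), abs_zero]
  have hpred : predict X β = ∑ i ∈ S, σ i • column X i := by
    rw [predict_eq_sum, ← Finset.sum_subset (Finset.subset_univ S)]
    · exact Finset.sum_congr rfl fun i hi => by rw [hval i hi]
    · intro i _ hi
      rw [hc i hi, zero_smul]
  obtain ⟨i, hi⟩ := hS
  refine (iInf_le _ β).trans ((iInf_le _ ?_).trans ((iInf_le _ ?_).trans ?_))
  · rw [hlc, hl]; positivity
  · refine ⟨i, hi, ?_⟩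
    rw [hval i hi]
    intro h0
    simpa [h0] using h1 i
  · have hs : (0 : ℝ) < S.card := by exact_mod_cast Finset.card_pos.2 ⟨i, hi⟩
    rw [ENNReal.ofReal_le_one, hl, div_le_one (by positivity), hpred]
    have h3 : ‖∑ i ∈ S, σ i • column X i‖ ≤ Real.sqrt S.card * colNorm X := by
      refine le_of_sq_le_sq (h2.trans (le_of_eq ?_)) (by positivity)
      rw [mul_pow, Real.sq_sqrt hs.le]
    calc _ ≤ Real.sqrt S.card * colNorm X * Real.sqrt S.card := by gcongr
      _ = colNorm X * (Real.sqrt S.card * Real.sqrt S.card) := by ring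
      _ = _ := by rw [Real.mul_self_sqrt hs.le]

theorem sparseSing_le_one (hX : 0 < colNorm X) {t : ℝ≥0∞} (ht : 1 ≤ t) (i : Fin p) :
    sparseSing X t ≤ 1 := by
  set β : EuclideanSpace ℝ (Fin p) := EuclideanSpace.single i 1
  have hs : supp β = {i} := by
    ext j
    by_cases h : j = i <;> simp [supp, β, h]
  refine (iInf_le _ β).trans ((iInf_le _ ?_).trans ((iInf_le _ ?_).trans ?_))
  · simp [hs]
  · simpa [hs] using ht
  · have hpred : predict X β = column X i := by
      rw [predict_eq_sum, Finset.sum_eq_single i]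
      · simp [β]
      · intro j _ hj; simp [β, hj]
      · simp
    rw [ENNReal.ofReal_le_one, hpred]
    have : ‖β‖ = 1 := by simp [β]
    rw [this, mul_one, div_le_one hX]
    exact norm_column_le X i

theorem mul_norm_le_of_le_sparseSing (hX : 0 < colNorm X) {t : ℝ≥0∞} {r : ℝ}
    (h : ENNReal.ofReal r ≤ sparseSing X t) {β : EuclideanSpace ℝ (Fin p)}
    (hβ : ((supp β).card : ℝ≥0∞) ≤ t) : r * (colNorm X * ‖β‖) ≤ ‖predict X β‖ := by
  by_cases h0 : β = 0
  · subst h0; simp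
  have hpos : 0 < ‖β‖ := norm_pos_iff.2 h0
  have hc : (supp β).card ≠ 0 := by
    rw [Finset.card_ne_zero]
    by_contra hne
    rw [Finset.not_nonempty_iff_eq_empty] at hne
    apply h0
    ext i
    by_contra hi
    have : i ∈ supp β := mem_supp.2 hi
    simp [hne] at this
  have h1 := le_trans h ((iInf_le _ β).trans ((iInf_le _ hc).trans (iInf_le _ hβ)))
  rwa [ENNReal.ofReal_le_ofReal_iff (by positivity), le_div_iff₀ (by positivity)] at h1

/-- The consequences of membership in the parameter class, in terms of real numbers. -/
theorem exists_sparse_constant {lam A₄ M c₀ s : ℝ} (hX : 0 < colNorm X)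
    (hA₄ : 0 < A₄) (hM : 0 ≤ M) (hc₀ : 0 < c₀) {β₀ : EuclideanSpace ℝ (Fin p)}
    (hβ₀ : β₀ ∈ paramClass X lam A₄ M c₀ s) :
    ∃ ψ : ℝ, 0 < ψ ∧ ψ ≤ 1 ∧ min c₀ 1 ≤ ψ ∧
      (∀ d : EuclideanSpace ℝ (Fin p),
        ((supp d).card : ℝ) ≤ (2 + 3 / A₄) * (supp β₀).card →
          ψ * (colNorm X * ‖d‖) ≤ ‖predict X d‖) ∧
      ∀ i ∈ supp β₀, M * Real.sqrt ((supp β₀).card * Real.log p) ≤ ψ ^ 2 * (colNorm X * |β₀ i|) := by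
  obtain ⟨hbeta, hcomp, -, hpsi⟩ := hβ₀
  set S₀ := supp β₀
  set Ψ := psiTilde X lam A₄ S₀ with hΨ
  -- For empty S₀ the number Ψ is ∞; truncation at 1 makes it real. For nonempty S₀ it is at most 1
  -- already, so the truncation costs nothing in the bound on the coordinates.
  set ψ := (min Ψ 1).toReal with hψ
  have hfin : min Ψ 1 ≠ ∞ := ne_top_of_le_ne_top ENNReal.one_ne_top (min_le_right _ _)
  have hmin : min c₀ 1 ≤ ψ := by
    rw [hψ, ← ENNReal.ofReal_le_iff_le_toReal hfin]
    refine le_min ((ENNReal.ofReal_le_ofReal (min_le_left _ _)).trans hpsi) ?_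
    exact ENNReal.ofReal_le_one.2 (min_le_right _ _)
  have hpos : 0 < ψ := lt_of_lt_of_le (lt_min hc₀ one_pos) hmin
  have hψΨ : ENNReal.ofReal ψ ≤ Ψ := by
    rw [hψ, ENNReal.ofReal_toReal hfin]; exact min_le_left _ _
  have hle : ψ ≤ 1 := ENNReal.toReal_le_of_le_ofReal zero_le_one (by simp)
  refine ⟨ψ, hpos, hle, hmin, fun d hd => ?_, fun i hi => ?_⟩
  · refine mul_norm_le_of_le_sparseSing hX hψΨ ?_
    -- The summand of `psiTilde` containing λ/λ̄ only enlarges the admissible sparsity and is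
    -- discarded.
    have h1 : ((supp d).card : ℝ≥0∞) ≤ (2 + ENNReal.ofReal (3 / A₄)) * S₀.card := by
      have := ENNReal.ofReal_le_ofReal hd
      rw [ENNReal.ofReal_mul (by positivity), ENNReal.ofReal_natCast, ENNReal.ofReal_natCast,
        ENNReal.ofReal_add (by norm_num) (by positivity)] at this
      simpa using this
    exact h1.trans (mul_le_mul_left (le_add_of_nonneg_right (zero_le)) _)
  · have hne : S₀.Nonempty := ⟨i, hi⟩
    have hcard : (1 : ℝ≥0∞) ≤ S₀.card := by exact_mod_cast Finset.card_pos.2 hne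
    have hΨ1 : Ψ ≤ 1 := by
      refine sparseSing_le_one hX ?_ i
      calc (1 : ℝ≥0∞) = 1 * 1 := by simp
        _ ≤ _ := mul_le_mul' (le_trans (by norm_num) ((le_self_add).trans le_self_add)) hcard
    have hΨψ : Ψ = ENNReal.ofReal ψ := by
      rw [hψ, ENNReal.ofReal_toReal hfin, min_eq_left hΨ1]
    have hb := hbeta i hi
    have hφ1 : compat X S₀ ≤ 1 := compat_le_one hX hne
    have hφ0 : compat X S₀ ≠ 0 := by
      intro h
      rw [h] at hcomp
      simp at hcomp
      linarith
    change ENNReal.ofReal M / Ψ ^ 2 * (ENNReal.ofReal (Real.sqrt (S₀.card * Real.log p)) /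
      (ENNReal.ofReal (colNorm X) * compat X S₀)) ≤ ENNReal.ofReal |β₀ i| at hb
    have h2 : ENNReal.ofReal M / Ψ ^ 2 * (ENNReal.ofReal (Real.sqrt (S₀.card * Real.log p)) /
        ENNReal.ofReal (colNorm X)) ≤ ENNReal.ofReal |β₀ i| := by
      refine le_trans ?_ hb
      gcongr
      calc ENNReal.ofReal (colNorm X) * compat X S₀ ≤ ENNReal.ofReal (colNorm X) * 1 := by gcongr
        _ = _ := mul_one _
    rw [hΨψ, ← ENNReal.ofReal_pow hpos.le, ← ENNReal.ofReal_div_of_pos (by positivity),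
      ← ENNReal.ofReal_div_of_pos hX, ← ENNReal.ofReal_mul (by positivity),
      ENNReal.ofReal_le_ofReal_iff (abs_nonneg _)] at h2
    rw [div_mul_div_comm, div_le_iff₀ (by positivity)] at h2
    linarith

end Compatibility

/-! ### Sums of prior weights over large models and supermodels -/

section DimensionPrior

variable {A₁ A₂ A₃ A₄ : ℝ} {π : ℕ → ℝ}

theorem DimPriorDecay.le_pow (hd : DimPriorDecay A₁ A₂ A₃ A₄ p π) (hA₂ : 0 < A₂) (s r : ℕ)
    (h : s + r ≤ p) : π (s + r) ≤ (A₂ * (p : ℝ) ^ (-A₄)) ^ r * π s := by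
  induction r with
  | zero => simp
  | succ r ih =>
    have h1 := (hd (s + r) (by omega)).2
    have hq : 0 ≤ A₂ * (p : ℝ) ^ (-A₄) := by positivity
    calc π (s + (r + 1)) ≤ A₂ * (p : ℝ) ^ (-A₄) * π (s + r) := h1
      _ ≤ A₂ * (p : ℝ) ^ (-A₄) * ((A₂ * (p : ℝ) ^ (-A₄)) ^ r * π s) :=
          mul_le_mul_of_nonneg_left (ih (by omega)) hq
      _ = _ := by ring

theorem DimPriorDecay.pow_le (hd : DimPriorDecay A₁ A₂ A₃ A₄ p π) (hA₁ : 0 < A₁) (s : ℕ)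
    (h : s ≤ p) : (A₁ * (p : ℝ) ^ (-A₃)) ^ s * π 0 ≤ π s := by
  induction s with
  | zero => simp
  | succ s ih =>
    have h1 := (hd s (by omega)).1
    have hq : 0 ≤ A₁ * (p : ℝ) ^ (-A₃) := by positivity
    calc _ = A₁ * (p : ℝ) ^ (-A₃) * ((A₁ * (p : ℝ) ^ (-A₃)) ^ s * π 0) := by ring
      _ ≤ A₁ * (p : ℝ) ^ (-A₃) * π s := mul_le_mul_of_nonneg_left (ih (by omega)) hq
      _ ≤ _ := h1

theorem sum_pow_succ_le {x : ℝ} (h0 : 0 ≤ x) (h : x ≤ 1 / 2) (m : ℕ) :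
    ∑ r ∈ Finset.range m, x ^ (r + 1) ≤ 2 * x := by
  have h1 : ∑ r ∈ Finset.range m, x ^ r ≤ (1 - x)⁻¹ := by
    rw [← tsum_geometric_of_lt_one h0 (by linarith)]
    exact (summable_geometric_of_lt_one h0 (by linarith)).sum_le_tsum _ fun _ _ => by positivity
  have h2 : (1 - x)⁻¹ ≤ 2 := by
    rw [inv_le_comm₀ (by linarith) (by norm_num)]; linarith
  simp_rw [pow_succ]
  rw [← Finset.sum_mul]
  exact mul_le_mul_of_nonneg_right (h1.trans h2) h0

/-- The weights are dominated by a geometric sequence of ratio at most 1/4, so the total mass 1 is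
at most (3/2) π(0). -/
theorem half_le_prior_zero (hπ : IsDimPrior p π) (hd : DimPriorDecay A₁ A₂ A₃ A₄ p π)
    (hA₂ : 0 < A₂) (hq : A₂ * (p : ℝ) ^ (-A₄) ≤ 1 / 4) : 1 / 2 ≤ π 0 := by
  set q := A₂ * (p : ℝ) ^ (-A₄) with hqdef
  have hq0 : 0 ≤ q := by positivity
  have h0 := hπ.1 0 (Nat.zero_le _)
  have h1 : (1 : ℝ) ≤ π 0 + 2 * q * π 0 := by
    rw [← hπ.2, Finset.sum_range_succ']
    have : ∑ s ∈ Finset.range p, π (s + 1) ≤ ∑ s ∈ Finset.range p, q ^ (s + 1) * π 0 := by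
      refine Finset.sum_le_sum fun s hs => ?_
      have := hd.le_pow hA₂ 0 (s + 1) (by have := Finset.mem_range.1 hs; omega)
      rwa [zero_add] at this
    rw [← Finset.sum_mul] at this
    have h2 := mul_le_mul_of_nonneg_right (sum_pow_succ_le hq0 (by linarith) p) h0
    linarith
  have h3 : 2 * q * π 0 ≤ 2 * (1 / 4) * π 0 := by gcongr
  linarith

theorem choose_mul_pow_le (p s : ℕ) :
    (p.choose s : ℝ) * (s : ℝ) ^ s ≤ (Real.exp 1 * p) ^ s := by
  have h1 : (p.choose s : ℝ) ≤ (p : ℝ) ^ s / s.factorial := Nat.choose_le_pow_div s p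
  have h2 : (s : ℝ) ^ s / s.factorial ≤ Real.exp s := Real.pow_div_factorial_le_exp _ (by positivity) s
  have h3 : Real.exp (s : ℝ) = Real.exp 1 ^ s := by
    rw [← Real.exp_nat_mul, mul_one]
  calc (p.choose s : ℝ) * (s : ℝ) ^ s ≤ (p : ℝ) ^ s / s.factorial * (s : ℝ) ^ s := by gcongr
    _ = (s : ℝ) ^ s / s.factorial * (p : ℝ) ^ s := by ring
    _ ≤ Real.exp s * (p : ℝ) ^ s := by gcongr
    _ = _ := by rw [h3, mul_pow]

/-- Raising `r` by one multiplies the binomial coefficient by (s + r + 1)/(r + 1) ≤ 1 + s. -/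
theorem choose_add_le_pow (s r : ℕ) : (s + r).choose s ≤ (1 + s) ^ r := by
  induction r with
  | zero => simp
  | succ r ih =>
    have h1 : (s + (r + 1)).choose s * (r + 1) = (s + r).choose s * (s + r + 1) := by
      have := Nat.choose_mul_succ_eq (s + r) s
      have e : s + r + 1 - s = r + 1 := by omega
      rw [e] at this
      rw [← add_assoc, this]
    have h2 : (s + r + 1) ≤ (1 + s) * (r + 1) := by nlinarith [Nat.zero_le (s * r)]
    have h3 : (s + (r + 1)).choose s * (r + 1) ≤ (1 + s) ^ (r + 1) * (r + 1) := by
      rw [h1, pow_succ, mul_assoc]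
      exact Nat.mul_le_mul ih h2
    exact Nat.le_of_mul_le_mul_right h3 (Nat.succ_pos r)

/-- The prior probability of a model. -/
def modelWeight (p : ℕ) (π : ℕ → ℝ) (s : ℕ) : ℝ := π s / (p.choose s : ℝ)

theorem modelWeight_nonneg (hπ : IsDimPrior p π) {s : ℕ} (hs : s ≤ p) : 0 ≤ modelWeight p π s :=
  div_nonneg (hπ.1 s hs) (Nat.cast_nonneg _)

theorem card_le_dim (S : Finset (Fin p)) : S.card ≤ p := by
  simpa using S.card_le_univ

theorem sum_modelWeight_mul (f : ℕ → ℝ) :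
    ∑ S : Finset (Fin p), modelWeight p π S.card * f S.card =
      ∑ s ∈ Finset.range (p + 1), π s * f s := by
  rw [← Finset.powerset_univ, Finset.sum_powerset_apply_card (fun s => modelWeight p π s * f s)]
  simp only [Finset.card_univ, Fintype.card_fin]
  refine Finset.sum_congr rfl fun s hs => ?_
  have : (p.choose s : ℝ) ≠ 0 := by
    exact_mod_cast (Nat.choose_pos (Nat.lt_succ_iff.1 (Finset.mem_range.1 hs))).ne'
  rw [nsmul_eq_mul, modelWeight]
  field_simp

theorem sum_modelWeight (hπ : IsDimPrior p π) :
    ∑ S : Finset (Fin p), modelWeight p π S.card = 1 := by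
  have := sum_modelWeight_mul (p := p) (π := π) fun _ => 1
  simpa [hπ.2] using this

theorem isProbabilityMeasure_prior (hπ : IsDimPrior p π) {lam : ℝ} (hlam : 0 < lam) :
    IsProbabilityMeasure (prior (p := p) π lam) := by
  constructor
  have h := lintegral_prior (p := p) π lam fun _ => 1
  simp only [lintegral_const, one_mul] at h
  rw [h]
  have h1 : ∀ S : Finset (Fin p), (slab lam S) Set.univ = 1 := fun S =>
    (isProbabilityMeasure_slab hlam S).measure_univ
  simp_rw [h1, mul_one]
  have h2 : ∑ S : Finset (Fin p), ENNReal.ofReal (modelWeight p π S.card) = 1 := by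
    rw [← ENNReal.ofReal_sum_of_nonneg fun S _ => modelWeight_nonneg hπ (card_le_dim S),
      sum_modelWeight hπ, ENNReal.ofReal_one]
  exact h2

/-- A lower bound for the normalized evidence of a model of size `s`. -/
def evidenceFloor (p : ℕ) (π : ℕ → ℝ) (s : ℕ) : ℝ :=
  π s * Real.exp (-1 / 2) / (Real.exp 1 * (p : ℝ) ^ 2) ^ s

/-- Here λ ≥ ‖X‖/p enters: it makes the Laplace height times the side of the cube in
`evidence_zero_ge` at least 1/(ps) per coordinate. The resulting s^s is absorbed by the binomial
coefficient, leaving (e p²)^s. -/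
theorem evidenceFloor_le {X : Matrix (Fin n) (Fin p) ℝ} (hX : 0 < colNorm X) (hp : 0 < p)
    (hπ : IsDimPrior p π) {lam : ℝ} (hlam : 0 < lam) (hlam' : colNorm X / p ≤ lam)
    (S : Finset (Fin p)) :
    ENNReal.ofReal (evidenceFloor p π S.card) ≤
      ENNReal.ofReal (modelWeight p π S.card) * ENNReal.ofReal ((lam / 2) ^ S.card) *
        evidence X S 0 := by
  refine le_trans ?_ (mul_le_mul_right (evidence_zero_ge X S hX) _)
  have hw := modelWeight_nonneg hπ (card_le_dim S)
  rw [← ENNReal.ofReal_mul hw, ← ENNReal.ofReal_mul (by positivity)]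
  apply ENNReal.ofReal_le_ofReal
  set s := S.card
  have hp0 : (0 : ℝ) < p := by exact_mod_cast hp
  have hc : (0 : ℝ) < p.choose s := by exact_mod_cast Nat.choose_pos (card_le_dim S)
  have hπs := hπ.1 s (card_le_dim S)
  have key : (p.choose s : ℝ) ≤ (Real.exp 1 * (p : ℝ) ^ 2) ^ s *
      ((lam / 2) ^ s * (2 / (colNorm X * s)) ^ s) := by
    rcases Nat.eq_zero_or_pos s with h0 | hs
    · simp [h0]
    have hs0 : (0 : ℝ) < s := by exact_mod_cast hs
    have h1 : (1 / (p * s : ℝ)) ^ s ≤ (lam / 2) ^ s * (2 / (colNorm X * s)) ^ s := by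
      rw [← mul_pow]
      refine pow_le_pow_left₀ (by positivity) ?_ _
      rw [div_le_iff₀ hp0] at hlam'
      have e : lam / 2 * (2 / (colNorm X * s)) = lam / (colNorm X * s) := by field_simp
      rw [e, div_le_div_iff₀ (by positivity) (by positivity)]
      nlinarith
    have h2 := choose_mul_pow_le p s
    calc (p.choose s : ℝ) = (p.choose s * (s : ℝ) ^ s) * (1 / (s : ℝ)) ^ s := by
          rw [mul_assoc, ← mul_pow, mul_one_div_cancel hs0.ne', one_pow, mul_one]
      _ ≤ (Real.exp 1 * p) ^ s * (1 / (s : ℝ)) ^ s := by gcongr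
      _ = (Real.exp 1 * (p : ℝ) ^ 2) ^ s * (1 / (p * s : ℝ)) ^ s := by
          rw [← mul_pow, ← mul_pow]; congr 1; field_simp
      _ ≤ _ := by gcongr
  rw [evidenceFloor, modelWeight, div_mul_eq_mul_div, div_mul_eq_mul_div,
    div_le_div_iff₀ (by positivity) hc]
  calc π s * Real.exp (-1 / 2) * (p.choose s : ℝ)
      ≤ π s * Real.exp (-1 / 2) * ((Real.exp 1 * (p : ℝ) ^ 2) ^ s *
        ((lam / 2) ^ s * (2 / (colNorm X * s)) ^ s)) := by gcongr
    _ = _ := by ring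

/-- The prior mass of the models too large to be compared with a true model of size `s₀`. -/
theorem sum_large_le (hπ : IsDimPrior p π) (hd : DimPriorDecay A₁ A₂ A₃ A₄ p π) (hA₂ : 0 < A₂)
    (hA₄ : 0 < A₄) (hp : 0 < p) {s₀ : ℕ} (hs₀ : s₀ ≤ p) {ρ : ℝ}
    (hρ : ρ = (4 * Real.exp 1 * (p : ℝ) ^ 2) ^ (A₄ / 3) * (4 * (A₂ * (p : ℝ) ^ (-A₄))))
    (hρ2 : ρ ≤ 1 / 2) :
    ∑ S : Finset (Fin p) with ¬ A₄ * S.card ≤ (A₄ + 3) * s₀, modelWeight p π S.card * 4 ^ S.card ≤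
      evidenceFloor p π s₀ * (2 * Real.exp (1 / 2) * ρ) := by
  set q := A₂ * (p : ℝ) ^ (-A₄) with hq
  have hq0 : 0 ≤ q := by positivity
  have hρ0 : 0 ≤ ρ := by rw [hρ]; positivity
  have hp1 : (1 : ℝ) ≤ p := by exact_mod_cast hp
  set P := 4 * Real.exp 1 * (p : ℝ) ^ 2 with hP
  have hP1 : 1 ≤ P := by
    have h1 : (1 : ℝ) ≤ Real.exp 1 := Real.one_le_exp zero_le_one
    have h2 : (1 : ℝ) ≤ (p : ℝ) ^ 2 := one_le_pow₀ hp1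
    nlinarith
  have hfloor : evidenceFloor p π s₀ * Real.exp (1 / 2) = π s₀ / (Real.exp 1 * (p : ℝ) ^ 2) ^ s₀ := by
    have : Real.exp (-1 / 2) * Real.exp (1 / 2) = 1 := by
      rw [← Real.exp_add]; norm_num
    rw [evidenceFloor, div_mul_eq_mul_div, mul_assoc, this, mul_one]
  have hsum : ∑ S : Finset (Fin p) with ¬ A₄ * S.card ≤ (A₄ + 3) * s₀,
      modelWeight p π S.card * 4 ^ S.card =
      ∑ s ∈ Finset.range (p + 1), π s * (if ¬ A₄ * s ≤ (A₄ + 3) * s₀ then 4 ^ s else 0) := by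
    rw [Finset.sum_filter, ← sum_modelWeight_mul]
    refine Finset.sum_congr rfl fun S _ => ?_
    split_ifs <;> simp
  have hbig : ∀ s : ℕ, ¬ A₄ * s ≤ (A₄ + 3) * s₀ → s₀ < s := by
    intro s hs
    by_contra hle
    push Not at hs hle
    have : (s : ℝ) ≤ s₀ := by exact_mod_cast hle
    nlinarith [Nat.cast_nonneg (α := ℝ) s₀]
  rw [hsum]
  have hπ0 := hπ.1 s₀ hs₀
  obtain ⟨m, rfl⟩ := Nat.exists_eq_add_of_le hs₀
  rw [show s₀ + m + 1 = (s₀ + 1) + m by ring, Finset.sum_range_add]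
  have hz : ∑ s ∈ Finset.range (s₀ + 1),
      π s * (if ¬ A₄ * s ≤ (A₄ + 3) * s₀ then (4 : ℝ) ^ s else 0) = 0 := by
    refine Finset.sum_eq_zero fun s hs => ?_
    rw [if_neg, mul_zero]
    intro h
    have := hbig s h
    have := Finset.mem_range.1 hs
    omega
  rw [hz, zero_add]
  have hterm : ∀ r ∈ Finset.range m, π (s₀ + 1 + r) *
      (if ¬ A₄ * ((s₀ + 1 + r : ℕ) : ℝ) ≤ (A₄ + 3) * s₀ then (4 : ℝ) ^ (s₀ + 1 + r) else 0) ≤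
      π s₀ / (Real.exp 1 * ((s₀ + m : ℕ) : ℝ) ^ 2) ^ s₀ * ρ ^ (r + 1) := by
    intro r hr
    by_cases h : A₄ * ((s₀ + 1 + r : ℕ) : ℝ) ≤ (A₄ + 3) * s₀
    · rw [if_neg (not_not.2 h), mul_zero]
      positivity
    rw [if_pos h]
    have h1 := hd.le_pow hA₂ s₀ (r + 1) (by have := Finset.mem_range.1 hr; omega)
    rw [← hq] at h1
    have e1 : s₀ + 1 + r = s₀ + (r + 1) := by ring
    -- The excess r + 1 over s₀ exceeds 3 s₀/A₄. Hence the polynomial loss P^{s₀} costs at most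
    -- P^{A₄/3} ≍ p^{2A₄/3} per extra coordinate, less than the gain p^{A₄} from the prior.
    have h2 : (s₀ : ℝ) ≤ A₄ / 3 * ((r + 1 : ℕ) : ℝ) := by
      push Not at h
      rw [e1, Nat.cast_add] at h
      linarith
    have h3 : P ^ s₀ ≤ (P ^ (A₄ / 3)) ^ (r + 1) := by
      rw [← Real.rpow_natCast, ← Real.rpow_natCast, ← Real.rpow_mul (by linarith)]
      exact Real.rpow_le_rpow_of_exponent_le hP1 h2
    have h4 : P ^ s₀ = 4 ^ s₀ * (Real.exp 1 * ((s₀ + m : ℕ) : ℝ) ^ 2) ^ s₀ := by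
      rw [hP, ← mul_pow]; ring
    rw [div_mul_eq_mul_div, le_div_iff₀ (by positivity), hρ, mul_pow (P ^ (A₄ / 3)), e1]
    calc π (s₀ + (r + 1)) * 4 ^ (s₀ + (r + 1)) * (Real.exp 1 * ((s₀ + m : ℕ) : ℝ) ^ 2) ^ s₀
        ≤ q ^ (r + 1) * π s₀ * 4 ^ (s₀ + (r + 1)) *
            (Real.exp 1 * ((s₀ + m : ℕ) : ℝ) ^ 2) ^ s₀ := by gcongr
      _ = π s₀ * (P ^ s₀ * (4 * q) ^ (r + 1)) := by rw [h4, mul_pow, pow_add]; ring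
      _ ≤ π s₀ * ((P ^ (A₄ / 3)) ^ (r + 1) * (4 * q) ^ (r + 1)) := by gcongr
  refine (Finset.sum_le_sum hterm).trans ?_
  rw [← Finset.mul_sum, ← hfloor]
  have h0 : 0 ≤ evidenceFloor (s₀ + m) π s₀ * Real.exp (1 / 2) := by rw [hfloor]; positivity
  calc _ ≤ evidenceFloor (s₀ + m) π s₀ * Real.exp (1 / 2) * (2 * ρ) :=
        mul_le_mul_of_nonneg_left (sum_pow_succ_le hρ0 hρ2 m) h0
    _ = _ := by ring

/-- Since 1 + 3/A₄ < 4, these models have size at most 4 s₀, and 4⁴ = 256. -/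
theorem sum_small_le (hπ : IsDimPrior p π) (hA₄ : 1 < A₄) (s₀ : ℕ) :
    ∑ S : Finset (Fin p) with A₄ * S.card ≤ (A₄ + 3) * s₀, modelWeight p π S.card * 4 ^ S.card ≤
      256 ^ s₀ := by
  calc _ ≤ ∑ S : Finset (Fin p) with A₄ * S.card ≤ (A₄ + 3) * s₀,
          modelWeight p π S.card * 256 ^ s₀ := by
        refine Finset.sum_le_sum fun S hS => ?_
        have h1 := (Finset.mem_filter.1 hS).2
        have h2 : S.card ≤ 4 * s₀ := by
          have : (S.card : ℝ) ≤ 4 * s₀ := by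
            by_contra hlt
            push Not at hlt
            have : A₄ * (4 * s₀) < A₄ * S.card := by gcongr
            nlinarith [Nat.cast_nonneg (α := ℝ) s₀]
          exact_mod_cast this
        have h3 : (256 : ℝ) ^ s₀ = 4 ^ (4 * s₀) := by rw [pow_mul]; norm_num
        rw [h3]
        exact mul_le_mul_of_nonneg_left (pow_le_pow_right₀ (by norm_num) h2)
          (modelWeight_nonneg hπ (card_le_dim S))
    _ ≤ ∑ S : Finset (Fin p), modelWeight p π S.card * 256 ^ s₀ :=
        Finset.sum_le_sum_of_subset_of_nonneg (Finset.filter_subset _ _) fun S _ _ =>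
          mul_nonneg (modelWeight_nonneg hπ (card_le_dim S)) (by positivity)
    _ = _ := by rw [← Finset.sum_mul, sum_modelWeight hπ, one_mul]

/-- Per coordinate the floor loses p^{A₃} from the prior and p² from the evidence. The exponent 3 +
A₃ leaves one power of p to spare, which for s₀ ≥ 1 yields the vanishing factor C/p. -/
theorem rpow_mul_pow_le_evidenceFloor (hπ : IsDimPrior p π) (hd : DimPriorDecay A₁ A₂ A₃ A₄ p π)
    (hA₁ : 0 < A₁) (h0 : 1 / 2 ≤ π 0) (hp : 0 < p) {s₀ : ℕ} (hs₀ : 0 < s₀) (hs₀p : s₀ ≤ p) {K' : ℝ}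
    (hK' : 3 + A₃ ≤ K') (hC : 256 * Real.exp 1 / A₁ ≤ p) :
    (p : ℝ) ^ (-(K' * s₀)) * 256 ^ s₀ ≤ evidenceFloor p π s₀ *
      (2 * Real.exp (1 / 2) * (256 * Real.exp 1 / A₁ / p)) := by
  have hp1 : (1 : ℝ) ≤ p := by exact_mod_cast hp
  have hp0 : (0 : ℝ) < p := by linarith
  set C := 256 * Real.exp 1 / A₁ with hCdef
  have hC0 : 0 < C := by positivity
  have h1 := hd.pow_le hA₁ s₀ hs₀p
  have h2 : (p : ℝ) ^ (-(K' * s₀)) ≤ ((p : ℝ) ^ (-(3 + A₃))) ^ s₀ := by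
    rw [← Real.rpow_natCast, ← Real.rpow_mul hp0.le]
    refine Real.rpow_le_rpow_of_exponent_le hp1 ?_
    nlinarith [Nat.cast_nonneg (α := ℝ) s₀]
  have h3 : (p : ℝ) ^ (-(3 + A₃)) = (p : ℝ) ^ (-A₃) / (p : ℝ) ^ 3 := by
    rw [neg_add, add_comm, Real.rpow_add hp0, Real.rpow_neg hp0.le 3, div_eq_mul_inv]
    norm_cast
  have hexp : Real.exp (-1 / 2) * Real.exp (1 / 2) = 1 := by
    rw [← Real.exp_add]; norm_num
  have hCp : C / p ≤ 1 := (div_le_one hp0).2 hC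
  have h4 : (C / p) ^ s₀ ≤ C / p := by
    simpa using pow_le_pow_of_le_one (by positivity) hCp hs₀
  have h5 : (A₁ * (p : ℝ) ^ (-A₃)) ^ s₀ ≤ 2 * π s₀ := by
    have : 0 ≤ (A₁ * (p : ℝ) ^ (-A₃)) ^ s₀ := by positivity
    nlinarith
  have hE : 0 < (Real.exp 1 * (p : ℝ) ^ 2) ^ s₀ := by positivity
  have hπs : 0 ≤ π s₀ := hπ.1 s₀ hs₀p
  calc (p : ℝ) ^ (-(K' * s₀)) * 256 ^ s₀ ≤ ((p : ℝ) ^ (-(3 + A₃))) ^ s₀ * 256 ^ s₀ := by gcongr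
    _ = (A₁ * (p : ℝ) ^ (-A₃)) ^ s₀ / (Real.exp 1 * (p : ℝ) ^ 2) ^ s₀ * (C / p) ^ s₀ := by
        rw [h3, ← mul_pow, ← div_pow, ← mul_pow, hCdef]
        congr 1
        field_simp
    _ ≤ 2 * π s₀ / (Real.exp 1 * (p : ℝ) ^ 2) ^ s₀ * (C / p) := by gcongr
    _ = 2 * π s₀ * (Real.exp (-1 / 2) * Real.exp (1 / 2)) /
          (Real.exp 1 * (p : ℝ) ^ 2) ^ s₀ * (C / p) := by rw [hexp, mul_one]
    _ = _ := by rw [evidenceFloor]; ring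

theorem sum_supersets (S₀ : Finset (Fin p)) (f : ℕ → ℝ) :
    ∑ S : Finset (Fin p) with S₀ ⊂ S, f S.card =
      ∑ r ∈ Finset.range (p - S₀.card), ((p - S₀.card).choose (r + 1) : ℝ) * f (S₀.card + (r + 1)) := by
  have h1 : ∑ S : Finset (Fin p) with S₀ ⊆ S, f S.card =
      ∑ r ∈ Finset.range (p - S₀.card + 1), ((p - S₀.card).choose r : ℝ) * f (S₀.card + r) := by
    have hc : S₀ᶜ.card = p - S₀.card := by rw [Finset.card_compl, Fintype.card_fin]
    have := Finset.sum_powerset_apply_card (fun r => f (S₀.card + r)) (x := S₀ᶜ)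
    rw [hc] at this
    simp only [nsmul_eq_mul] at this
    rw [← this]
    refine Finset.sum_nbij' (fun S => S \ S₀) (fun T => S₀ ∪ T) ?_ ?_ ?_ ?_ ?_
    · intro S _
      rw [Finset.mem_powerset]
      intro i hi
      exact Finset.mem_compl.2 (Finset.mem_sdiff.1 hi).2
    · intro T _
      simp
    · intro S hS
      exact Finset.union_sdiff_of_subset (Finset.mem_filter.1 hS).2
    · intro T hT
      have hdis : Disjoint S₀ T := by
        rw [Finset.disjoint_right]
        intro i hi
        exact Finset.mem_compl.1 (Finset.mem_powerset.1 hT hi)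
      rw [Finset.union_sdiff_left]
      exact Finset.sdiff_eq_self_of_disjoint hdis.symm
    · intro S hS
      have := Finset.card_sdiff_add_card_eq_card (Finset.mem_filter.1 hS).2
      rw [add_comm, this]
  have h2 : (Finset.univ.filter fun S : Finset (Fin p) => S₀ ⊆ S) =
      insert S₀ (Finset.univ.filter fun S => S₀ ⊂ S) := by
    ext S
    simp only [Finset.mem_filter, Finset.mem_univ, true_and, Finset.mem_insert,
      Finset.ssubset_iff_subset_ne]
    constructor
    · intro h
      by_cases he : S = S₀
      · exact Or.inl he
      · exact Or.inr ⟨h, fun h' => he h'.symm⟩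
    · rintro (rfl | h)
      · exact subset_rfl
      · exact h.1
  rw [h2, Finset.sum_insert (by simp), Finset.sum_range_succ'] at h1
  simp only [Nat.choose_zero_right, Nat.cast_one, one_mul, add_zero] at h1
  linarith

/-- The number of supermodels with r extra coordinates is offset by the uniform choice of the set:
the quotient of C(p - s₀, r) by C(p, s₀ + r) is C(s₀ + r, s₀)/C(p, s₀), at most (1 + s₀)^r / C(p,
s₀). Each extra coordinate thus costs q (1 + s₀), without a factor p. -/
theorem sum_supersets_le (hπ : IsDimPrior p π) (hd : DimPriorDecay A₁ A₂ A₃ A₄ p π) (hA₂ : 0 < A₂)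
    (S₀ : Finset (Fin p)) {x : ℝ} (hx : A₂ * (p : ℝ) ^ (-A₄) * (1 + S₀.card) ≤ x)
    (hx2 : x ≤ 1 / 2) :
    ∑ S : Finset (Fin p) with S₀ ⊂ S, modelWeight p π S.card ≤
      modelWeight p π S₀.card * (2 * x) := by
  set s₀ := S₀.card
  have hs₀ : s₀ ≤ p := card_le_dim S₀
  set q := A₂ * (p : ℝ) ^ (-A₄) with hq
  have hq0 : 0 ≤ q := by positivity
  have hx0 : 0 ≤ x := le_trans (by positivity) hx
  rw [sum_supersets]
  have hterm : ∀ r ∈ Finset.range (p - s₀), ((p - s₀).choose (r + 1) : ℝ) *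
      modelWeight p π (s₀ + (r + 1)) ≤ modelWeight p π s₀ * x ^ (r + 1) := by
    intro r hr
    have hr' : s₀ + (r + 1) ≤ p := by have := Finset.mem_range.1 hr; omega
    have h1 := hd.le_pow hA₂ s₀ (r + 1) hr'
    rw [← hq] at h1
    have h2 : (p.choose (s₀ + (r + 1)) : ℝ) * ((s₀ + (r + 1)).choose s₀ : ℝ) =
        p.choose s₀ * (p - s₀).choose (r + 1) := by
      have := Nat.choose_mul (n := p) (k := s₀ + (r + 1)) (s := s₀) (by omega)
      rw [Nat.add_sub_cancel_left] at this
      exact_mod_cast this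
    have h3 : (((s₀ + (r + 1)).choose s₀ : ℕ) : ℝ) ≤ (1 + s₀ : ℝ) ^ (r + 1) := by
      exact_mod_cast choose_add_le_pow s₀ (r + 1)
    have hc1 : (0 : ℝ) < p.choose (s₀ + (r + 1)) := by exact_mod_cast Nat.choose_pos hr'
    have hc2 : (0 : ℝ) < p.choose s₀ := by exact_mod_cast Nat.choose_pos hs₀
    have hπ0 := hπ.1 s₀ hs₀
    have e : ((p - s₀).choose (r + 1) : ℝ) * modelWeight p π (s₀ + (r + 1)) =
        π (s₀ + (r + 1)) * ((s₀ + (r + 1)).choose s₀ : ℝ) / p.choose s₀ := by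
      rw [modelWeight, mul_div_assoc', div_eq_div_iff hc1.ne' hc2.ne']
      linear_combination (-π (s₀ + (r + 1))) * h2
    rw [e, modelWeight, div_mul_eq_mul_div]
    refine div_le_div_of_nonneg_right ?_ hc2.le
    calc π (s₀ + (r + 1)) * ((s₀ + (r + 1)).choose s₀ : ℝ)
        ≤ q ^ (r + 1) * π s₀ * (1 + s₀ : ℝ) ^ (r + 1) := by gcongr
      _ = π s₀ * (q * (1 + s₀)) ^ (r + 1) := by rw [mul_pow q]; ring
      _ ≤ π s₀ * x ^ (r + 1) := by gcongr
  refine (Finset.sum_le_sum hterm).trans ?_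
  rw [← Finset.mul_sum]
  exact mul_le_mul_of_nonneg_left (sum_pow_succ_le hx0 hx2 _) (modelWeight_nonneg hπ hs₀)

end DimensionPrior

/-! ### Bounds on exponents: compatibility, noise averaging, far and near the truth -/

section Pointwise

variable {X : Matrix (Fin n) (Fin p) ℝ} {lam : ℝ} {β₀ : EuclideanSpace ℝ (Fin p)}

theorem l1On_le_add_sub (S : Finset (Fin p)) (a b : EuclideanSpace ℝ (Fin p)) :
    l1On S a ≤ l1On S b + l1On S (b - a) := by
  rw [l1On, l1On, l1On, ← Finset.sum_add_distrib]
  refine Finset.sum_le_sum fun i _ => ?_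
  have := abs_sub_abs_le_abs_sub (a i) (b i)
  rw [abs_sub_comm] at this
  simp only [PiLp.sub_apply]
  linarith

theorem l1On_supp (β : EuclideanSpace ℝ (Fin p)) : l1On (supp β) β = l1On Finset.univ β := by
  refine Finset.sum_subset (Finset.subset_univ _) fun i _ hi => ?_
  have : β i = 0 := by simpa [supp] using hi
  rw [this, abs_zero]

theorem l1On_compl_supp_sub (β : EuclideanSpace ℝ (Fin p)) :
    l1On (supp β₀)ᶜ (β - β₀) = l1On (supp β₀)ᶜ β := by
  refine Finset.sum_congr rfl fun i hi => ?_
  have : β₀ i = 0 := by simpa [supp] using hi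
  rw [PiLp.sub_apply, this, sub_zero]

theorem l1On_le_sqrt_card_mul_norm (d : EuclideanSpace ℝ (Fin p)) :
    l1On Finset.univ d ≤ Real.sqrt (supp d).card * ‖d‖ := by
  rw [← l1On_supp]
  refine le_of_sq_le_sq ?_ (by positivity)
  rw [mul_pow, Real.sq_sqrt (by positivity), EuclideanSpace.real_norm_sq_eq]
  calc l1On (supp d) d ^ 2 ≤ (supp d).card * ∑ i ∈ supp d, |d i| ^ 2 := sq_sum_le_card_mul_sum_sq
    _ ≤ (supp d).card * ∑ i, d i ^ 2 := by
        gcongr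
        simp only [sq_abs]
        exact Finset.sum_le_sum_of_subset_of_nonneg (Finset.subset_univ _) fun i _ _ => sq_nonneg _

theorem supp_sub_card_le (β β₀ : EuclideanSpace ℝ (Fin p)) {S : Finset (Fin p)} (h : supp β ⊆ S) :
    (supp (β - β₀)).card ≤ S.card + (supp β₀).card := by
  refine (Finset.card_le_card (t := S ∪ supp β₀) fun i hi => ?_).trans (Finset.card_union_le _ _)
  rw [Finset.mem_union]
  by_contra hn
  push Not at hn
  have h1 : β i = 0 := by
    by_contra h'
    exact hn.1 (h (mem_supp.2 h'))
  have h2 : β₀ i = 0 := by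
    by_contra h'
    exact hn.2 (mem_supp.2 h')
  exact mem_supp.1 hi (by simp [h1, h2])

/-- The compatibility condition turns the excess of the Laplace exponent into a bounded term. -/
theorem laplace_exponent_le (hX : 0 < colNorm X) (hlam : 0 < lam) (hbar : 0 < lamBar X) {c₀ : ℝ}
    (hc₀ : 0 < c₀) (hφ : ENNReal.ofReal c₀ ≤ compat X (supp β₀)) (β : EuclideanSpace ℝ (Fin p)) :
    lam * l1On Finset.univ β₀ + lam / 2 * l1On Finset.univ (β - β₀) -
        lam / (2 * lamBar X) * ‖predict X (β - β₀)‖ ^ 2 / 2 ≤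
      lam * l1On Finset.univ β - lam / 4 * l1On Finset.univ (β - β₀) +
        49 * lam * lamBar X * (supp β₀).card / (16 * (c₀ * colNorm X) ^ 2) := by
  set S₀ := supp β₀
  set d := β - β₀ with hd
  set u := l1On S₀ d
  set v := l1On S₀ᶜ d with hv
  set x := ‖predict X d‖
  set L := lamBar X
  have h1 : l1On Finset.univ d = u + v := (l1On_add_compl S₀ d).symm
  have h2 : l1On Finset.univ β = l1On S₀ β + v := by
    rw [← l1On_add_compl S₀ β, hv, hd, l1On_compl_supp_sub]
  have h3 : l1On Finset.univ β₀ ≤ l1On S₀ β + u := by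
    rw [← l1On_supp]; exact l1On_le_add_sub S₀ β₀ β
  have hu : 0 ≤ u := l1On_nonneg _ _
  have hx : 0 ≤ lam / (2 * L) * x ^ 2 / 2 := by positivity
  have hQ : 0 ≤ 49 * lam * L * S₀.card / (16 * (c₀ * colNorm X) ^ 2) := by positivity
  rw [h1, h2]
  have h4 := mul_le_mul_of_nonneg_left h3 hlam.le
  -- The coefficients 7/4 and 1/4 are the reason for the 7 in the cone defining φ: outside the cone
  -- the left side is nonpositive, inside it u is controlled by the prediction norm.
  suffices hmain : lam * (7 / 4 * u - v / 4) ≤ lam / (2 * L) * x ^ 2 / 2 +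
      49 * lam * L * S₀.card / (16 * (c₀ * colNorm X) ^ 2) by
    nlinarith
  rcases le_total (7 * u) v with h7 | h7
  · have : lam * (7 / 4 * u - v / 4) ≤ 0 := mul_nonpos_of_nonneg_of_nonpos hlam.le (by linarith)
    linarith
  · have hc := mul_l1On_le_of_le_compat hX hφ (β := d) h7
    set y := Real.sqrt S₀.card / (c₀ * colNorm X) with hy
    have hy2 : y ^ 2 = S₀.card / (c₀ * colNorm X) ^ 2 := by
      rw [hy, div_pow, Real.sq_sqrt (by positivity)]
    have huy : u ≤ x * y := by
      rw [hy, mul_div_assoc', le_div_iff₀ (by positivity)]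
      calc u * (c₀ * colNorm X) = c₀ * colNorm X * u := by ring
        _ ≤ _ := hc
    have e1 : lam / (2 * L) * x ^ 2 / 2 + 49 * lam * L * S₀.card / (16 * (c₀ * colNorm X) ^ 2) =
        lam * ((x ^ 2 / 4 + 49 * L ^ 2 * y ^ 2 / 16) / L) := by
      rw [hy2]; field_simp; ring
    rw [e1]
    refine mul_le_mul_of_nonneg_left ?_ hlam.le
    rw [le_div_iff₀ hbar]
    have hv0 : 0 ≤ v := l1On_nonneg _ _
    have h8 : (7 / 4 * u - v / 4) * L ≤ 7 / 4 * (x * y) * L := by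
      refine mul_le_mul_of_nonneg_right ?_ hbar.le
      linarith
    -- Young's inequality trades the linear term in x for the quadratic term of the likelihood.
    nlinarith [sq_nonneg (x / 2 - 7 * L * y / 4)]

/-- Only the share t = λ/(2λ̄) ≤ 1 of the noise term is bounded by the noise event, at cost tλ̄‖d‖₁
= λ‖d‖₁/2, which the Laplace prior can absorb even for small λ. The share 1 - t is averaged exactly,
and since (1 - t)² ≤ 1 - t a fraction t of the quadratic term survives. -/
theorem lintegral_noiseEvent_exp_le (hlam : 0 < lam) (hbar : 0 < lamBar X)
    (hlam2 : lam ≤ 2 * lamBar X) (d : EuclideanSpace ℝ (Fin p)) :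
    ∫⁻ e in noiseEvent X, ENNReal.ofReal (Real.exp (inner ℝ e (predict X d) -
        ‖predict X d‖ ^ 2 / 2)) ∂(stdGaussian (EuclideanSpace ℝ (Fin n))) ≤
      ENNReal.ofReal (Real.exp (lam / 2 * l1On Finset.univ d -
        lam / (2 * lamBar X) * ‖predict X d‖ ^ 2 / 2)) := by
  set t := lam / (2 * lamBar X) with ht
  have ht0 : 0 ≤ t := by positivity
  have ht1 : t ≤ 1 := (div_le_one (by positivity)).2 hlam2
  have htL : t * lamBar X = lam / 2 := by rw [ht]; field_simp
  set x := ‖predict X d‖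
  set l := l1On Finset.univ d
  calc _ ≤ ∫⁻ e in noiseEvent X, ENNReal.ofReal (Real.exp (lam / 2 * l - x ^ 2 / 2)) *
          ENNReal.ofReal (Real.exp (inner ℝ e ((1 - t) • predict X d)))
          ∂(stdGaussian (EuclideanSpace ℝ (Fin n))) := by
        refine setLIntegral_mono' (measurableSet_noiseEvent X) fun e he => ?_
        rw [← ENNReal.ofReal_mul (Real.exp_pos _).le, ← Real.exp_add, inner_smul_right]
        apply ENNReal.ofReal_le_ofReal
        apply Real.exp_le_exp.2
        have h1 := (le_abs_self _).trans (abs_inner_predict_le X he d)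
        have h2 := mul_le_mul_of_nonneg_left h1 ht0
        rw [← mul_assoc, htL] at h2
        linarith
    _ ≤ ∫⁻ e, ENNReal.ofReal (Real.exp (lam / 2 * l - x ^ 2 / 2)) *
          ENNReal.ofReal (Real.exp (inner ℝ e ((1 - t) • predict X d)))
          ∂(stdGaussian (EuclideanSpace ℝ (Fin n))) := setLIntegral_le_lintegral _ _
    _ ≤ _ := by
        rw [lintegral_const_mul _ (by fun_prop), lintegral_exp_inner_stdGaussian,
          ← ENNReal.ofReal_mul (Real.exp_pos _).le, ← Real.exp_add]
        apply ENNReal.ofReal_le_ofReal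
        apply Real.exp_le_exp.2
        rw [norm_smul, Real.norm_of_nonneg (by linarith), mul_pow]
        have : (1 - t) ^ 2 ≤ 1 - t := by nlinarith
        have h3 := mul_le_mul_of_nonneg_right this (sq_nonneg x)
        change lam / 2 * l - x ^ 2 / 2 + (1 - t) ^ 2 * x ^ 2 / 2 ≤ _
        linarith

/-- The radius, in prediction norm, of the neighbourhood of the truth. -/
def radius (p : ℕ) (K ψ : ℝ) (s : ℕ) : ℝ := K * Real.sqrt (s * Real.log p) / ψ

/-- Half of ‖Xd‖²/2 absorbs all ℓ¹ terms, at most (7/2) λ̄ ‖d‖₁ because λ ≤ 2λ̄; the other half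
gives the decay. The constant 64 is 4 · 16, where 16 bounds (7/2) · 2 · √5, with √5 from the
sparsity bound D ≤ 5. -/
theorem moderate_exponent_le (hX : 0 < colNorm X) (hlam2 : lam ≤ 2 * lamBar X)
    (hp : 1 ≤ p) {D K ψ : ℝ} (hK : 64 ≤ K) (hψ : 0 < ψ) (hψ1 : ψ ≤ 1) {s : ℕ}
    {d : EuclideanSpace ℝ (Fin p)} (hψd : ψ * (colNorm X * ‖d‖) ≤ ‖predict X d‖)
    (hD : ((supp d).card : ℝ) ≤ D * s) (hD5 : D ≤ 5) (hx : radius p K ψ s < ‖predict X d‖)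
    {e : EuclideanSpace ℝ (Fin n)} (he : e ∈ noiseEvent X) :
    inner ℝ e (predict X d) - ‖predict X d‖ ^ 2 / 2 ≤
      -(K ^ 2 / 4 * s * Real.log p) - 5 / 4 * lam * l1On Finset.univ d := by
  set x := ‖predict X d‖ with hxdef
  set l := l1On Finset.univ d
  have hl0 : 0 ≤ l := l1On_nonneg _ _
  have hlog : 0 ≤ Real.log p := Real.log_nonneg (by exact_mod_cast hp)
  set a := Real.sqrt (s * Real.log p) with ha
  have ha2 : a ^ 2 = s * Real.log p := Real.sq_sqrt (by positivity)
  have ha0 : 0 ≤ a := Real.sqrt_nonneg _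
  have hKa : K * a ≤ ψ * x := by
    have := hx.le
    rw [radius, div_le_iff₀ hψ] at this
    linarith
  have hx0 : 0 ≤ x := norm_nonneg _
  have hKx : K * a ≤ x := hKa.trans (by nlinarith)
  have h1 := (le_abs_self _).trans (abs_inner_predict_le X he d)
  have hL : lamBar X = 2 * colNorm X * Real.sqrt (Real.log p) := rfl
  have hbar : 0 ≤ lamBar X := by rw [hL]; positivity
  have h2 : lamBar X * l + 5 / 4 * lam * l ≤ 7 / 2 * lamBar X * l := by nlinarith
  have h3 : lamBar X * l ≤ 2 * (Real.sqrt 5 * a) * (x / ψ) := by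
    have hl : l ≤ Real.sqrt (5 * s) * ‖d‖ := by
      refine (l1On_le_sqrt_card_mul_norm d).trans ?_
      gcongr
      exact hD.trans (mul_le_mul_of_nonneg_right hD5 (Nat.cast_nonneg _))
    have hcd : colNorm X * ‖d‖ ≤ x / ψ := by rw [le_div_iff₀ hψ]; linarith
    calc lamBar X * l ≤ lamBar X * (Real.sqrt (5 * s) * ‖d‖) := by gcongr
      _ = 2 * (Real.sqrt (5 * s) * Real.sqrt (Real.log p)) * (colNorm X * ‖d‖) := by rw [hL]; ring
      _ = 2 * (Real.sqrt 5 * a) * (colNorm X * ‖d‖) := by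
          rw [ha, ← Real.sqrt_mul (by positivity), ← Real.sqrt_mul (by positivity),
            mul_assoc (5 : ℝ)]
      _ ≤ _ := by gcongr
  have h5 : Real.sqrt 5 ≤ 16 / 7 := by
    rw [Real.sqrt_le_left (by norm_num)]; norm_num
  have h4 : 7 / 2 * (lamBar X * l) ≤ x ^ 2 / 4 := by
    have haψ : a * (x / ψ) ≤ x ^ 2 / 64 := by
      rw [mul_div_assoc', div_le_iff₀ hψ]
      have : 64 * a ≤ ψ * x := (by nlinarith : 64 * a ≤ K * a).trans hKa
      nlinarith
    have hnn : 0 ≤ a * (x / ψ) := by positivity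
    nlinarith
  have h6 : K ^ 2 * a ^ 2 ≤ x ^ 2 := by
    rw [← mul_pow]
    exact pow_le_pow_left₀ (by positivity) hKx 2
  rw [ha2] at h6
  linarith

/-- Sparsity turns the prediction radius into an ℓ¹ radius, over which the Laplace log density
varies by a multiple of sλ√(log p)/‖X‖. This is the bias of the Laplace prior. -/
theorem lam_mul_l1On_le (hX : 0 < colNorm X) (hlam : 0 < lam) {D K ψ : ℝ}
    (hψ : 0 < ψ) {s : ℕ} {d : EuclideanSpace ℝ (Fin p)}
    (hψd : ψ * (colNorm X * ‖d‖) ≤ ‖predict X d‖)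
    (hD : ((supp d).card : ℝ) ≤ D * s) (hD5 : D ≤ 5) (hx : ‖predict X d‖ ≤ radius p K ψ s) :
    lam * l1On Finset.univ d ≤
      3 * K / ψ ^ 2 * (s * lam * Real.sqrt (Real.log p) / colNorm X) := by
  have h1 : ‖d‖ ≤ radius p K ψ s / (ψ * colNorm X) := by
    rw [le_div_iff₀ (by positivity)]
    linarith
  have h2 : Real.sqrt (supp d).card ≤ 3 * Real.sqrt s := by
    rw [Real.sqrt_le_left (by positivity), mul_pow, Real.sq_sqrt (Nat.cast_nonneg _)]
    nlinarith [Nat.cast_nonneg (α := ℝ) s]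
  calc lam * l1On Finset.univ d ≤ lam * (3 * Real.sqrt s * (radius p K ψ s / (ψ * colNorm X))) := by
        gcongr
        exact (l1On_le_sqrt_card_mul_norm d).trans (by gcongr)
    _ = 3 * K / ψ ^ 2 * (Real.sqrt s * Real.sqrt s * lam * Real.sqrt (Real.log p) / colNorm X) := by
        rw [radius, Real.sqrt_mul (Nat.cast_nonneg _)]
        field_simp
    _ = _ := by rw [Real.mul_self_sqrt (Nat.cast_nonneg _)]

end Pointwise

/-! ### Splitting the integral over a union of coordinate sets -/

section Split

theorem lintegral_flat_union {S T : Finset (Fin p)} (h : Disjoint S T)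
    {f : EuclideanSpace ℝ (Fin p) → ℝ≥0∞} (hf : Measurable f) :
    ∫⁻ β, f β ∂(flat (S ∪ T)) = ∫⁻ v, ∫⁻ u, f (u + v) ∂(flat S) ∂(flat T) := by
  -- Extension by zero is updating the base point 0, so `flat S` is a marginal integral and Tonelli
  -- for marginals applies.
  have hflat : ∀ (S : Finset (Fin p)) {f : EuclideanSpace ℝ (Fin p) → ℝ≥0∞}, Measurable f →
      ∫⁻ β, f β ∂(flat S) =
        lmarginal (fun _ => (volume : Measure ℝ)) S (fun y => f (WithLp.toLp 2 y)) 0 := by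
    intro S f hf
    rw [lintegral_flat S hf]
    rfl
  have hm : Measurable fun y : Fin p → ℝ => f (WithLp.toLp 2 y) := by fun_prop
  rw [hflat _ hf, lmarginal_union' _ _ hm h, lintegral_flat T]
  · unfold lmarginal
    refine lintegral_congr fun y => ?_
    rw [lintegral_flat S (by fun_prop)]
    refine lintegral_congr fun z => ?_
    congr 1
    ext i
    have hST : i ∈ S → i ∉ T := fun h1 h2 => Finset.disjoint_left.1 h h1 h2
    by_cases h1 : i ∈ S
    · simp [zeroExtend, Function.updateFinset, h1, hST h1]
    · by_cases h2 : i ∈ T <;> simp [zeroExtend, Function.updateFinset, h1, h2]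
  · exact Measurable.lintegral_prod_right' (f := fun q : EuclideanSpace ℝ (Fin p) ×
      EuclideanSpace ℝ (Fin p) => f (q.2 + q.1)) (by fun_prop)

theorem ae_slab_supp_subset {lam : ℝ} (h : 0 < lam) (S : Finset (Fin p)) :
    ∀ᵐ β ∂(slab lam S), supp β ⊆ S := by
  rw [slab_eq_withDensity h]
  exact (withDensity_absolutelyContinuous _ _).ae_le (ae_flat_supp_subset S)

end Split

/-! ### Masses of the models relative to the normal approximation -/

section Masses

variable (X : Matrix (Fin n) (Fin p) ℝ) (π : ℕ → ℝ) (lam : ℝ) (β₀ : EuclideanSpace ℝ (Fin p))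

/-- The vectors whose predictive vector is within `r` of that of the truth. -/
def nearTruth (r : ℝ) : Set (EuclideanSpace ℝ (Fin p)) := {β | ‖predict X (β - β₀)‖ ≤ r}

theorem measurableSet_nearTruth (r : ℝ) : MeasurableSet (nearTruth X β₀ r) :=
  measurableSet_le (by fun_prop) measurable_const

/-- The height of the Laplace prior density of the true model, frozen at the truth. -/
def frozenHeight : ℝ := (lam / 2) ^ (supp β₀).card * Real.exp (-lam * l1On Finset.univ β₀)

theorem frozenHeight_pos {lam : ℝ} (hlam : 0 < lam) : 0 < frozenHeight lam β₀ := by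
  unfold frozenHeight; positivity

/-- The unnormalized normal approximation to the posterior distribution. -/
def approxMeasure (Y : EuclideanSpace ℝ (Fin n)) : Measure (EuclideanSpace ℝ (Fin p)) :=
  (ENNReal.ofReal (modelWeight p π (supp β₀).card) * ENNReal.ofReal (frozenHeight lam β₀)) •
    (flat (supp β₀)).withDensity (likelihood X Y)

/-- The total mass of `approxMeasure`. -/
def approxMass (Y : EuclideanSpace ℝ (Fin n)) : ℝ≥0∞ :=
  ENNReal.ofReal (modelWeight p π (supp β₀).card) * ENNReal.ofReal (frozenHeight lam β₀) *
    evidence X (supp β₀) Y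

theorem approxMeasure_univ (Y : EuclideanSpace ℝ (Fin n)) :
    approxMeasure X π lam β₀ Y Set.univ = approxMass X π lam β₀ Y := by
  rw [approxMeasure, Measure.smul_apply, withDensity_apply _ MeasurableSet.univ,
    Measure.restrict_univ, approxMass, smul_eq_mul]
  rfl

theorem measurable_approxMass : Measurable (approxMass X π lam β₀) :=
  (measurable_evidence X _).const_mul _

variable {X π lam β₀}

theorem approxMass_ge (hX : 0 < colNorm X) (hp : 0 < p) (hπ : IsDimPrior p π) (hlam : 0 < lam)
    (hlam' : colNorm X / p ≤ lam) (e : EuclideanSpace ℝ (Fin n)) :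
    ENNReal.ofReal (Real.exp (-‖e‖ ^ 2 / 2)) *
        ENNReal.ofReal (evidenceFloor p π (supp β₀).card * Real.exp (-lam * l1On Finset.univ β₀)) ≤
      approxMass X π lam β₀ (predict X β₀ + e) := by
  have h1 := evidence_ge X (supp β₀) (predict X β₀ + e) subset_rfl e rfl
  have h2 := evidenceFloor_le hX hp hπ hlam hlam' (supp β₀)
  rw [approxMass, frozenHeight, ENNReal.ofReal_mul' (Real.exp_pos _).le,
    ENNReal.ofReal_mul' (Real.exp_pos _).le]
  calc _ ≤ ENNReal.ofReal (Real.exp (-‖e‖ ^ 2 / 2)) *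
        (ENNReal.ofReal (modelWeight p π (supp β₀).card) *
          ENNReal.ofReal ((lam / 2) ^ (supp β₀).card) * evidence X (supp β₀) 0 *
            ENNReal.ofReal (Real.exp (-lam * l1On Finset.univ β₀))) := by gcongr
    _ = ENNReal.ofReal (modelWeight p π (supp β₀).card) *
          (ENNReal.ofReal ((lam / 2) ^ (supp β₀).card) *
            ENNReal.ofReal (Real.exp (-lam * l1On Finset.univ β₀))) *
          (ENNReal.ofReal (Real.exp (-‖e‖ ^ 2 / 2)) * evidence X (supp β₀) 0) := by ring
    _ ≤ _ := by gcongr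

/-- By `approxMass_ge` the random part exp(-‖e‖²/2) cancels and the denominator becomes
deterministic. The noise is then integrated before β, and the compatibility bound turns the exponent
into one the Laplace measure integrates to at most 4^{|S|}. -/
theorem lintegral_noiseEvent_mass_le (hX : 0 < colNorm X) (hp : 0 < p) (hπ : IsDimPrior p π)
    (hlam : 0 < lam) (hlam' : colNorm X / p ≤ lam) (hbar : 0 < lamBar X)
    (hlam2 : lam ≤ 2 * lamBar X) {c₀ : ℝ} (hc₀ : 0 < c₀)
    (hφ : ENNReal.ofReal c₀ ≤ compat X (supp β₀))
    (hω : 0 < evidenceFloor p π (supp β₀).card) (S : Finset (Fin p)) :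
    ∫⁻ e in noiseEvent X, (∫⁻ β, likelihood X (predict X β₀ + e) β ∂(slab lam S)) /
        approxMass X π lam β₀ (predict X β₀ + e) ∂(stdGaussian (EuclideanSpace ℝ (Fin n))) ≤
      ENNReal.ofReal (Real.exp (49 * lam * lamBar X * (supp β₀).card /
        (16 * (c₀ * colNorm X) ^ 2)) / evidenceFloor p π (supp β₀).card) * 4 ^ S.card := by
  set ω := evidenceFloor p π (supp β₀).card
  set Q := 49 * lam * lamBar X * (supp β₀).card / (16 * (c₀ * colNorm X) ^ 2)
  set l₀ := l1On Finset.univ β₀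
  have i1 := isProbabilityMeasure_slab hlam S
  have hl := measurable_l1On (p := p) Finset.univ
  set c : ℝ≥0∞ := ENNReal.ofReal (Real.exp (lam * l₀) / ω) with hc
  have hcω : c * ENNReal.ofReal (ω * Real.exp (-lam * l₀)) = 1 := by
    rw [hc, ← ENNReal.ofReal_mul (by positivity)]
    have : Real.exp (lam * l₀) / ω * (ω * Real.exp (-lam * l₀)) = 1 := by
      rw [neg_mul, Real.exp_neg]; field_simp
    rw [this, ENNReal.ofReal_one]
  have hmeas : Measurable fun q : EuclideanSpace ℝ (Fin n) × EuclideanSpace ℝ (Fin p) =>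
      ENNReal.ofReal (Real.exp (inner ℝ q.1 (predict X (q.2 - β₀)) -
        ‖predict X (q.2 - β₀)‖ ^ 2 / 2)) := by fun_prop
  calc _ ≤ ∫⁻ e in noiseEvent X, c * ∫⁻ β, ENNReal.ofReal (Real.exp (inner ℝ e (predict X (β - β₀)) -
          ‖predict X (β - β₀)‖ ^ 2 / 2)) ∂(slab lam S)
          ∂(stdGaussian (EuclideanSpace ℝ (Fin n))) := by
        refine lintegral_mono fun e => ENNReal.div_le_of_le_mul ?_
        simp_rw [likelihood_shift X β₀]
        rw [lintegral_const_mul _ (by fun_prop)]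
        refine le_trans (le_of_eq ?_) (mul_le_mul_right (approxMass_ge hX hp hπ hlam hlam' e) _)
        set I := ∫⁻ β, ENNReal.ofReal (Real.exp (inner ℝ e (predict X (β - β₀)) -
          ‖predict X (β - β₀)‖ ^ 2 / 2)) ∂(slab lam S)
        set L0 := ENNReal.ofReal (Real.exp (-‖e‖ ^ 2 / 2))
        calc L0 * I = L0 * I * (c * ENNReal.ofReal (ω * Real.exp (-lam * l₀))) := by
              rw [hcω, mul_one]
          _ = _ := by ring
    _ = c * ∫⁻ β, ∫⁻ e in noiseEvent X, ENNReal.ofReal (Real.exp (inner ℝ e (predict X (β - β₀)) -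
          ‖predict X (β - β₀)‖ ^ 2 / 2)) ∂(stdGaussian (EuclideanSpace ℝ (Fin n)))
          ∂(slab lam S) := by
        rw [lintegral_const_mul _ hmeas.lintegral_prod_right', lintegral_lintegral_swap]
        exact hmeas.aemeasurable
    _ ≤ c * ∫⁻ β, ENNReal.ofReal (Real.exp (Q - lam * l₀)) * ENNReal.ofReal (Real.exp
          (lam * l1On Finset.univ β - lam / 4 * l1On Finset.univ (β - β₀))) ∂(slab lam S) := by
        refine mul_le_mul_right (lintegral_mono fun β => ?_) _
        refine (lintegral_noiseEvent_exp_le hlam hbar hlam2 _).trans ?_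
        rw [← ENNReal.ofReal_mul (Real.exp_pos _).le, ← Real.exp_add]
        apply ENNReal.ofReal_le_ofReal
        apply Real.exp_le_exp.2
        have := laplace_exponent_le hX hlam hbar hc₀ hφ β
        linarith
    _ ≤ c * (ENNReal.ofReal (Real.exp (Q - lam * l₀)) * 4 ^ S.card) := by
        rw [lintegral_const_mul _ (by fun_prop)]
        gcongr
        exact lintegral_slab_exp_le hlam S β₀
    _ = _ := by
        rw [← mul_assoc, hc, ← ENNReal.ofReal_mul (by positivity)]
        congr 2
        rw [div_mul_eq_mul_div, ← Real.exp_add]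
        congr 2
        ring

/-- The factor by which the likelihood decays outside the neighbourhood of the truth. -/
def farFactor (p : ℕ) (K : ℝ) (s : ℕ) : ℝ := if s = 0 then 0 else (p : ℝ) ^ (-(K ^ 2 / 4 * s))

theorem farFactor_nonneg (p : ℕ) (K : ℝ) (s : ℕ) : 0 ≤ farFactor p K s := by
  unfold farFactor; split_ifs <;> positivity

theorem likelihood_far_le (hX : 0 < colNorm X) (hlam2 : lam ≤ 2 * lamBar X)
    (hp : 1 ≤ p) {D K ψ : ℝ} (hK : 64 ≤ K) (hψ : 0 < ψ) (hψ1 : ψ ≤ 1)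
    (hψd : ∀ d : EuclideanSpace ℝ (Fin p), ((supp d).card : ℝ) ≤ D * (supp β₀).card →
      ψ * (colNorm X * ‖d‖) ≤ ‖predict X d‖) (hD5 : D ≤ 5)
    {e : EuclideanSpace ℝ (Fin n)} (he : e ∈ noiseEvent X) {β : EuclideanSpace ℝ (Fin p)}
    (hβ : ((supp (β - β₀)).card : ℝ) ≤ D * (supp β₀).card)
    (hfar : β ∉ nearTruth X β₀ (radius p K ψ (supp β₀).card)) :
    likelihood X (predict X β₀ + e) β ≤ ENNReal.ofReal (Real.exp (-‖e‖ ^ 2 / 2)) *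
      (ENNReal.ofReal (farFactor p K (supp β₀).card) *
        ENNReal.ofReal (Real.exp (-(5 / 4 * lam * l1On Finset.univ (β - β₀))))) := by
  simp only [nearTruth, Set.mem_ofPred_eq, not_le] at hfar
  -- If the true support is empty, sparsity forces β = β₀, which lies in the neighbourhood of radius
  -- 0; hence the value 0 of `farFactor` there is legitimate.
  have hs : (supp β₀).card ≠ 0 := by
    intro h0
    rw [h0, Nat.cast_zero, mul_zero] at hβ
    have h1 : (supp (β - β₀)).card = 0 := by
      have : ((supp (β - β₀)).card : ℝ) = 0 := le_antisymm hβ (Nat.cast_nonneg _)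
      exact_mod_cast this
    have h2 : β - β₀ = 0 := by
      ext i
      by_contra hi
      have : i ∈ supp (β - β₀) := mem_supp.2 hi
      rw [Finset.card_eq_zero.1 h1] at this
      simp at this
    rw [h2, predict_zero, norm_zero, h0, radius] at hfar
    simp at hfar
  have hp0 : (0 : ℝ) < p := by exact_mod_cast hp
  rw [likelihood_shift]
  gcongr
  rw [← ENNReal.ofReal_mul (farFactor_nonneg _ _ _), farFactor, if_neg hs,
    Real.rpow_def_of_pos hp0, ← Real.exp_add]
  apply ENNReal.ofReal_le_ofReal
  apply Real.exp_le_exp.2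
  have := moderate_exponent_le hX hlam2 hp hK hψ hψ1 (hψd _ hβ) hβ hD5 hfar he
  linarith

theorem setLIntegral_slab_far_le (hX : 0 < colNorm X) (hlam : 0 < lam)
    (hlam2 : lam ≤ 2 * lamBar X) (hp : 1 ≤ p) {D K ψ : ℝ} (hK : 64 ≤ K) (hψ : 0 < ψ) (hψ1 : ψ ≤ 1)
    (hψd : ∀ d : EuclideanSpace ℝ (Fin p), ((supp d).card : ℝ) ≤ D * (supp β₀).card →
      ψ * (colNorm X * ‖d‖) ≤ ‖predict X d‖) (hD5 : D ≤ 5)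
    {e : EuclideanSpace ℝ (Fin n)} (he : e ∈ noiseEvent X) {S : Finset (Fin p)}
    (hS : (S.card + (supp β₀).card : ℝ) ≤ D * (supp β₀).card) :
    ∫⁻ β in (nearTruth X β₀ (radius p K ψ (supp β₀).card))ᶜ,
        likelihood X (predict X β₀ + e) β ∂(slab lam S) ≤
      ENNReal.ofReal (Real.exp (-‖e‖ ^ 2 / 2)) *
        ENNReal.ofReal (farFactor p K (supp β₀).card * Real.exp (-lam * l1On Finset.univ β₀)) *
          4 ^ S.card := by
  have hl := measurable_l1On (p := p) Finset.univ
  set θ := farFactor p K (supp β₀).card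
  calc _ ≤ ∫⁻ β in (nearTruth X β₀ (radius p K ψ (supp β₀).card))ᶜ,
          ENNReal.ofReal (Real.exp (-‖e‖ ^ 2 / 2)) *
            ENNReal.ofReal (θ * Real.exp (-lam * l1On Finset.univ β₀)) *
            ENNReal.ofReal (Real.exp (lam * l1On Finset.univ β -
              lam / 4 * l1On Finset.univ (β - β₀))) ∂(slab lam S) := by
        refine lintegral_mono_ae ?_
        filter_upwards [ae_restrict_of_ae (ae_slab_supp_subset hlam S),
          ae_restrict_mem (measurableSet_nearTruth X β₀ _).compl] with β h1 h2
        have h3 : ((supp (β - β₀)).card : ℝ) ≤ D * (supp β₀).card := by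
          refine le_trans ?_ hS
          exact_mod_cast supp_sub_card_le β β₀ h1
        refine (likelihood_far_le hX hlam2 hp hK hψ hψ1 hψd hD5 he h3 h2).trans ?_
        rw [mul_assoc (ENNReal.ofReal (Real.exp (-‖e‖ ^ 2 / 2))),
          ENNReal.ofReal_mul (farFactor_nonneg _ _ _), mul_assoc (ENNReal.ofReal (farFactor _ _ _)),
          ← ENNReal.ofReal_mul (Real.exp_pos _).le, ← Real.exp_add]
        gcongr
        -- Of the 5/4 λ‖β - β₀‖₁ available, λ passes from ‖β‖₁ to ‖β₀‖₁ and λ/4 makes the integral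
        -- finite.
        have h4 := mul_le_mul_of_nonneg_left (l1On_le_add_sub Finset.univ β₀ β) hlam.le
        linarith
    _ ≤ ∫⁻ β, ENNReal.ofReal (Real.exp (-‖e‖ ^ 2 / 2)) *
            ENNReal.ofReal (θ * Real.exp (-lam * l1On Finset.univ β₀)) *
            ENNReal.ofReal (Real.exp (lam * l1On Finset.univ β -
              lam / 4 * l1On Finset.univ (β - β₀))) ∂(slab lam S) := setLIntegral_le_lintegral _ _
    _ ≤ _ := by
        rw [lintegral_const_mul _ (by fun_prop)]
        gcongr
        exact lintegral_slab_exp_le hlam S β₀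

theorem setLIntegral_flat_far_le (hX : 0 < colNorm X) (hlam : 0 < lam)
    (hlam2 : lam ≤ 2 * lamBar X) (hp : 1 ≤ p) {D K ψ : ℝ} (hK : 64 ≤ K) (hψ : 0 < ψ) (hψ1 : ψ ≤ 1)
    (hψd : ∀ d : EuclideanSpace ℝ (Fin p), ((supp d).card : ℝ) ≤ D * (supp β₀).card →
      ψ * (colNorm X * ‖d‖) ≤ ‖predict X d‖) (hD5 : D ≤ 5) (hD2 : 2 ≤ D)
    {e : EuclideanSpace ℝ (Fin n)} (he : e ∈ noiseEvent X) :
    ENNReal.ofReal (frozenHeight lam β₀) *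
      ∫⁻ β in (nearTruth X β₀ (radius p K ψ (supp β₀).card))ᶜ,
        likelihood X (predict X β₀ + e) β ∂(flat (supp β₀)) ≤
      ENNReal.ofReal (Real.exp (-‖e‖ ^ 2 / 2)) *
        ENNReal.ofReal (farFactor p K (supp β₀).card * Real.exp (-lam * l1On Finset.univ β₀)) *
          4 ^ (supp β₀).card := by
  have hl := measurable_l1On (p := p) Finset.univ
  set θ := farFactor p K (supp β₀).card
  have h1 : ∫⁻ β in (nearTruth X β₀ (radius p K ψ (supp β₀).card))ᶜ,
        likelihood X (predict X β₀ + e) β ∂(flat (supp β₀)) ≤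
      ENNReal.ofReal (Real.exp (-‖e‖ ^ 2 / 2)) * ENNReal.ofReal θ *
        ∫⁻ β, ENNReal.ofReal (Real.exp (-(lam / 4 * l1On Finset.univ (β - β₀))))
          ∂(flat (supp β₀)) := by
    rw [← lintegral_const_mul _ (by fun_prop)]
    refine le_trans (lintegral_mono_ae ?_) (setLIntegral_le_lintegral _ _)
    filter_upwards [ae_restrict_of_ae (ae_flat_supp_subset (supp β₀)),
      ae_restrict_mem (measurableSet_nearTruth X β₀ _).compl] with β h1 h2
    have h3 : ((supp (β - β₀)).card : ℝ) ≤ D * (supp β₀).card := by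
      have : ((supp (β - β₀)).card : ℝ) ≤ (supp β₀).card + (supp β₀).card := by
        exact_mod_cast supp_sub_card_le β β₀ h1
      nlinarith [Nat.cast_nonneg (α := ℝ) (supp β₀).card]
    refine (likelihood_far_le hX hlam2 hp hK hψ hψ1 hψd hD5 he h3 h2).trans ?_
    rw [mul_assoc (ENNReal.ofReal (Real.exp (-‖e‖ ^ 2 / 2)))]
    gcongr
    · exact l1On_nonneg _ _
    · linarith
  rw [frozenHeight, ENNReal.ofReal_mul' (Real.exp_pos _).le,
    ENNReal.ofReal_mul' (Real.exp_pos _).le]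
  calc _ ≤ ENNReal.ofReal ((lam / 2) ^ (supp β₀).card) *
        ENNReal.ofReal (Real.exp (-lam * l1On Finset.univ β₀)) *
        (ENNReal.ofReal (Real.exp (-‖e‖ ^ 2 / 2)) * ENNReal.ofReal θ *
        ∫⁻ β, ENNReal.ofReal (Real.exp (-(lam / 4 * l1On Finset.univ (β - β₀))))
          ∂(flat (supp β₀))) := by gcongr
    _ = ENNReal.ofReal (Real.exp (-‖e‖ ^ 2 / 2)) * (ENNReal.ofReal θ *
        ENNReal.ofReal (Real.exp (-lam * l1On Finset.univ β₀))) *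
        (ENNReal.ofReal ((lam / 2) ^ (supp β₀).card) *
        ∫⁻ β, ENNReal.ofReal (Real.exp (-(lam / 4 * l1On Finset.univ (β - β₀))))
          ∂(flat (supp β₀))) := by ring
    _ ≤ _ := by
        gcongr
        exact lintegral_flat_exp_le hlam (supp β₀) β₀

theorem likelihood_add (Y : EuclideanSpace ℝ (Fin n)) (u v : EuclideanSpace ℝ (Fin p)) :
    likelihood X Y (u + v) = likelihood X (Y - predict X v) u := by
  have h : Y - (predict X u + predict X v) = Y - predict X v - predict X u := by abel
  rw [likelihood, likelihood, predict_add, h]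

/-- On the coordinates of S₀ the Laplace density is replaced by its value at β₀, at cost exp δ. With
the extra coordinates v fixed, integrating over S₀ gives the evidence of S₀ for the data moved by
Xv. -/
theorem setLIntegral_slab_near_superset_le (hlam : 0 < lam) {S : Finset (Fin p)}
    (hS : supp β₀ ⊆ S) {r δ : ℝ}
    (hδ : ∀ β : EuclideanSpace ℝ (Fin p), supp β ⊆ S → β ∈ nearTruth X β₀ r →
      lam * l1On Finset.univ (β - β₀) ≤ δ) (Y : EuclideanSpace ℝ (Fin n)) :
    ∫⁻ β in nearTruth X β₀ r, likelihood X Y β ∂(slab lam S) ≤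
      ENNReal.ofReal (Real.exp δ) * (ENNReal.ofReal (frozenHeight lam β₀) *
        ∫⁻ v, evidence X (supp β₀) (Y - predict X v) ∂(slab lam (S \ supp β₀))) := by
  set S₀ := supp β₀ with hS₀
  set T := S \ S₀ with hT
  have hdis : Disjoint S₀ T := Finset.disjoint_sdiff
  have hunion : S₀ ∪ T = S := Finset.union_sdiff_of_subset hS
  have hl := measurable_l1On (p := p) Finset.univ
  have hlc := measurable_l1On (p := p) S₀ᶜ
  have hL := measurable_likelihood X Y
  have hN := measurableSet_nearTruth X β₀ r
  have hev : Measurable fun v => evidence X S₀ (Y - predict X v) :=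
    (measurable_evidence X S₀).comp (by fun_prop)
  have hcard : S.card = S₀.card + T.card := by
    rw [← hunion, Finset.card_union_of_disjoint hdis]
  set A : ℝ≥0∞ := ENNReal.ofReal ((lam / 2) ^ S.card * Real.exp (δ - lam * l1On Finset.univ β₀))
  rw [← lintegral_indicator hN, lintegral_slab hlam S (hL.indicator hN)]
  calc _ ≤ ∫⁻ β, A * (ENNReal.ofReal (Real.exp (-lam * l1On S₀ᶜ β)) * likelihood X Y β)
          ∂(flat S) := by
        refine lintegral_mono_ae ?_
        filter_upwards [ae_flat_supp_subset S] with β hβ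
        by_cases hmem : β ∈ nearTruth X β₀ r
        · rw [Set.indicator_of_mem hmem, ← mul_assoc, ← ENNReal.ofReal_mul (by positivity),
            mul_assoc, ← Real.exp_add]
          gcongr
          have h1 := hδ β hβ hmem
          have h2 : l1On S₀ β₀ ≤ l1On S₀ β + l1On S₀ (β - β₀) := l1On_le_add_sub _ _ _
          have h3 := l1On_add_compl S₀ β
          have h4 := l1On_add_compl S₀ (β - β₀)
          have h5 := l1On_nonneg S₀ᶜ (β - β₀)
          have h6 : l1On S₀ β₀ = l1On Finset.univ β₀ := l1On_supp β₀
          have h7 : l1On Finset.univ β₀ + l1On S₀ᶜ β ≤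
            l1On Finset.univ β + l1On Finset.univ (β - β₀) := by linarith
          nlinarith
        · rw [Set.indicator_of_notMem hmem, mul_zero]
          exact zero_le
    _ = A * ∫⁻ v, ENNReal.ofReal (Real.exp (-lam * l1On Finset.univ v)) *
          evidence X S₀ (Y - predict X v) ∂(flat T) := by
        rw [lintegral_const_mul _ (by fun_prop), ← hunion, lintegral_flat_union hdis (by fun_prop)]
        congr 1
        refine lintegral_congr_ae ?_
        filter_upwards [ae_flat_supp_subset T] with v hv
        rw [evidence, ← lintegral_const_mul _ (measurable_likelihood X _)]
        refine lintegral_congr_ae ?_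
        filter_upwards [ae_flat_supp_subset S₀] with u hu
        rw [likelihood_add]
        congr 4
        have h1 : l1On S₀ᶜ (u + v) = l1On S₀ᶜ v := by
          refine Finset.sum_congr rfl fun i hi => ?_
          have : u i = 0 := by
            by_contra h
            exact Finset.mem_compl.1 hi (hu (mem_supp.2 h))
          rw [PiLp.add_apply, this, zero_add]
        have h2 : l1On S₀ v = 0 := by
          refine Finset.sum_eq_zero fun i hi => ?_
          have : v i = 0 := by
            by_contra h
            exact Finset.disjoint_left.1 hdis hi (hv (mem_supp.2 h))
          rw [this, abs_zero]
        rw [h1, ← l1On_add_compl S₀ v, h2, zero_add]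
    _ = _ := by
        rw [lintegral_slab hlam T hev, ← mul_assoc,
          ← lintegral_const_mul _ (by fun_prop), ← lintegral_const_mul _ (by fun_prop)]
        refine lintegral_congr fun v => ?_
        simp only [A, frozenHeight, ← hS₀, ← mul_assoc]
        rw [← ENNReal.ofReal_mul (by positivity), ← ENNReal.ofReal_mul (by positivity),
          ← ENNReal.ofReal_mul (by positivity), hcard, sub_eq_add_neg, Real.exp_add, pow_add]
        congr 2
        simp only [neg_mul]
        ring

/-- After exchanging integrals, for each v the evidence ratio has mean at most one and
`frozenHeight` cancels: the data favour a supermodel, on average, by no more than exp δ. -/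
theorem lintegral_near_superset_le (hlam : 0 < lam) {S : Finset (Fin p)}
    (hS : supp β₀ ⊆ S) {r δ : ℝ}
    (hδ : ∀ β : EuclideanSpace ℝ (Fin p), supp β ⊆ S → β ∈ nearTruth X β₀ r →
      lam * l1On Finset.univ (β - β₀) ≤ δ)
    (hw : 0 < modelWeight p π (supp β₀).card) :
    ∫⁻ e, (∫⁻ β in nearTruth X β₀ r, likelihood X (predict X β₀ + e) β ∂(slab lam S)) /
        approxMass X π lam β₀ (predict X β₀ + e) ∂(stdGaussian (EuclideanSpace ℝ (Fin n))) ≤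
      ENNReal.ofReal (Real.exp δ / modelWeight p π (supp β₀).card) := by
  set S₀ := supp β₀
  set w := modelWeight p π S₀.card
  have hf := frozenHeight_pos β₀ hlam
  have i1 := isProbabilityMeasure_slab hlam (S \ S₀)
  set c : ℝ≥0∞ := ENNReal.ofReal (Real.exp δ / w) with hc
  have hm1 : Measurable fun q : EuclideanSpace ℝ (Fin n) × EuclideanSpace ℝ (Fin p) =>
      evidence X S₀ (predict X β₀ + q.1 - predict X q.2) :=
    (measurable_evidence X S₀).comp (by fun_prop)
  have hm2 : Measurable fun q : EuclideanSpace ℝ (Fin n) × EuclideanSpace ℝ (Fin p) =>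
      evidence X S₀ (predict X β₀ + q.1) := (measurable_evidence X S₀).comp (by fun_prop)
  have hm3 : Measurable fun q : EuclideanSpace ℝ (Fin n) × EuclideanSpace ℝ (Fin p) =>
      evidence X S₀ (predict X β₀ + q.1 - predict X q.2) / evidence X S₀ (predict X β₀ + q.1) :=
    hm1.div hm2
  have hmv : ∀ e, Measurable fun v => evidence X S₀ (predict X β₀ + e - predict X v) := fun e =>
    (measurable_evidence X S₀).comp (by fun_prop)
  calc _ ≤ ∫⁻ e, c * ∫⁻ v, evidence X S₀ (predict X β₀ + e - predict X v) /
          evidence X S₀ (predict X β₀ + e) ∂(slab lam (S \ S₀))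
          ∂(stdGaussian (EuclideanSpace ℝ (Fin n))) := by
        refine lintegral_mono fun e => ?_
        set Y := predict X β₀ + e
        have h1 := setLIntegral_slab_near_superset_le hlam hS hδ Y
        refine (ENNReal.div_le_div_right h1 _).trans (le_of_eq ?_)
        simp_rw [div_eq_mul_inv]
        rw [lintegral_mul_const _ (hmv e), approxMass]
        have hA0 : ENNReal.ofReal (frozenHeight lam β₀) ≠ 0 := by simpa using hf
        have hw0 : ENNReal.ofReal w ≠ 0 := by simpa using hw
        rw [ENNReal.mul_inv (Or.inl (mul_ne_zero hw0 hA0)) (Or.inl (by finiteness)),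
          ENNReal.mul_inv (Or.inl hw0) (Or.inl (by finiteness)), hc,
          ENNReal.ofReal_div_of_pos hw, div_eq_mul_inv]
        set I := ∫⁻ v, evidence X S₀ (Y - predict X v) ∂(slab lam (S \ S₀))
        calc _ = ENNReal.ofReal (Real.exp δ) * (ENNReal.ofReal w)⁻¹ * (I * (evidence X S₀ Y)⁻¹) *
              (ENNReal.ofReal (frozenHeight lam β₀) *
                (ENNReal.ofReal (frozenHeight lam β₀))⁻¹) := by ring
          _ = _ := by rw [ENNReal.mul_inv_cancel hA0 (by finiteness), mul_one]
    _ = c * ∫⁻ v, ∫⁻ e, evidence X S₀ (predict X β₀ + e - predict X v) /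
          evidence X S₀ (predict X β₀ + e) ∂(stdGaussian (EuclideanSpace ℝ (Fin n)))
          ∂(slab lam (S \ S₀)) := by
        rw [lintegral_const_mul _ hm3.lintegral_prod_right', lintegral_lintegral_swap]
        exact hm3.aemeasurable
    _ ≤ c * ∫⁻ _v, 1 ∂(slab lam (S \ S₀)) := by
        gcongr
        exact lintegral_evidence_ratio_le X S₀ subset_rfl _
    _ = c := by simp

end Masses

/-! ### The unnormalized posterior and its comparison with the approximation -/

section Posterior

variable {X : Matrix (Fin n) (Fin p) ℝ} {π : ℕ → ℝ} {lam : ℝ} {β₀ : EuclideanSpace ℝ (Fin p)}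

variable (X π lam) in
/-- The unnormalized posterior distribution. -/
def posteriorMeasure (Y : EuclideanSpace ℝ (Fin n)) : Measure (EuclideanSpace ℝ (Fin p)) :=
  (prior π lam).withDensity (likelihood X Y)

theorem posteriorMeasure_univ (Y : EuclideanSpace ℝ (Fin n)) :
    posteriorMeasure X π lam Y Set.univ = ∑ S : Finset (Fin p),
      ENNReal.ofReal (modelWeight p π S.card) * ∫⁻ β, likelihood X Y β ∂(slab lam S) := by
  rw [posteriorMeasure, withDensity_apply _ MeasurableSet.univ, Measure.restrict_univ,
    lintegral_prior]
  rfl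

theorem posterior_eq (Y : EuclideanSpace ℝ (Fin n)) :
    posterior X π lam Y =
      (posteriorMeasure X π lam Y Set.univ)⁻¹ • posteriorMeasure X π lam Y := by
  rw [posterior, posteriorMeasure, withDensity_apply _ MeasurableSet.univ, Measure.restrict_univ]

theorem posteriorMeasure_univ_ne_zero (hπ : IsDimPrior p π) (hlam : 0 < lam)
    (Y : EuclideanSpace ℝ (Fin n)) : posteriorMeasure X π lam Y Set.univ ≠ 0 := by
  have i1 := isProbabilityMeasure_prior (p := p) hπ hlam
  rw [posteriorMeasure, withDensity_apply _ MeasurableSet.univ, Measure.restrict_univ]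
  intro h
  rw [lintegral_eq_zero_iff (measurable_likelihood X Y)] at h
  have h2 : ∀ᵐ _β ∂(prior (p := p) π lam), False := by
    filter_upwards [h] with β hβ
    simp only [likelihood, Pi.zero_apply, ENNReal.ofReal_eq_zero] at hβ
    exact absurd hβ (not_le.2 (Real.exp_pos _))
  simp at h2
  exact IsProbabilityMeasure.ne_zero _ h2

theorem posteriorMeasure_univ_ne_top (hπ : IsDimPrior p π) (hlam : 0 < lam)
    (Y : EuclideanSpace ℝ (Fin n)) : posteriorMeasure X π lam Y Set.univ ≠ ∞ := by
  have i1 := isProbabilityMeasure_prior (p := p) hπ hlam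
  rw [posteriorMeasure, withDensity_apply _ MeasurableSet.univ, Measure.restrict_univ]
  refine ne_top_of_le_ne_top ENNReal.one_ne_top ?_
  calc ∫⁻ β, likelihood X Y β ∂(prior π lam) ≤ ∫⁻ _β, 1 ∂(prior (p := p) π lam) := by
        refine lintegral_mono fun β => ENNReal.ofReal_le_one.2 (Real.exp_le_one_iff.2 ?_)
        have := sq_nonneg ‖Y - predict X β‖
        linarith
    _ = 1 := by simp

theorem isProbabilityMeasure_posterior (hπ : IsDimPrior p π) (hlam : 0 < lam)
    (Y : EuclideanSpace ℝ (Fin n)) : IsProbabilityMeasure (posterior X π lam Y) := by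
  rw [posterior_eq]
  exact ⟨by simp [ENNReal.inv_mul_cancel (posteriorMeasure_univ_ne_zero hπ hlam Y)
    (posteriorMeasure_univ_ne_top hπ hlam Y)]⟩

instance (S : Finset (Fin p)) (b : EuclideanSpace ℝ S) :
    IsProbabilityMeasure (normalOnModel X S b) := by
  unfold normalOnModel
  exact Measure.isProbabilityMeasure_map ((measurable_zeroExtend S).comp (by fun_prop)).aemeasurable

theorem normalOnModel_eq_approxMeasure (hlam : 0 < lam)
    (hw : 0 < modelWeight p π (supp β₀).card)
    (hinj : Function.Injective (modelLin X (supp β₀))) {Y : EuclideanSpace ℝ (Fin n)}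
    {b : EuclideanSpace ℝ (supp β₀)} (hb : IsLeastSquares X (supp β₀) Y b) :
    approxMeasure X π lam β₀ Y Set.univ ≠ 0 ∧ approxMeasure X π lam β₀ Y Set.univ ≠ ∞ ∧
      normalOnModel X (supp β₀) b =
        (approxMeasure X π lam β₀ Y Set.univ)⁻¹ • approxMeasure X π lam β₀ Y := by
  obtain ⟨h0, ht, heq⟩ := normalOnModel_eq X (supp β₀) hinj hb
  have hf := frozenHeight_pos β₀ hlam
  set k := ENNReal.ofReal (modelWeight p π (supp β₀).card) * ENNReal.ofReal (frozenHeight lam β₀)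
    with hk
  have hk0 : k ≠ 0 := mul_ne_zero (by simpa using hw) (by simpa using hf)
  have hkt : k ≠ ∞ := by finiteness
  have hmass : approxMeasure X π lam β₀ Y Set.univ = k * evidence X (supp β₀) Y :=
    approxMeasure_univ X π lam β₀ Y
  rw [hmass]
  refine ⟨mul_ne_zero hk0 h0, ENNReal.mul_ne_top hkt ht, ?_⟩
  rw [heq, approxMeasure, ← hk, smul_smul, ENNReal.mul_inv (Or.inl hk0) (Or.inl hkt),
    mul_comm k⁻¹, mul_assoc, ENNReal.inv_mul_cancel hk0 hkt, mul_one]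

/-- All terms of the prior mixture except the true model are discarded, and near the truth its
density is at least exp(-δ) times the frozen one. -/
theorem exp_mul_approxMeasure_le (hlam : 0 < lam) {r δ : ℝ}
    (hδ : ∀ β : EuclideanSpace ℝ (Fin p), supp β ⊆ supp β₀ → β ∈ nearTruth X β₀ r →
      lam * l1On Finset.univ (β - β₀) ≤ δ) (Y : EuclideanSpace ℝ (Fin n))
    {B : Set (EuclideanSpace ℝ (Fin p))} (hB : MeasurableSet B) :
    ENNReal.ofReal (Real.exp (-δ)) * approxMeasure X π lam β₀ Y (B ∩ nearTruth X β₀ r) ≤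
      posteriorMeasure X π lam Y B := by
  set S₀ := supp β₀ with hS₀
  set N := nearTruth X β₀ r
  have hN : MeasurableSet N := measurableSet_nearTruth X β₀ r
  have hBN := hB.inter hN
  have hL := measurable_likelihood X Y
  rw [approxMeasure, Measure.smul_apply, smul_eq_mul, withDensity_apply _ hBN, posteriorMeasure,
    withDensity_apply _ hB, ← lintegral_indicator hB, lintegral_prior]
  refine le_trans ?_ (Finset.single_le_sum (f := fun S : Finset (Fin p) =>
    ENNReal.ofReal (π S.card / (p.choose S.card : ℝ)) *
      ∫⁻ β, B.indicator (likelihood X Y) β ∂(slab lam S)) (fun _ _ => zero_le)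
    (Finset.mem_univ S₀))
  change _ ≤ ENNReal.ofReal (modelWeight p π S₀.card) * _
  rw [mul_left_comm, mul_assoc]
  gcongr
  rw [mul_left_comm, ← mul_assoc, ← ENNReal.ofReal_mul (Real.exp_pos _).le,
    lintegral_slab hlam S₀ (hL.indicator hB), ← lintegral_indicator hBN,
    ← lintegral_const_mul _ (hL.indicator hBN)]
  refine lintegral_mono_ae ?_
  filter_upwards [ae_flat_supp_subset S₀] with β hβ
  by_cases hmem : β ∈ B ∩ N
  · rw [Set.indicator_of_mem hmem, Set.indicator_of_mem hmem.1, frozenHeight, ← hS₀]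
    refine mul_le_mul' (ENNReal.ofReal_le_ofReal ?_) le_rfl
    rw [mul_left_comm, ← Real.exp_add]
    gcongr
    have h1 := hδ β hβ hmem.2
    have h2 := l1On_le_add_sub Finset.univ β β₀
    have h3 : l1On Finset.univ (β₀ - β) = l1On Finset.univ (β - β₀) := by
      refine Finset.sum_congr rfl fun i _ => ?_
      rw [PiLp.sub_apply, PiLp.sub_apply, abs_sub_comm]
    rw [h3] at h2
    nlinarith
  · rw [Set.indicator_of_notMem hmem, mul_zero]
    exact zero_le

theorem setLIntegral_slab_near_self_le (hlam : 0 < lam) {r δ : ℝ}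
    (hδ : ∀ β : EuclideanSpace ℝ (Fin p), supp β ⊆ supp β₀ → β ∈ nearTruth X β₀ r →
      lam * l1On Finset.univ (β - β₀) ≤ δ) (Y : EuclideanSpace ℝ (Fin n)) :
    ENNReal.ofReal (modelWeight p π (supp β₀).card) *
      ∫⁻ β in nearTruth X β₀ r, likelihood X Y β ∂(slab lam (supp β₀)) ≤
      ENNReal.ofReal (Real.exp δ) * approxMass X π lam β₀ Y := by
  have i1 := isProbabilityMeasure_slab hlam (supp β₀ \ supp β₀)
  have h := setLIntegral_slab_near_superset_le hlam (subset_refl (supp β₀)) hδ Y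
  have h2 : ∫⁻ v, evidence X (supp β₀) (Y - predict X v) ∂(slab lam (supp β₀ \ supp β₀)) =
      evidence X (supp β₀) Y := by
    have : ∫⁻ v, evidence X (supp β₀) (Y - predict X v) ∂(slab lam (supp β₀ \ supp β₀)) =
        ∫⁻ _v, evidence X (supp β₀) Y ∂(slab lam (supp β₀ \ supp β₀)) := by
      refine lintegral_congr_ae ?_
      filter_upwards [ae_slab_supp_subset hlam (supp β₀ \ supp β₀)] with v hv
      have hv0 : v = 0 := by
        ext i
        by_contra hi
        have := hv (mem_supp.2 hi)
        simp at this
      rw [hv0, predict_zero, sub_zero]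
    rw [this, lintegral_const, measure_univ, mul_one]
  rw [h2] at h
  rw [approxMass]
  calc _ ≤ ENNReal.ofReal (modelWeight p π (supp β₀).card) * (ENNReal.ofReal (Real.exp δ) *
        (ENNReal.ofReal (frozenHeight lam β₀) * evidence X (supp β₀) Y)) := by gcongr
    _ = _ := by ring

end Posterior

/-! ### The nonasymptotic bound -/

section ExpectedDistance

variable {X : Matrix (Fin n) (Fin p) ℝ} {π : ℕ → ℝ} {lam : ℝ} {β₀ : EuclideanSpace ℝ (Fin p)}

/-- A nonasymptotic bound on the expected total variation distance. -/
theorem lintegral_tvDist_le (hX : 0 < colNorm X) (hp : 1 ≤ p) (hbar : 0 < lamBar X)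
    (hr : LambdaRange X lam) (hπ : IsDimPrior p π) {A₄ c₀ K ψ δ η₁ η₂ η₃ : ℝ} (hA₄ : 1 < A₄)
    (hc₀ : 0 < c₀) (hφ : ENNReal.ofReal c₀ ≤ compat X (supp β₀))
    (hw : 0 < modelWeight p π (supp β₀).card)
    (hK : 64 ≤ K) (hψ : 0 < ψ) (hψ1 : ψ ≤ 1)
    (hψd : ∀ d : EuclideanSpace ℝ (Fin p), ((supp d).card : ℝ) ≤ (2 + 3 / A₄) * (supp β₀).card →
      ψ * (colNorm X * ‖d‖) ≤ ‖predict X d‖)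
    (hmin : ∀ i ∈ supp β₀, radius p K ψ (supp β₀).card < ψ * (colNorm X * |β₀ i|))
    (hδ0 : 0 ≤ δ) (hη₁ : 0 ≤ η₁) (hη₂ : 0 ≤ η₂) (hη₃ : 0 ≤ η₃)
    (hδ : 3 * K / ψ ^ 2 * ((supp β₀).card * lam * Real.sqrt (Real.log p) / colNorm X) ≤ δ)
    (hlarge : ∑ S : Finset (Fin p) with ¬ A₄ * S.card ≤ (A₄ + 3) * (supp β₀).card,
      modelWeight p π S.card * 4 ^ S.card ≤ evidenceFloor p π (supp β₀).card * η₁)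
    (hsmall : farFactor p K (supp β₀).card *
      ∑ S : Finset (Fin p) with A₄ * S.card ≤ (A₄ + 3) * (supp β₀).card,
        modelWeight p π S.card * 4 ^ S.card ≤ evidenceFloor p π (supp β₀).card * η₂)
    (hsup : ∑ S : Finset (Fin p) with supp β₀ ⊂ S, modelWeight p π S.card ≤
      modelWeight p π (supp β₀).card * η₃)
    {ν : EuclideanSpace ℝ (Fin n) → Measure (EuclideanSpace ℝ (Fin p))}
    [∀ Y, IsProbabilityMeasure (ν Y)]
    (hν : ∀ Y, approxMeasure X π lam β₀ Y Set.univ ≠ 0 ∧ approxMeasure X π lam β₀ Y Set.univ ≠ ∞ ∧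
      ν Y = (approxMeasure X π lam β₀ Y Set.univ)⁻¹ • approxMeasure X π lam β₀ Y) :
    ∫⁻ Y, tvDist (posterior X π lam Y) (ν Y) ∂(dataLaw X β₀) ≤
      ENNReal.ofReal (2 / p + (2 * δ + 2 * η₂ + Real.exp (49 * lam * lamBar X * (supp β₀).card /
        (16 * (c₀ * colNorm X) ^ 2)) * η₁ + Real.exp δ * η₃)) := by
  obtain ⟨hlam, hlam', hlam2⟩ := hr
  set S₀ := supp β₀ with hS₀
  set s₀ := S₀.card with hs₀
  set N := nearTruth X β₀ (radius p K ψ s₀) with hNdef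
  have hN : MeasurableSet N := measurableSet_nearTruth X β₀ _
  set ω := evidenceFloor p π s₀ with hωdef
  set w₀ := modelWeight p π s₀ with hw₀
  set Q := 49 * lam * lamBar X * s₀ / (16 * (c₀ * colNorm X) ^ 2)
  have hp0 : 0 < p := hp
  have hω : 0 < ω := by
    have hc : (0 : ℝ) < p.choose s₀ := by exact_mod_cast Nat.choose_pos (card_le_dim S₀)
    have : 0 < π s₀ := by
      have h := mul_pos hw hc
      rwa [hw₀, modelWeight, div_mul_cancel₀ _ hc.ne'] at h
    rw [hωdef, evidenceFloor]
    positivity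
  set D := 2 + 3 / A₄ with hD
  have hA₄0 : 0 < A₄ := by linarith
  have hD5 : D ≤ 5 := by
    have : 3 / A₄ ≤ 3 := (div_le_iff₀ hA₄0).2 (by linarith)
    linarith
  have hD2 : 2 ≤ D := by
    have : 0 ≤ 3 / A₄ := by positivity
    linarith
  set W : Finset (Fin p) → ℝ≥0∞ := fun S => ENNReal.ofReal (modelWeight p π S.card) with hW
  -- The cut at (1 + 3/A₄) s₀ keeps β - β₀ within the sparsity (2 + 3/A₄) s₀ for which the lower
  -- bound with ψ holds.
  have hsmallD : ∀ S : Finset (Fin p), A₄ * S.card ≤ (A₄ + 3) * s₀ →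
      (S.card + s₀ : ℝ) ≤ D * s₀ := by
    intro S hS
    have h1 : A₄ * (S.card + s₀) ≤ A₄ * (D * s₀) := by
      have : A₄ * (D * s₀) = (2 * A₄ + 3) * s₀ := by rw [hD]; field_simp
      rw [this]
      linarith
    exact le_of_mul_le_mul_left h1 hA₄0
  have hS₀small : A₄ * S₀.card ≤ (A₄ + 3) * s₀ := by
    rw [← hs₀]
    have : (0 : ℝ) ≤ s₀ := Nat.cast_nonneg _
    linarith
  have hnear : ∀ S : Finset (Fin p), A₄ * S.card ≤ (A₄ + 3) * s₀ →
      ∀ β : EuclideanSpace ℝ (Fin p), supp β ⊆ S → β ∈ N →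
        lam * l1On Finset.univ (β - β₀) ≤ δ := by
    intro S hS β hβ hβN
    have h1 : ((supp (β - β₀)).card : ℝ) ≤ D * s₀ :=
      le_trans (by exact_mod_cast supp_sub_card_le β β₀ hβ) (hsmallD S hS)
    exact (lam_mul_l1On_le hX hlam hψ (hψd _ h1) h1 hD5 hβN).trans hδ
  set a : Finset (Fin p) → EuclideanSpace ℝ (Fin n) → ℝ≥0∞ := fun S e =>
    ∫⁻ β, likelihood X (predict X β₀ + e) β ∂(slab lam S) with ha
  set b : Finset (Fin p) → EuclideanSpace ℝ (Fin n) → ℝ≥0∞ := fun S e =>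
    ∫⁻ β in N, likelihood X (predict X β₀ + e) β ∂(slab lam S) with hbdef
  set g : EuclideanSpace ℝ (Fin n) → ℝ≥0∞ := fun e => approxMass X π lam β₀ (predict X β₀ + e)
    with hg
  have hlik : Measurable fun q : EuclideanSpace ℝ (Fin n) × EuclideanSpace ℝ (Fin p) =>
      likelihood X (predict X β₀ + q.1) q.2 :=
    (measurable_likelihood_uncurry X).comp
      (f := fun q : EuclideanSpace ℝ (Fin n) × EuclideanSpace ℝ (Fin p) =>
        (predict X β₀ + q.1, q.2)) (by fun_prop)
  have hgm : Measurable g := (measurable_approxMass X π lam β₀).comp (by fun_prop)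
  have ham : ∀ S, Measurable fun e => a S e / g e := by
    intro S
    have := isProbabilityMeasure_slab hlam S
    exact (hlik.lintegral_prod_right').div hgm
  have hbm : ∀ S, Measurable fun e => b S e / g e := by
    intro S
    have := isProbabilityMeasure_slab hlam S
    exact (hlik.lintegral_prod_right' (ν := (slab lam S).restrict N)).div hgm
  set large := Finset.univ.filter fun S : Finset (Fin p) => ¬ A₄ * S.card ≤ (A₄ + 3) * s₀
  set small := Finset.univ.filter fun S : Finset (Fin p) => A₄ * S.card ≤ (A₄ + 3) * s₀
  set above := small.filter fun S => S₀ ⊂ S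
  have hWnn : ∀ S : Finset (Fin p), 0 ≤ modelWeight p π S.card := fun S =>
    modelWeight_nonneg hπ (card_le_dim S)
  have hsumW : ∀ T : Finset (Finset (Fin p)), ∑ S ∈ T, W S * 4 ^ S.card =
      ENNReal.ofReal (∑ S ∈ T, modelWeight p π S.card * 4 ^ S.card) := by
    intro T
    rw [ENNReal.ofReal_sum_of_nonneg fun S _ => mul_nonneg (hWnn S) (by positivity)]
    refine Finset.sum_congr rfl fun S _ => ?_
    rw [ENNReal.ofReal_mul (hWnn S), ENNReal.ofReal_pow (by norm_num)]
    norm_num [hW]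
  have hθ := farFactor_nonneg p K s₀
  have hfar : ∀ e ∈ noiseEvent X, ENNReal.ofReal (Real.exp (-‖e‖ ^ 2 / 2)) *
      ENNReal.ofReal (farFactor p K s₀ * Real.exp (-lam * l1On Finset.univ β₀)) *
        ∑ S ∈ small, W S * 4 ^ S.card ≤ ENNReal.ofReal η₂ * g e := by
    intro e _
    rw [hsumW]
    refine le_trans ?_ (mul_le_mul_right (approxMass_ge hX hp0 hπ hlam hlam' e) _)
    rw [mul_assoc, ← ENNReal.ofReal_mul (by positivity), mul_left_comm,
      ← ENNReal.ofReal_mul hη₂]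
    refine mul_le_mul' le_rfl (ENNReal.ofReal_le_ofReal ?_)
    calc _ = farFactor p K s₀ * (∑ S ∈ small, modelWeight p π S.card * 4 ^ S.card) *
          Real.exp (-lam * l1On Finset.univ β₀) := by ring
      _ ≤ ω * η₂ * Real.exp (-lam * l1On Finset.univ β₀) := by gcongr
      _ = _ := by ring
  set η : EuclideanSpace ℝ (Fin n) → ℝ≥0∞ := fun e =>
    ∑ S ∈ large, W S * (a S e / g e) + ENNReal.ofReal η₂ + ∑ S ∈ above, W S * (b S e / g e)
  have hpt : ∀ e ∈ noiseEvent X, tvDist (posterior X π lam (predict X β₀ + e))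
      (ν (predict X β₀ + e)) ≤
        ENNReal.ofReal (2 * δ) + η e + ENNReal.ofReal η₂ := by
    intro e he
    set Y := predict X β₀ + e
    obtain ⟨hg0, hgt, hgeq⟩ := hν Y
    have hgu : approxMeasure X π lam β₀ Y Set.univ = g e := approxMeasure_univ X π lam β₀ Y
    rw [hgeq, posterior_eq]
    refine tvDist_normalize_le _ _ hN hδ0 (posteriorMeasure_univ_ne_zero hπ hlam Y)
      (posteriorMeasure_univ_ne_top hπ hlam Y) hg0 hgt
      (fun B hB => exp_mul_approxMeasure_le hlam (hnear S₀ hS₀small) Y hB) ?_ ?_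
    · rw [hgu] at hg0 hgt ⊢
      rw [posteriorMeasure_univ, ← Finset.sum_filter_add_sum_filter_not Finset.univ
        (fun S : Finset (Fin p) => A₄ * S.card ≤ (A₄ + 3) * s₀)]
      have h1 : ∑ S ∈ large, W S * a S e = (∑ S ∈ large, W S * (a S e / g e)) * g e := by
        rw [Finset.sum_mul]
        refine Finset.sum_congr rfl fun S _ => ?_
        rw [mul_assoc, ENNReal.div_mul_cancel hg0 hgt]
      have h2 : ∑ S ∈ above, W S * b S e = (∑ S ∈ above, W S * (b S e / g e)) * g e := by
        rw [Finset.sum_mul]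
        refine Finset.sum_congr rfl fun S _ => ?_
        rw [mul_assoc, ENNReal.div_mul_cancel hg0 hgt]
      have h3 : ∑ S ∈ small, W S * a S e = ∑ S ∈ small, W S * b S e +
          ∑ S ∈ small, W S * ∫⁻ β in Nᶜ, likelihood X Y β ∂(slab lam S) := by
        rw [← Finset.sum_add_distrib]
        refine Finset.sum_congr rfl fun S _ => ?_
        rw [← mul_add, hbdef]
        congr 1
        exact (lintegral_add_compl _ hN).symm
      have h4 : ∑ S ∈ small, W S * ∫⁻ β in Nᶜ, likelihood X Y β ∂(slab lam S) ≤
          ENNReal.ofReal η₂ * g e := by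
        refine le_trans ?_ (hfar e he)
        rw [Finset.mul_sum]
        refine Finset.sum_le_sum fun S hS => ?_
        rw [mul_left_comm]
        gcongr
        exact setLIntegral_slab_far_le hX hlam hlam2 hp hK hψ hψ1 hψd hD5 he
          (hsmallD S (Finset.mem_filter.1 hS).2)
      have h5 : ∑ S ∈ small, W S * b S e ≤ W S₀ * b S₀ e + ∑ S ∈ above, W S * b S e := by
        refine le_of_le_of_eq ?_ (Finset.sum_insert (f := fun S => W S * b S e)
          (a := S₀) (s := above) (by simp [above]))
        refine Finset.sum_le_sum_of_ne_zero fun S hS hne => ?_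
        by_cases hsub : S₀ ⊆ S
        · rcases eq_or_ne S S₀ with rfl | hSne
          · exact Finset.mem_insert_self _ _
          · exact Finset.mem_insert_of_mem (Finset.mem_filter.2
              ⟨hS, Finset.ssubset_iff_subset_ne.2 ⟨hsub, hSne.symm⟩⟩)
        · exfalso
          apply hne
          -- A coordinate i of S₀ missed by `S` gives ‖X(β - β₀)‖ ≥ ψ‖X‖|β₀ i|, more than the
          -- radius, so the model has no mass near the truth.
          have hb0 : b S e = 0 := by
            rw [hbdef]
            have hae : ∀ᵐ β ∂((slab lam S).restrict N), False := by
              filter_upwards [ae_restrict_of_ae (ae_slab_supp_subset hlam S),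
                ae_restrict_mem hN] with β hβ hβN
              obtain ⟨i, hi, hiS⟩ := Finset.not_subset.1 hsub
              have hβi : β i = 0 := by
                by_contra h
                exact hiS (hβ (mem_supp.2 h))
              have hd : ((supp (β - β₀)).card : ℝ) ≤ D * s₀ :=
                le_trans (by exact_mod_cast supp_sub_card_le β β₀ hβ)
                  (hsmallD S (Finset.mem_filter.1 hS).2)
              have h7 := hψd _ hd
              have h8 : |β₀ i| ≤ ‖β - β₀‖ := by
                have := PiLp.norm_apply_le (β - β₀) i
                rwa [PiLp.sub_apply, hβi, zero_sub, norm_neg, Real.norm_eq_abs] at this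
              have h9 := hmin i hi
              have h10 : ψ * (colNorm X * |β₀ i|) ≤ ψ * (colNorm X * ‖β - β₀‖) := by gcongr
              have h11 : ‖predict X (β - β₀)‖ ≤ radius p K ψ s₀ := hβN
              linarith
            have hz : (slab lam S).restrict N = 0 := by
              rw [← Measure.measure_univ_eq_zero]
              simpa [ae_iff] using hae
            change ∫⁻ β, likelihood X (predict X β₀ + e) β ∂((slab lam S).restrict N) = 0
            rw [hz, lintegral_zero_measure]
          rw [hb0, mul_zero]
      have h6 : W S₀ * b S₀ e ≤ ENNReal.ofReal (Real.exp δ) * g e :=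
        setLIntegral_slab_near_self_le hlam (hnear S₀ hS₀small) Y
      calc ∑ S ∈ small, W S * a S e + ∑ S ∈ large, W S * a S e
          ≤ (ENNReal.ofReal (Real.exp δ) * g e + (∑ S ∈ above, W S * (b S e / g e)) * g e +
            ENNReal.ofReal η₂ * g e) + (∑ S ∈ large, W S * (a S e / g e)) * g e := by
            rw [h3, ← h1, ← h2]
            gcongr
            exact h5.trans (by gcongr)
        _ = _ := by simp only [η]; ring
    · rw [hgu, approxMeasure, Measure.smul_apply, smul_eq_mul, withDensity_apply _ hN.compl]
      refine le_trans ?_ (hfar e he)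
      rw [mul_assoc]
      refine (mul_le_mul_right (setLIntegral_flat_far_le hX hlam hlam2 hp hK hψ hψ1 hψd hD5 hD2 he)
        _).trans ?_
      rw [mul_left_comm]
      gcongr
      exact Finset.single_le_sum (f := fun S : Finset (Fin p) => W S * 4 ^ S.card)
        (fun _ _ => zero_le) (Finset.mem_filter.2 ⟨Finset.mem_univ S₀, hS₀small⟩)
  have i1 : ∀ Y, IsProbabilityMeasure (posterior X π lam Y) := fun Y =>
    isProbabilityMeasure_posterior hπ hlam Y
  have hT := measurableSet_noiseEvent X
  set P := stdGaussian (EuclideanSpace ℝ (Fin n))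
  have hI1 : ∫⁻ e in noiseEvent X, ∑ S ∈ large, W S * (a S e / g e) ∂P ≤
      ENNReal.ofReal (Real.exp Q * η₁) := by
    rw [lintegral_finsetSum _ fun S _ => (ham S).const_mul _]
    calc _ ≤ ∑ S ∈ large, W S * (ENNReal.ofReal (Real.exp Q / ω) * 4 ^ S.card) := by
          refine Finset.sum_le_sum fun S _ => ?_
          rw [lintegral_const_mul _ (ham S)]
          gcongr
          exact lintegral_noiseEvent_mass_le hX hp0 hπ hlam hlam' hbar hlam2 hc₀ hφ hω S
      _ = ENNReal.ofReal (Real.exp Q / ω) * ∑ S ∈ large, W S * 4 ^ S.card := by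
          rw [Finset.mul_sum]
          exact Finset.sum_congr rfl fun S _ => by ring
      _ ≤ ENNReal.ofReal (Real.exp Q / ω) * ENNReal.ofReal (ω * η₁) := by
          rw [hsumW]
          gcongr
      _ = _ := by
          rw [← ENNReal.ofReal_mul (by positivity)]
          congr 1
          field_simp
  have hI2 : ∫⁻ e in noiseEvent X, ∑ S ∈ above, W S * (b S e / g e) ∂P ≤
      ENNReal.ofReal (Real.exp δ * η₃) := by
    rw [lintegral_finsetSum _ fun S _ => (hbm S).const_mul _]
    calc _ ≤ ∑ S ∈ above, W S * ENNReal.ofReal (Real.exp δ / w₀) := by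
          refine Finset.sum_le_sum fun S hS => ?_
          rw [lintegral_const_mul _ (hbm S)]
          gcongr
          obtain ⟨hS1, hS2⟩ := Finset.mem_filter.1 hS
          exact (setLIntegral_le_lintegral _ _).trans (lintegral_near_superset_le hlam hS2.1
            (hnear S (Finset.mem_filter.1 hS1).2) hw)
      _ = ENNReal.ofReal (∑ S ∈ above, modelWeight p π S.card) *
            ENNReal.ofReal (Real.exp δ / w₀) := by
          rw [← Finset.sum_mul, ENNReal.ofReal_sum_of_nonneg fun S _ => hWnn S]
      _ ≤ ENNReal.ofReal (w₀ * η₃) * ENNReal.ofReal (Real.exp δ / w₀) := by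
          gcongr
          refine le_trans (Finset.sum_le_sum_of_subset_of_nonneg ?_ fun S _ _ => hWnn S) hsup
          intro S hS
          exact Finset.mem_filter.2 ⟨Finset.mem_univ _, (Finset.mem_filter.1 hS).2⟩
      _ = _ := by
          rw [← ENNReal.ofReal_mul (by positivity)]
          congr 1
          field_simp
  -- Off the noise event the distance is bounded by 1, giving 2/p; on it the pointwise bound is
  -- integrated.
  rw [lintegral_dataLaw, ← lintegral_add_compl _ hT, add_comm,
    ENNReal.ofReal_add (by positivity) (by positivity)]
  refine add_le_add ?_ ?_
  · calc _ ≤ ∫⁻ _e in (noiseEvent X)ᶜ, 1 ∂P := lintegral_mono fun e => tvDist_le_one _ _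
      _ = P (noiseEvent X)ᶜ := by simp
      _ ≤ _ := stdGaussian_noiseEvent_compl_le X hX hp
  · have hsumm1 : Measurable fun e => ∑ S ∈ large, W S * (a S e / g e) :=
      Finset.measurable_sum _ fun S _ => (ham S).const_mul _
    have hsumm2 : Measurable fun e => ∑ S ∈ above, W S * (b S e / g e) :=
      Finset.measurable_sum _ fun S _ => (hbm S).const_mul _
    calc _ ≤ ∫⁻ e in noiseEvent X, (ENNReal.ofReal (2 * δ + 2 * η₂) +
          ∑ S ∈ large, W S * (a S e / g e) + ∑ S ∈ above, W S * (b S e / g e)) ∂P := by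
          refine setLIntegral_mono' hT fun e he => (hpt e he).trans (le_of_eq ?_)
          rw [ENNReal.ofReal_add (by positivity) (by positivity), two_mul η₂,
            ENNReal.ofReal_add hη₂ hη₂]
          simp only [η]
          ring
      _ = ∫⁻ _e in noiseEvent X, ENNReal.ofReal (2 * δ + 2 * η₂) ∂P +
          ∫⁻ e in noiseEvent X, ∑ S ∈ large, W S * (a S e / g e) ∂P +
          ∫⁻ e in noiseEvent X, ∑ S ∈ above, W S * (b S e / g e) ∂P := by
          rw [lintegral_add_right _ hsumm2, lintegral_add_right _ hsumm1]
      _ ≤ ENNReal.ofReal (2 * δ + 2 * η₂) + ENNReal.ofReal (Real.exp Q * η₁) +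
          ENNReal.ofReal (Real.exp δ * η₃) := by
          gcongr
          rw [setLIntegral_const]
          calc _ ≤ ENNReal.ofReal (2 * δ + 2 * η₂) * 1 := by gcongr; exact prob_le_one
            _ = _ := mul_one _
      _ = _ := by
          rw [← ENNReal.ofReal_add (by positivity) (by positivity),
            ← ENNReal.ofReal_add (by positivity) (by positivity)]

end ExpectedDistance

/-! ### Choice of constants and passage to the limit -/

theorem LambdaRange.pos {X : Matrix (Fin n) (Fin p) ℝ} {lam : ℝ} (h : LambdaRange X lam) :
    0 < colNorm X ∧ 0 < lamBar X ∧ 0 < Real.log p := by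
  have hbar : 0 < lamBar X := by linarith [h.1, h.2.2]
  have hX0 := colNorm_nonneg X
  have hX : 0 < colNorm X := by
    rcases hX0.eq_or_lt with h0 | h0
    · rw [lamBar, ← h0] at hbar
      simp at hbar
    · exact h0
  refine ⟨hX, hbar, ?_⟩
  rw [lamBar] at hbar
  exact Real.sqrt_pos.1 (pos_of_mul_pos_right hbar (by positivity))

/-- The rate of the prior mass of overly large models. -/
def largeRate (A₂ A₄ x : ℝ) : ℝ :=
  (4 * Real.exp 1 * x ^ 2) ^ (A₄ / 3) * (4 * (A₂ * x ^ (-A₄)))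

/-- The rate of the prior mass of strict supermodels. -/
def supersetRate (A₂ A₄ a x : ℝ) : ℝ := A₂ * x ^ (-A₄) * (2 * x ^ max a 0)

/-- The nonasymptotic error, as a function of the dimension `x` and of the size `τ` of the bias
caused by the Laplace prior. -/
def approxError (A₁ A₂ A₃ A₄ a c₀ x τ : ℝ) : ℝ :=
  2 / x + (2 * (3 * (64 + A₃) / min c₀ 1 ^ 2 * τ) +
    2 * (2 * Real.exp (1 / 2) * (256 * Real.exp 1 / A₁ / x)) +
    Real.exp (49 / (8 * c₀ ^ 2) * τ) * (2 * Real.exp (1 / 2) * largeRate A₂ A₄ x) +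
    Real.exp (3 * (64 + A₃) / min c₀ 1 ^ 2 * τ) * (2 * supersetRate A₂ A₄ a x))

theorem lintegral_tvDist_le_approxError {X : Matrix (Fin n) (Fin p) ℝ} {π : ℕ → ℝ}
    {lam A₁ A₂ A₃ A₄ M a c₀ s : ℝ} (hA₁ : 0 < A₁) (hA₂ : 0 < A₂) (hA₃ : 0 < A₃) (hA₄ : 1 < A₄)
    (hM : 65 + A₃ ≤ M) (hr : LambdaRange X lam) (hπ : IsDimPrior p π)
    (hd : DimPriorDecay A₁ A₂ A₃ A₄ p π) (hs : s ≤ (p : ℝ) ^ a) (hc₀ : 0 < c₀)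
    (h1 : A₂ * (p : ℝ) ^ (-A₄) ≤ 1 / 4) (h2 : largeRate A₂ A₄ p ≤ 1 / 2)
    (h3 : 256 * Real.exp 1 / A₁ ≤ p) (h4 : supersetRate A₂ A₄ a p ≤ 1 / 2)
    {β₀ : EuclideanSpace ℝ (Fin p)} (hβ₀ : β₀ ∈ paramClass X lam A₄ M c₀ s)
    {bhat : EuclideanSpace ℝ (Fin n) → EuclideanSpace ℝ (supp β₀)}
    (hb : ∀ Y, IsLeastSquares X (supp β₀) Y (bhat Y)) :
    ∫⁻ Y, tvDist (posterior X π lam Y) (normalOnModel X (supp β₀) (bhat Y)) ∂(dataLaw X β₀) ≤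
      ENNReal.ofReal (approxError A₁ A₂ A₃ A₄ a c₀ p
        |s * lam * Real.sqrt (Real.log p) / colNorm X|) := by
  obtain ⟨hX, hbar, hlog⟩ := hr.pos
  have hp0 : 0 < p := by
    rcases Nat.eq_zero_or_pos p with h0 | h0
    · simp [h0] at hlog
    · exact h0
  have hp1 : (1 : ℝ) ≤ p := by exact_mod_cast hp0
  have hlam := hr.1
  obtain ⟨ψ, hψ, hψ1, hmin, hψd, hbeta⟩ :=
    exists_sparse_constant hX (by linarith) (by linarith) hc₀ hβ₀
  obtain ⟨-, hφ, hcard, -⟩ := hβ₀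
  have hp0' : 1 / 2 ≤ π 0 := half_le_prior_zero hπ hd hA₂ h1
  have hs₀p := card_le_dim (supp β₀)
  have hw : 0 < modelWeight p π (supp β₀).card := by
    have h5 := hd.pow_le hA₁ _ hs₀p
    have h6 : 0 < (A₁ * (p : ℝ) ^ (-A₃)) ^ (supp β₀).card * π 0 := by positivity
    exact div_pos (h6.trans_le h5) (by exact_mod_cast Nat.choose_pos hs₀p)
  have hinj := injective_modelLin hX hc₀ hφ
  -- A negative `s` makes the parameter class empty; the absolute value keeps the error bound
  -- nonnegative in all cases.
  set τ := |s * lam * Real.sqrt (Real.log p) / colNorm X| with hτ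
  have hτ0 : 0 ≤ τ := abs_nonneg _
  have hτs : (supp β₀).card * lam * Real.sqrt (Real.log p) / colNorm X ≤ τ := by
    refine le_trans ?_ (le_abs_self _)
    gcongr
  have hm0 : 0 < min c₀ 1 := lt_min hc₀ one_pos
  have hρ0 : 0 ≤ largeRate A₂ A₄ p := by unfold largeRate; positivity
  have hx0 : 0 ≤ supersetRate A₂ A₄ a p := by unfold supersetRate; positivity
  -- The radius constant K = 64 + A₃ is at least 64, as `moderate_exponent_le` needs, and its decay
  -- p^{-K²s/4} beats the evidence floor.
  have hK4 : 3 + A₃ ≤ (64 + A₃) ^ 2 / 4 := by nlinarith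
  refine (lintegral_tvDist_le (A₄ := A₄) (c₀ := c₀) (K := 64 + A₃) (ψ := ψ)
    (δ := 3 * (64 + A₃) / min c₀ 1 ^ 2 * τ)
    (η₁ := 2 * Real.exp (1 / 2) * largeRate A₂ A₄ p)
    (η₂ := 2 * Real.exp (1 / 2) * (256 * Real.exp 1 / A₁ / p))
    (η₃ := 2 * supersetRate A₂ A₄ a p) hX hp0 hbar hr hπ hA₄ hc₀ hφ hw (by linarith) hψ hψ1 hψd
    ?_ (by positivity) (by positivity) (by positivity) (by positivity) ?_ ?_ ?_ ?_
    fun Y => normalOnModel_eq_approxMeasure hlam hw hinj (hb Y)).trans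
      (ENNReal.ofReal_le_ofReal ?_)
  · intro i hi
    have hc : 0 < (supp β₀).card := Finset.card_pos.2 ⟨i, hi⟩
    have hq : 0 < Real.sqrt ((supp β₀).card * Real.log p) := by positivity
    rw [radius, div_lt_iff₀ hψ]
    have h5 : (64 + A₃) * Real.sqrt ((supp β₀).card * Real.log p) <
        M * Real.sqrt ((supp β₀).card * Real.log p) := by gcongr; linarith
    linarith [hbeta i hi]
  · gcongr
  · exact sum_large_le hπ hd hA₂ (by linarith) hp0 hs₀p rfl h2
  · rcases Nat.eq_zero_or_pos (supp β₀).card with h0 | h0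
    · rw [farFactor, if_pos h0, zero_mul]
      have := hπ.1 _ hs₀p
      unfold evidenceFloor
      positivity
    · rw [farFactor, if_neg h0.ne']
      refine le_trans ?_ (rpow_mul_pow_le_evidenceFloor hπ hd hA₁ hp0' hp0 h0 hs₀p hK4 h3)
      gcongr
      exact sum_small_le hπ hA₄ _
  · refine sum_supersets_le hπ hd hA₂ _ ?_ h4
    rw [supersetRate]
    gcongr
    -- The exponent max(a, 0) lets one power dominate both 1 and s, so that 1 + |S₀| ≤ 2 p^{max(a,
    -- 0)} even for negative a.
    have h5 : (1 : ℝ) ≤ (p : ℝ) ^ max a 0 := Real.one_le_rpow hp1 (le_max_right _ _)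
    have h6 : (p : ℝ) ^ a ≤ (p : ℝ) ^ max a 0 :=
      Real.rpow_le_rpow_of_exponent_le hp1 (le_max_left _ _)
    linarith
  · rw [approxError]
    gcongr
    calc 49 * lam * lamBar X * (supp β₀).card / (16 * (c₀ * colNorm X) ^ 2)
        = 49 / (8 * c₀ ^ 2) * ((supp β₀).card * lam * Real.sqrt (Real.log p) / colNorm X) := by
          rw [lamBar]
          field_simp
          ring
      _ ≤ _ := by gcongr

/-- The powers combine to 2A₄/3 - A₄ = -A₄/3; any cut-off (1 + c/A₄)|S₀| with c > 2 would leave a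
negative exponent. -/
theorem tendsto_largeRate {A₂ A₄ : ℝ} (hA₄ : 0 < A₄) :
    Tendsto (largeRate A₂ A₄) atTop (𝓝 0) := by
  have h := (tendsto_rpow_neg_atTop (y := A₄ / 3) (by positivity)).const_mul
    ((4 * Real.exp 1) ^ (A₄ / 3) * (4 * A₂))
  rw [mul_zero] at h
  refine h.congr' ?_
  filter_upwards [eventually_gt_atTop 0] with x hx
  rw [largeRate, Real.mul_rpow (y := x ^ 2) (by positivity) (by positivity), ← Real.rpow_natCast x,
    ← Real.rpow_mul hx.le]
  have : x ^ (-(A₄ / 3)) = x ^ ((2 : ℕ) * (A₄ / 3)) * x ^ (-A₄) := by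
    rw [← Real.rpow_add hx]
    congr 1
    push_cast
    ring
  rw [this]
  ring

theorem tendsto_supersetRate {A₂ A₄ a : ℝ} (hA₄ : 0 < A₄) (ha : a < A₄) :
    Tendsto (supersetRate A₂ A₄ a) atTop (𝓝 0) := by
  have h := (tendsto_rpow_neg_atTop (y := A₄ - max a 0) (sub_pos.2 (max_lt ha hA₄))).const_mul
    (A₂ * 2)
  rw [mul_zero] at h
  refine h.congr' ?_
  filter_upwards [eventually_gt_atTop 0] with x hx
  have : x ^ (-(A₄ - max a 0)) = x ^ (-A₄) * x ^ max a 0 := by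
    rw [← Real.rpow_add hx]
    congr 1
    ring
  rw [supersetRate, this]
  ring

theorem tendsto_approxError {A₁ A₂ A₃ A₄ a c₀ : ℝ} (hA₄ : 0 < A₄) (ha : a < A₄) {x τ : ℕ → ℝ}
    (hx : Tendsto x atTop atTop) (hτ : Tendsto τ atTop (𝓝 0)) :
    Tendsto (fun k => approxError A₁ A₂ A₃ A₄ a c₀ (x k) (τ k)) atTop (𝓝 0) := by
  have hexp : ∀ c : ℝ, Tendsto (fun k => Real.exp (c * τ k)) atTop (𝓝 1) := by
    intro c
    have := (Real.continuous_exp.tendsto _).comp (hτ.const_mul c)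
    rwa [mul_zero, Real.exp_zero] at this
  have h := (hx.const_div_atTop 2).add (((((hτ.const_mul (3 * (64 + A₃) / min c₀ 1 ^ 2)).const_mul
    2).add (((hx.const_div_atTop (256 * Real.exp 1 / A₁)).const_mul (2 * Real.exp (1 / 2))).const_mul
    2)).add ((hexp (49 / (8 * c₀ ^ 2))).mul (((tendsto_largeRate (A₂ := A₂) hA₄).comp hx).const_mul
    (2 * Real.exp (1 / 2))))).add ((hexp (3 * (64 + A₃) / min c₀ 1 ^ 2)).mul
      (((tendsto_supersetRate (A₂ := A₂) hA₄ ha).comp hx).const_mul 2)))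
  simp only [mul_zero, add_zero] at h
  exact h

end SparseRegression

end

open SparseRegression

theorem corollary2 (A₁ A₂ A₃ A₄ : ℝ) (hA₁ : 0 < A₁) (hA₂ : 0 < A₂) (hA₃ : 0 < A₃)
    (hA₄ : 1 < A₄) :
    ∃ M₀ : ℝ, ∀ M ≥ M₀,
      ∀ (n p : ℕ → ℕ) (X : ∀ k, Matrix (Fin (n k)) (Fin (p k)) ℝ) (lam : ℕ → ℝ)
        (π : ℕ → ℕ → ℝ) (a c₀ : ℝ) (s : ℕ → ℝ)
        (bhat : ∀ (k : ℕ) (S : Finset (Fin (p k))),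
          EuclideanSpace ℝ (Fin (n k)) → EuclideanSpace ℝ S),
        Tendsto p atTop atTop →
        (∀ k, LambdaRange (X k) (lam k)) →
        (∀ k, IsDimPrior (p k) (π k)) →
        (∀ k, DimPriorDecay A₁ A₂ A₃ A₄ (p k) (π k)) →
        a < A₄ - 1 →
        (∀ k, s k ≤ (p k : ℝ) ^ a) →
        Tendsto (fun k => s k * lam k * Real.sqrt (Real.log (p k)) / colNorm (X k))
          atTop (𝓝 0) →
        0 < c₀ →
        (∀ k S Y, IsLeastSquares (X k) S Y (bhat k S Y)) →
        Tendsto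
          (fun k => ⨆ β₀ ∈ paramClass (X k) (lam k) A₄ M c₀ (s k),
            ∫⁻ Y, tvDist (posterior (X k) (π k) (lam k) Y)
              (normalOnModel (X k) (supp β₀) (bhat k (supp β₀) Y)) ∂(dataLaw (X k) β₀))
          atTop (𝓝 0) := by
  -- One more than K = 64 + A₃, so that the nonzero coordinates strictly exceed what the radius
  -- allows.
  refine ⟨65 + A₃, ?_⟩
  intro M hM n p X lam π a c₀ s bhat hp hr hπ hd ha hs hτ hc₀ hb
  have hA₄0 : 0 < A₄ := by linarith
  have haA : a < A₄ := by linarith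
  have hpR : Tendsto (fun k => (p k : ℝ)) atTop atTop := tendsto_natCast_atTop_atTop.comp hp
  have hτ' := hτ.abs
  rw [abs_zero] at hτ'
  have herr := ENNReal.tendsto_ofReal (tendsto_approxError (A₁ := A₁) (A₂ := A₂) (A₃ := A₃)
    (c₀ := c₀) hA₄0 haA hpR hτ')
  rw [ENNReal.ofReal_zero] at herr
  refine tendsto_of_tendsto_of_tendsto_of_le_of_le' tendsto_const_nhds herr
    (Eventually.of_forall fun _ => zero_le) ?_
  have e1 : ∀ᶠ k in atTop, A₂ * (p k : ℝ) ^ (-A₄) ≤ 1 / 4 := by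
    have h := ((tendsto_rpow_neg_atTop hA₄0).comp hpR).const_mul A₂
    rw [mul_zero] at h
    exact h.eventually_le_const (by norm_num)
  have e2 : ∀ᶠ k in atTop, largeRate A₂ A₄ (p k) ≤ 1 / 2 :=
    ((tendsto_largeRate hA₄0).comp hpR).eventually_le_const (by norm_num)
  have e3 : ∀ᶠ k in atTop, supersetRate A₂ A₄ a (p k) ≤ 1 / 2 :=
    ((tendsto_supersetRate hA₄0 haA).comp hpR).eventually_le_const (by norm_num)
  filter_upwards [e1, e2, e3, hpR.eventually_ge_atTop (256 * Real.exp 1 / A₁)] with k h1 h2 h3 h4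
  exact iSup₂_le fun β₀ hβ₀ => lintegral_tvDist_le_approxError hA₁ hA₂ hA₃ hA₄ hM (hr k) (hπ k)
    (hd k) (hs k) hc₀ h1 h2 h4 h3 hβ₀ (hb k (supp β₀))
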